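/- **Setting.** An uplink system has a base station (BS) with $L=L_xL_y\ge 1$ antennas, $K$ single-antenna users, and an RDARS with $N=N_xN_y$ elements, both uniform planar arrays with spacing $d_s$ at wavelength $\lambda$. The array response $\mathbf a_X(\psi^a,\psi^e)\in\mathbb C^X$, $X\in\{L,N\}$, has entries $\exp\{j2\pi\frac{d_s}{\lambda}(\lfloor\frac{x-1}{X_y}\rfloor\sin\psi^a\sin\psi^e+((x-1)\bmod X_y)\cos\psi^e)\}$, $x=1,\dots,X$. The mode-indicator matrix $\mathbf A\in\mathbb R^{a\times N}$ is such that $\mathbf A^H\mathbf A$ is diagonal with entries $a_n\in\{0,1\}$, exactly $a$ of them equal to $1$ (connected mode); the others are in reflection mode. $\mathbf\Theta=\mathrm{diag}(\boldsymbol\theta)$ with $|\boldsymbol\theta(n)|=1$ for reflecting elements, and $\mathbf B=(\mathbf I-\mathbf A^H\mathbf A)\mathbf\Theta$. With path losses $\beta,\alpha_k,\gamma_k\ge0$ and Rician factors $\delta,\epsilon_k\ge0$ the channels are $$\mathbf H=\sqrt{\tfrac{\beta}{\delta+1}}(\sqrt\delta\,\overline{\mathbf H}+\widetilde{\mathbf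 H}),\quad \mathbf h_k=\sqrt{\tfrac{\alpha_k}{\epsilon_k+1}}(\sqrt{\epsilon_k}\,\overline{\mathbf h}_k+\widetilde{\mathbf h}_k),\quad \mathbf d_k=\sqrt{\gamma_k}\,\widetilde{\mathbf d}_k,$$ where $\overline{\mathbf H}=\mathbf a_L(\phi^a_{RB},\phi^e_{RB})\mathbf a_N^H$, $\mathbf a_N=\mathbf a_N(\varphi^a_{RB},\varphi^e_{RB})$, $\overline{\mathbf h}_k=\mathbf a_N(\varphi^a_{UR,k},\varphi^e_{UR,k})$, and the entries of $\widetilde{\mathbf H},\widetilde{\mathbf h}_k,\widetilde{\mathbf d}_k$ are independent $\mathcal{CN}(0,1)$. The equivalent channel is $\mathbf q_k=[(\mathbf H\mathbf B\mathbf h_k+\mathbf d_k)^T\ (\mathbf A\mathbf h_k)^T]^T$. With orthonormal pilots $\mathbf s_1,\dots,\mathbf s_K\in\mathbb C^\tau$ of power $p_p>0$ the pilot observation is $\mathbf y_k=\frac1{\sqrt{\tau p_p}}\mathbf Y_p\mathbf s_k=\mathbf q_k+\frac{1}{\sqrt{\tau p_p}}\mathbf N\mathbf s_k$, $\mathbf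 Y_p=\sqrt{\tau p_p}\,[\mathbf q_1,\dots,\mathbf q_K][\mathbf s_1,\dots,\mathbf s_K]^H+\mathbf N$, where the noise $\mathbf N$ is independent of the channels and has independent entries, $\mathcal{CN}(0,\sigma_B^2)$ in the $L$ BS rows and $\mathcal{CN}(0,\sigma_R^2)$ in the $a$ RDARS rows ($\sigma_B,\sigma_R>0$). Let $\hat{\mathbf q}_k=\mathbb E[\mathbf q_k]+\mathbb C[\mathbf q_k,\mathbf y_k]\,\mathbb C[\mathbf y_k,\mathbf y_k]^{-1}(\mathbf y_k-\mathbb E[\mathbf y_k])$ be the LMMSE estimate ($\mathbb C$ is the covariance). For transmit powers $p_i\ge0$, maximum ratio combining with $\hat{\mathbf q}_k$ and the use-and-then-forget bound give $$\mathrm{SINR}_k=\frac{p_k|\mathbb E[\hat{\mathbf q}_k^H\mathbf q_k]|^2}{p_k(\mathbb E[|\hat{\mathbf q}_k^H\mathbf q_k|^2]-|\mathbb E[\hat{\mathbf q}_k^H\mathbf q_k]|^2)+\sum_{i\ne k}p_i\mathbb E[|\hat{\mathbf q}_k^H\mathbf q_i|^2]+\mathbb E[\hat{\mathbf q}_k^H\mathrm{blk}(\sigma_B^2\mathbf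 I_L,\sigma_R^2\mathbf I_a)\hat{\mathbf q}_k]},\qquad R_k=\frac{\tau_c-\tau}{\tau}\log(1+\mathrm{SINR}_k).$$ **Notation.** Put $M=N-a$, $s_B=\frac{\sigma_B^2}{\tau p_p}$, $s_R=\frac{\sigma_R^2}{\tau p_p}$, $c_k=\frac{\beta\alpha_k}{(\delta+1)(\epsilon_k+1)}$, $d_k=\frac{\alpha_k}{\epsilon_k+1}$, $a_{k1}=Mc_k\delta$, $a_{k2}=Mc_k(\epsilon_k+1)+\gamma_k$, $a_{k3}=\frac{a_{k1}s_B}{(a_{k2}+s_B)(a_{k2}+s_B+La_{k1})}$, $a_{k4}=\frac{a_{k2}}{a_{k2}+s_B}$, $e_{k1}=a_{k3}+a_{k4}$, $e_{k2}=La_{k3}+a_{k4}$, $e_{k3}=La_{k3}^2+2a_{k3}a_{k4}+a_{k4}^2$, $e_{k4}=\frac{d_k}{d_k+s_R}$, and $$f_k=\sum_{n=1}^N(1-a_n)e^{j(\zeta^k_n+\arg\boldsymbol\theta(n))},\qquad g_{k,i}=\sum_{n=1}^Na_ne^{j\varsigma_n^{k,i}},$$ $\zeta_n^k=2\pi\frac{d_s}{\lambda}[\lfloor\frac{n-1}{N_y}\rfloor(\sin\varphi^e_{UR,k}\sin\varphi^a_{UR,k}-\sin\varphi^e_{RB}\sin\varphi^a_{RB})+((n-1)\bmod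 N_y)(\cos\varphi^e_{UR,k}-\cos\varphi^e_{RB})]$, $\varsigma_n^{k,i}=2\pi\frac{d_s}{\lambda}[\lfloor\frac{n-1}{N_y}\rfloor(\sin\varphi^e_{UR,i}\sin\varphi^a_{UR,i}-\sin\varphi^e_{UR,k}\sin\varphi^a_{UR,k})+((n-1)\bmod N_y)(\cos\varphi^e_{UR,i}-\cos\varphi^e_{UR,k})]$. **Theorem 2.** All expectations above are finite, $\mathbb C[\mathbf y_k,\mathbf y_k]$ is invertible, $f_k=\mathbf a_N^H\mathbf B\overline{\mathbf h}_k$, $g_{k,i}=\overline{\mathbf h}_k^H\mathbf A^H\mathbf A\overline{\mathbf h}_i$, and for every user $k$ $$\mathrm{SINR}_k=\frac{p_kE_k^{signal}}{p_kE_k^{leak}+\sum_{i\ne k}p_iI_{ki}+E_k^{noise}},$$ hence $R_k=\frac{\tau_c-\tau}{\tau}\log\bigl(1+\frac{p_kE_k^{signal}}{p_kE_k^{leak}+\sum_{i\ne k}p_iI_{ki}+E_k^{noise}}\bigr)$. Here $E_k^{signal}=|\mathbb E[\hat{\mathbf q}_k^H\mathbf q_k]|^2$, $E_k^{leak}=\mathbb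 E[|\hat{\mathbf q}_k^H\mathbf q_k|^2]-|\mathbb E[\hat{\mathbf q}_k^H\mathbf q_k]|^2$, $I_{ki}=\mathbb E[|\hat{\mathbf q}_k^H\mathbf q_i|^2]$ $(i\neq k)$ and $E_k^{noise}=\mathbb E[\hat{\mathbf q}_k^H\mathrm{blk}(\sigma_B^2\mathbf I_L,\sigma_R^2\mathbf I_a)\hat{\mathbf q}_k]$ have the closed forms, with $P_k=L[|f_k|^2c_k\delta\epsilon_k+Mc_k\delta e_{k2}+(Mc_k(\epsilon_k+1)+\gamma_k)e_{k1}]$ and $Q_k=a[d_k\epsilon_k+e_{k4}d_k]$, $$E_k^{signal}=(P_k+Q_k)^2,\qquad E_k^{noise}=\sigma_B^2P_k+\sigma_R^2Q_k,$$ $$\begin{aligned}E_k^{leak}={}&L|f_k|^2c_k^2\delta\epsilon_k[M(L\delta+\epsilon_k+1)(e_{k2}^2+1)+2(Le_{k1}+e_{k2})(e_{k2}+1)]+L|f_k|^2c_k\delta\epsilon_k[\gamma_k+(\gamma_k+s_B)e_{k2}^2]\\&+L^2M^2c_k^2\delta^2e_{k2}^2+2LM^2c_k^2\delta(\epsilon_k+1)e_{k2}^2+LM^2c_k^2(\epsilon_k+1)^2e_{k3}+L^2Mc_k^2[(2\epsilon_k+1)e_{k1}^2+2\delta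 e_{k1}e_{k2}]\\&+LMc_k[c_k(2\delta e_{k2}^2+(2\epsilon_k+1)e_{k3})+(2\gamma_k+s_B)(\delta e_{k2}^2+(\epsilon_k+1)e_{k3})]+L\gamma_k(\gamma_k+s_B)e_{k3}\\&+ad_k^2\epsilon_k+ad_k^2\epsilon_ke_{k4}^2+ad_k^2e_{k4}^2+as_Rd_ke_{k4}^2(\epsilon_k+1),\end{aligned}$$ $$\begin{aligned}I_{ki}={}&L^2|f_k|^2|f_i|^2c_kc_i\delta^2\epsilon_k\epsilon_i+L|f_k|^2c_k\delta\epsilon_k[c_i(LM\delta+M\epsilon_i+M+2Le_{k1})+\gamma_i]\\&+L|f_i|^2c_i\delta\epsilon_i[c_ke_{k2}(LM\delta e_{k2}+M\epsilon_ke_{k2}+Me_{k2}+2Le_{k1})+(\gamma_k+s_B)e_{k2}^2]+L^2M^2c_kc_i\delta^2e_{k2}^2\\&+LM^2c_kc_i[\delta(\epsilon_k+\epsilon_i+2)e_{k2}^2+(\epsilon_k+1)(\epsilon_i+1)e_{k3}]+L^2Mc_kc_ie_{k1}[(\epsilon_k+\epsilon_i+1)e_{k1}+2\delta e_{k2}]\\&+L^2c_kc_i\epsilon_k\epsilon_ie_{k1}\bigl[|\overline{\mathbf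 h}_k^H(\mathbf I-\mathbf A^H\mathbf A)\overline{\mathbf h}_i|^2e_{k1}+2\delta\,\mathrm{Re}\bigl(f_k^{*}f_i\,\overline{\mathbf h}_i^H(\mathbf I-\mathbf A^H\mathbf A)\overline{\mathbf h}_k\bigr)\bigr]+L\gamma_i(\gamma_k+s_B)e_{k3}\\&+LM[(\gamma_k+s_B)c_i(\delta e_{k2}^2+(\epsilon_i+1)e_{k3})+\gamma_ic_k(\delta e_{k2}^2+(\epsilon_k+1)e_{k3})]+d_kd_i\epsilon_k\epsilon_i|g_{k,i}|^2\\&+ad_i[d_k\epsilon_k+(\epsilon_i+1)(d_k+s_R)e_{k4}^2]+2\,\mathrm{Re}\bigl(L\sqrt{c_kc_id_kd_i}\,\epsilon_k\epsilon_i\bigl[\delta f_k^{*}f_i+e_{k1}(\overline{\mathbf h}_k^H\overline{\mathbf h}_i-g_{k,i})\bigr]g_{i,k}\bigr).\end{aligned}$$ The denominator is positive if $\gamma_k>0$, or if $N,\alpha_k,\beta>0$ (a ratio with denominator $0$ is read as $0$). Special cases. For $a=0$ (RIS-aided system) the formula holds with $M=N$, $f_k=\mathbf a_N^H\mathbf\Theta\overline{\mathbf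 h}_k$, $\overline{\mathbf h}_k^H(\mathbf I-\mathbf A^H\mathbf A)\overline{\mathbf h}_i=\overline{\mathbf h}_k^H\overline{\mathbf h}_i$ and without the terms in $d_k,d_i$. For $a=N$ (distributed antenna system), with $e_k=\gamma_k/(\gamma_k+s_B)$, it reads $$\mathrm{SINR}_k=\frac{p_k[L\gamma_ke_k+Nd_k(\epsilon_k+e_{k4})]^2}{p_kV_k+\sum_{i\ne k}p_iW_{ki}+\sigma_B^2L\gamma_ke_k+\sigma_R^2Nd_k(\epsilon_k+e_{k4})},$$ $V_k=L\gamma_k^2e_k+Nd_k^2\epsilon_k+Nd_k(\epsilon_k+1)(d_k+s_R)e_{k4}^2$, $W_{ki}=L\gamma_i\gamma_ke_k+d_kd_i\epsilon_k\epsilon_i|\overline{\mathbf h}_k^H\overline{\mathbf h}_i|^2+Nd_i[d_k\epsilon_k+(\epsilon_i+1)(d_k+s_R)e_{k4}^2]$. For $N=a=0$ (conventional massive MIMO) it reads $\mathrm{SINR}_k=\dfrac{p_kL\gamma_ke_k}{\sum_{i=1}^Kp_i\gamma_i+\sigma_B^2}$. -/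

import Mathlib

namespace RDARS

noncomputable section

open MeasureTheory ProbabilityTheory Matrix
open scoped NNReal ComplexConjugate

/-- The circularly symmetric complex Gaussian law with mean zero and variance `v`:
real and imaginary part are independent real Gaussians of variance `v / 2`. -/
def complexGaussian (v : ℝ≥0) : Measure ℂ :=
  ((gaussianReal 0 (v / 2)).prod (gaussianReal 0 (v / 2))).map
    (fun z : ℝ × ℝ => (z.1 : ℂ) + z.2 * Complex.I)

/-- Response of a uniform planar array with `X` elements, `Xy` of them in each row, for azimuth `ψa`
and elevation `ψe`; the elements are numbered from `0`, and `ds`, `lam` are the element spacing and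
the wavelength. -/
def arrayResponse (ds lam : ℝ) (X Xy : ℕ) (ψa ψe : ℝ) (x : Fin X) : ℂ :=
  Complex.exp (Complex.I * ((2 * Real.pi * (ds / lam) *
    (((x.val / Xy : ℕ) : ℝ) * (Real.sin ψa * Real.sin ψe)
      + ((x.val % Xy : ℕ) : ℝ) * Real.cos ψe) : ℝ) : ℂ))

/-- The deterministic (statistical) parameters of an uplink system with `K` single-antenna users, a
base station (BS) with `L` antennas, an RDARS with `N` elements of which `a` are in connected mode,
and pilot sequences of length `τ`. -/
structure System (K L N a τ : ℕ) where
  /-- Sizes `Lx × Ly` and `Nx × Ny` of the planar arrays at the BS and at the RDARS. -/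
  (Lx Ly Nx Ny : ℕ)
  L_eq : L = Lx * Ly
  N_eq : N = Nx * Ny
  L_pos : 0 < L
  /-- Element spacing and wavelength. -/
  (ds lam : ℝ)
  ds_pos : 0 < ds
  lam_pos : 0 < lam
  /-- Azimuth and elevation of the arrival at the BS from the RDARS. -/
  (arrAz arrEl : ℝ)
  /-- Azimuth and elevation of the departure from the RDARS towards the BS. -/
  (depAz depEl : ℝ)
  /-- Azimuth and elevation of the arrival at the RDARS from each user. -/
  (userAz userEl : Fin K → ℝ)
  /-- Path loss of the RDARS-BS link. -/
  β : ℝ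
  /-- Path losses of the user-RDARS links. -/
  α : Fin K → ℝ
  /-- Path losses of the user-BS links. -/
  γ : Fin K → ℝ
  β_nonneg : 0 ≤ β
  α_nonneg : ∀ k, 0 ≤ α k
  γ_nonneg : ∀ k, 0 ≤ γ k
  /-- Rician factor of the RDARS-BS link. -/
  δ : ℝ
  /-- Rician factors of the user-RDARS links. -/
  ε : Fin K → ℝ
  δ_nonneg : 0 ≤ δ
  ε_nonneg : ∀ k, 0 ≤ ε k
  /-- Noise standard deviations at the BS antennas and at the connected RDARS elements. -/
  (σB σR : ℝ)
  σB_pos : 0 < σB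
  σR_pos : 0 < σR
  /-- Transmit powers of the users. -/
  p : Fin K → ℝ
  p_nonneg : ∀ k, 0 ≤ p k
  /-- Average transmit power of each pilot symbol. -/
  pp : ℝ
  pp_pos : 0 < pp
  /-- The pilot sequences are the columns of `pilots`, and they are orthonormal. -/
  pilots : Matrix (Fin τ) (Fin K) ℂ
  pilots_orth : pilotsᴴ * pilots = 1
  /-- Length of the channel coherence interval. -/
  τc : ℕ
  τ_le : τ ≤ τc
  /-- The mode indicator matrix: `Aᵀ A` is diagonal with entries `0` (reflection mode) and `1`
  (connected mode), and exactly `a` elements are in connected mode. -/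
  A : Matrix (Fin a) (Fin N) ℝ
  A_diag : (Aᵀ * A).IsDiag
  A_mode : ∀ n, (Aᵀ * A) n n = 0 ∨ (Aᵀ * A) n n = 1
  A_card : Nat.card {n : Fin N // (Aᵀ * A) n n = 1} = a
  /-- The reflection coefficients; those of the reflecting elements are pure phase shifts. -/
  θ : Fin N → ℂ
  θ_unit : ∀ n, (Aᵀ * A) n n = 0 → ‖θ n‖ = 1

/-- The random quantities: the small-scale (non-line-of-sight) components of the RDARS-BS, user-RDARS
and user-BS channels, and the noise during pilot transmission at the BS antennas and at the
connected RDARS elements. -/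
structure Randomness (K L N a τ : ℕ) (Ω : Type*) where
  Htil : Ω → Matrix (Fin L) (Fin N) ℂ
  htil : Fin K → Ω → Fin N → ℂ
  dtil : Fin K → Ω → Fin L → ℂ
  NB : Ω → Matrix (Fin L) (Fin τ) ℂ
  NR : Ω → Matrix (Fin a) (Fin τ) ℂ

/-- Index of all the scalar entries of the random quantities. -/
abbrev Src (K L N a τ : ℕ) : Type :=
  (Fin L × Fin N) ⊕ (Fin K × Fin N) ⊕ (Fin K × Fin L) ⊕ (Fin L × Fin τ) ⊕ (Fin a × Fin τ)

section
variable {K L N a τ : ℕ} {Ω : Type*}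

/-- The scalar entries of the random quantities. -/
def Randomness.entry (X : Randomness K L N a τ Ω) : Src K L N a τ → Ω → ℂ
  | .inl s => fun ω => X.Htil ω s.1 s.2
  | .inr (.inl s) => fun ω => X.htil s.1 ω s.2
  | .inr (.inr (.inl s)) => fun ω => X.dtil s.1 ω s.2
  | .inr (.inr (.inr (.inl s))) => fun ω => X.NB ω s.1 s.2
  | .inr (.inr (.inr (.inr s))) => fun ω => X.NR ω s.1 s.2

namespace System
variable (S : System K L N a τ)

/-- Variances of the scalar entries: `1` for the fading, `σB²` and `σR²` for the noise. -/
def entryVar : Src K L N a τ → ℝ≥0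
  | .inl _ => 1
  | .inr (.inl _) => 1
  | .inr (.inr (.inl _)) => 1
  | .inr (.inr (.inr (.inl _))) => (S.σB ^ 2).toNNReal
  | .inr (.inr (.inr (.inr _))) => (S.σR ^ 2).toNNReal

/-- All scalar entries are mutually independent centered circular complex Gaussians. -/
structure IsModel [MeasurableSpace Ω] (X : Randomness K L N a τ Ω) (μ : Measure Ω) : Prop where
  law : ∀ s, HasLaw (X.entry s) (complexGaussian (S.entryVar s)) μ
  indep : iIndepFun X.entry μ

/-! ### Channels -/

/-- The indicator matrix as a complex matrix. -/
def Ac : Matrix (Fin a) (Fin N) ℂ := S.A.map (fun x : ℝ => (x : ℂ))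

/-- `I - Aᴴ A`, the projection onto the reflecting elements. -/
def refl : Matrix (Fin N) (Fin N) ℂ := 1 - S.Acᴴ * S.Ac

/-- `B = (I - Aᴴ A) Θ` with `Θ = diag θ`. -/
def B : Matrix (Fin N) (Fin N) ℂ := S.refl * Matrix.diagonal S.θ

def aL : Fin L → ℂ := arrayResponse S.ds S.lam L S.Ly S.arrAz S.arrEl

def aN : Fin N → ℂ := arrayResponse S.ds S.lam N S.Ny S.depAz S.depEl

/-- Line-of-sight component `a_L a_Nᴴ` of the RDARS-BS link. -/
def Hbar : Matrix (Fin L) (Fin N) ℂ := Matrix.vecMulVec S.aL (star S.aN)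

/-- Line-of-sight component of the user-RDARS link. -/
def hbar (k : Fin K) : Fin N → ℂ :=
  arrayResponse S.ds S.lam N S.Ny (S.userAz k) (S.userEl k)

variable (X : Randomness K L N a τ Ω)

/-- The RDARS-BS channel (Rician). -/
def H (ω : Ω) : Matrix (Fin L) (Fin N) ℂ :=
  (Real.sqrt (S.β / (S.δ + 1)) : ℂ) • ((Real.sqrt S.δ : ℂ) • S.Hbar + X.Htil ω)

/-- The user-RDARS channel (Rician). -/
def h (k : Fin K) (ω : Ω) : Fin N → ℂ :=
  (Real.sqrt (S.α k / (S.ε k + 1)) : ℂ) •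
    ((Real.sqrt (S.ε k) : ℂ) • S.hbar k + X.htil k ω)

/-- The user-BS channel (Rayleigh). -/
def d (k : Fin K) (ω : Ω) : Fin L → ℂ := (Real.sqrt (S.γ k) : ℂ) • X.dtil k ω

/-- The equivalent channel `q_k = [H B h_k + d_k; A h_k]` of user `k`. -/
def q (k : Fin K) (ω : Ω) : Fin L ⊕ Fin a → ℂ :=
  Sum.elim ((S.H X ω * S.B) *ᵥ S.h X k ω + S.d X k ω) (S.Ac *ᵥ S.h X k ω)

/-! ### Pilot transmission and LMMSE estimation -/

/-- Received pilot signal `Y_p = √(τ p_p) Q Sᴴ + N`. -/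
def Yp (ω : Ω) : Matrix (Fin L ⊕ Fin a) (Fin τ) ℂ :=
  (Real.sqrt (τ * S.pp) : ℂ) • ((Matrix.of fun j k => S.q X k ω j) * S.pilotsᴴ)
    + Matrix.of (fun j t => Sum.elim (fun l => X.NB ω l t) (fun m => X.NR ω m t) j)

/-- Projected pilot observation `y_{k,p} = Y_p s_k / √(τ p_p)`. -/
def y (k : Fin K) (ω : Ω) : Fin L ⊕ Fin a → ℂ :=
  (1 / (Real.sqrt (τ * S.pp) : ℂ)) • (S.Yp X ω *ᵥ fun t => S.pilots t k)

end System

/-- Entrywise expectation of a random vector. -/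
def mean [MeasurableSpace Ω] {ι : Type*} (μ : Measure Ω) (U : Ω → ι → ℂ) : ι → ℂ :=
  fun i => ∫ ω, U ω i ∂μ

/-- Covariance matrix `E[(U - E U) (V - E V)ᴴ]` of two random vectors. -/
def cov [MeasurableSpace Ω] {ι κ : Type*} (μ : Measure Ω) (U : Ω → ι → ℂ) (V : Ω → κ → ℂ) :
    Matrix ι κ ℂ :=
  Matrix.of fun i j => ∫ ω, (U ω i - mean μ U i) * conj (V ω j - mean μ V j) ∂μ

namespace System
variable (S : System K L N a τ) [MeasurableSpace Ω] (X : Randomness K L N a τ Ω) (μ : Measure Ω)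

/-- LMMSE estimate `E[q_k] + C[q_k, y_k] C[y_k, y_k]⁻¹ (y_k - E[y_k])` of the equivalent channel. -/
def qhat (k : Fin K) (ω : Ω) : Fin L ⊕ Fin a → ℂ :=
  mean μ (S.q X k) +
    (cov μ (S.q X k) (S.y X k) * (cov μ (S.y X k) (S.y X k))⁻¹) *ᵥ
      (S.y X k ω - mean μ (S.y X k))

/-- The scalar `q̂_kᴴ q_i`: gain of user `i` after maximum ratio combining for user `k`. -/
def gain (k i : Fin K) (ω : Ω) : ℂ := star (S.qhat X μ k ω) ⬝ᵥ S.q X i ω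

/-- The noise covariance `blk(σB² I_L, σR² I_a)`. -/
def noiseCov : Matrix (Fin L ⊕ Fin a) (Fin L ⊕ Fin a) ℂ :=
  Matrix.fromBlocks ((S.σB ^ 2 : ℂ) • 1) 0 0 ((S.σR ^ 2 : ℂ) • 1)

/-- The scalar `q̂_kᴴ blk(σB² I_L, σR² I_a) q̂_k`. -/
def noiseForm (k : Fin K) (ω : Ω) : ℂ :=
  star (S.qhat X μ k ω) ⬝ᵥ (S.noiseCov *ᵥ S.qhat X μ k ω)

/-- The use-and-then-forget SINR of user `k`. -/
def sinr (k : Fin K) : ℝ :=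
  S.p k * ‖∫ ω, S.gain X μ k k ω ∂μ‖ ^ 2 /
    (S.p k * ((∫ ω, ‖S.gain X μ k k ω‖ ^ 2 ∂μ) - ‖∫ ω, S.gain X μ k k ω ∂μ‖ ^ 2)
      + ∑ i ∈ Finset.univ.erase k, S.p i * ∫ ω, ‖S.gain X μ k i ω‖ ^ 2 ∂μ
      + (∫ ω, S.noiseForm X μ k ω ∂μ).re)

/-- The achievable rate of user `k`, with logarithms to base `b`. -/
def rate (b : ℝ) (k : Fin K) : ℝ :=
  ((S.τc : ℝ) - τ) / τ * Real.logb b (1 + S.sinr X μ k)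

end System

/-! ### The closed form: functions of the statistical parameters only -/

namespace System
variable (S : System K L N a τ)

/-- Effective noise level `σB² / (τ p_p)` of the pilot observation at the BS. -/
def sB : ℝ := S.σB ^ 2 / (τ * S.pp)

/-- Effective noise level `σR² / (τ p_p)` of the pilot observation at the RDARS. -/
def sR : ℝ := S.σR ^ 2 / (τ * S.pp)

def c (k : Fin K) : ℝ := S.β * S.α k / ((S.δ + 1) * (S.ε k + 1))

/-- The constant `d_k = α_k / (ε_k + 1)` (not the channel `d`). -/
def dc (k : Fin K) : ℝ := S.α k / (S.ε k + 1)

def a1 (k : Fin K) : ℝ := ((N : ℝ) - a) * S.c k * S.δ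

def a2 (k : Fin K) : ℝ := ((N : ℝ) - a) * S.c k * (S.ε k + 1) + S.γ k

def a3 (k : Fin K) : ℝ :=
  S.a1 k * S.sB / ((S.a2 k + S.sB) * ((S.a2 k + S.sB) + L * S.a1 k))

def a4 (k : Fin K) : ℝ := S.a2 k / (S.a2 k + S.sB)

def a5 (k : Fin K) : ℝ := S.dc k / (S.dc k + S.sR)

def e1 (k : Fin K) : ℝ := S.a3 k + S.a4 k

def e2 (k : Fin K) : ℝ := L * S.a3 k + S.a4 k

def e3 (k : Fin K) : ℝ := L * S.a3 k ^ 2 + 2 * S.a3 k * S.a4 k + S.a4 k ^ 2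

def e4 (k : Fin K) : ℝ := S.a5 k

/-- `a_n = (Aᴴ A)(n, n)`. -/
def mode (n : Fin N) : ℝ := (S.Aᵀ * S.A) n n

def ζ (k : Fin K) (n : Fin N) : ℝ :=
  2 * Real.pi * (S.ds / S.lam) *
    (((n.val / S.Ny : ℕ) : ℝ) *
        (Real.sin (S.userEl k) * Real.sin (S.userAz k) - Real.sin S.depEl * Real.sin S.depAz)
      + ((n.val % S.Ny : ℕ) : ℝ) * (Real.cos (S.userEl k) - Real.cos S.depEl))

def ς (k i : Fin K) (n : Fin N) : ℝ :=
  2 * Real.pi * (S.ds / S.lam) *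
    (((n.val / S.Ny : ℕ) : ℝ) *
        (Real.sin (S.userEl i) * Real.sin (S.userAz i)
          - Real.sin (S.userEl k) * Real.sin (S.userAz k))
      + ((n.val % S.Ny : ℕ) : ℝ) * (Real.cos (S.userEl i) - Real.cos (S.userEl k)))

def f (k : Fin K) : ℂ :=
  ∑ n, ((1 - S.mode n : ℝ) : ℂ) *
    Complex.exp (Complex.I * ((S.ζ k n + Complex.arg (S.θ n) : ℝ) : ℂ))

def g (k i : Fin K) : ℂ :=
  ∑ n, (S.mode n : ℂ) * Complex.exp (Complex.I * (S.ς k i n : ℂ))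

/-- `h̄_kᴴ (I - Aᴴ A) h̄_i`. -/
def losRefl (k i : Fin K) : ℂ := star (S.hbar k) ⬝ᵥ (S.refl *ᵥ S.hbar i)

/-- `h̄_kᴴ h̄_i`. -/
def losAll (k i : Fin K) : ℂ := star (S.hbar k) ⬝ᵥ S.hbar i

def Esignal (k : Fin K) : ℝ :=
  (L * (‖S.f k‖ ^ 2 * S.c k * S.δ * S.ε k + ((N : ℝ) - a) * S.c k * S.δ * S.e2 k
        + (((N : ℝ) - a) * S.c k * (S.ε k + 1) + S.γ k) * S.e1 k)
    + a * (S.dc k * S.ε k + S.e4 k * S.dc k)) ^ 2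

def Enoise (k : Fin K) : ℝ :=
  S.σB ^ 2 * L * (‖S.f k‖ ^ 2 * S.c k * S.δ * S.ε k + ((N : ℝ) - a) * S.c k * S.δ * S.e2 k
        + (((N : ℝ) - a) * S.c k * (S.ε k + 1) + S.γ k) * S.e1 k)
    + S.σR ^ 2 * a * (S.dc k * S.ε k + S.e4 k * S.dc k)

def Eleak (k : Fin K) : ℝ :=
  L * ‖S.f k‖ ^ 2 * S.c k ^ 2 * S.δ * S.ε k *
      (((N : ℝ) - a) * (L * S.δ + S.ε k + 1) * (S.e2 k ^ 2 + 1)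
        + 2 * (L * S.e1 k + S.e2 k) * (S.e2 k + 1))
    + L * ‖S.f k‖ ^ 2 * S.c k * S.δ * S.ε k * (S.γ k + (S.γ k + S.sB) * S.e2 k ^ 2)
    + (L : ℝ) ^ 2 * ((N : ℝ) - a) ^ 2 * S.c k ^ 2 * S.δ ^ 2 * S.e2 k ^ 2
    + 2 * L * ((N : ℝ) - a) ^ 2 * S.c k ^ 2 * S.δ * (S.ε k + 1) * S.e2 k ^ 2
    + L * ((N : ℝ) - a) ^ 2 * S.c k ^ 2 * (S.ε k + 1) ^ 2 * S.e3 k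
    + (L : ℝ) ^ 2 * ((N : ℝ) - a) * S.c k ^ 2 *
        ((2 * S.ε k + 1) * S.e1 k ^ 2 + 2 * S.δ * S.e1 k * S.e2 k)
    + L * ((N : ℝ) - a) * S.c k *
        (S.c k * (2 * S.δ * S.e2 k ^ 2 + (2 * S.ε k + 1) * S.e3 k)
          + (2 * S.γ k + S.sB) * (S.δ * S.e2 k ^ 2 + (S.ε k + 1) * S.e3 k))
    + L * S.γ k * (S.γ k + S.sB) * S.e3 k
    + a * S.dc k ^ 2 * S.ε k + a * S.dc k ^ 2 * S.ε k * S.e4 k ^ 2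
    + a * S.dc k ^ 2 * S.e4 k ^ 2
    + a * S.sR * S.dc k * S.e4 k ^ 2 * (S.ε k + 1)

/-- The interference term `I_{ki}`. -/
def Iint (k i : Fin K) : ℝ :=
  (L : ℝ) ^ 2 * ‖S.f k‖ ^ 2 * ‖S.f i‖ ^ 2 * S.c k * S.c i * S.δ ^ 2 * S.ε k * S.ε i
    + L * ‖S.f k‖ ^ 2 * S.c k * S.δ * S.ε k *
        (S.c i * (L * ((N : ℝ) - a) * S.δ + ((N : ℝ) - a) * S.ε i + ((N : ℝ) - a)
          + 2 * L * S.e1 k) + S.γ i)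
    + L * ‖S.f i‖ ^ 2 * S.c i * S.δ * S.ε i *
        (S.c k * S.e2 k * (L * ((N : ℝ) - a) * S.δ * S.e2 k + ((N : ℝ) - a) * S.ε k * S.e2 k
          + ((N : ℝ) - a) * S.e2 k + 2 * L * S.e1 k) + (S.γ k + S.sB) * S.e2 k ^ 2)
    + (L : ℝ) ^ 2 * ((N : ℝ) - a) ^ 2 * S.c k * S.c i * S.δ ^ 2 * S.e2 k ^ 2
    + L * ((N : ℝ) - a) ^ 2 * S.c k * S.c i *
        (S.δ * (S.ε k + S.ε i + 2) * S.e2 k ^ 2 + (S.ε k + 1) * (S.ε i + 1) * S.e3 k)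
    + (L : ℝ) ^ 2 * ((N : ℝ) - a) * S.c k * S.c i * S.e1 k *
        ((S.ε k + S.ε i + 1) * S.e1 k + 2 * S.δ * S.e2 k)
    + (L : ℝ) ^ 2 * S.c k * S.c i * S.ε k * S.ε i * S.e1 k *
        (‖S.losRefl k i‖ ^ 2 * S.e1 k
          + 2 * S.δ * (conj (S.f k) * S.f i * S.losRefl i k).re)
    + L * S.γ i * (S.γ k + S.sB) * S.e3 k
    + L * ((N : ℝ) - a) *
        ((S.γ k + S.sB) * S.c i * (S.δ * S.e2 k ^ 2 + (S.ε i + 1) * S.e3 k)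
          + S.γ i * S.c k * (S.δ * S.e2 k ^ 2 + (S.ε k + 1) * S.e3 k))
    + S.dc k * S.dc i * S.ε k * S.ε i * ‖S.g k i‖ ^ 2
    + a * S.dc i * (S.dc k * S.ε k + (S.ε i + 1) * (S.dc k + S.sR) * S.e4 k ^ 2)
    + 2 * (((L * Real.sqrt (S.c k * S.c i * S.dc k * S.dc i) * S.δ * S.ε k * S.ε i : ℝ) : ℂ)
            * conj (S.f k) * S.f i * S.g i k
          + ((L * Real.sqrt (S.c k * S.c i * S.dc k * S.dc i) * S.ε k * S.ε i * S.e1 k : ℝ) : ℂ)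
            * (S.losAll k i - S.g k i) * S.g i k).re

/-- Denominator of the closed-form SINR. -/
def closedDenom (k : Fin K) : ℝ :=
  S.p k * S.Eleak k + ∑ i ∈ Finset.univ.erase k, S.p i * S.Iint k i + S.Enoise k

/-- The closed-form SINR. -/
def closedSinr (k : Fin K) : ℝ := S.p k * S.Esignal k / S.closedDenom k

/-! ### Special cases, written out -/

/-- `a_Nᴴ Θ h̄_k`, which replaces `f_k` when every element reflects. -/
def fRis (k : Fin K) : ℂ := star S.aN ⬝ᵥ (Matrix.diagonal S.θ *ᵥ S.hbar k)

/-- Received power `E‖ĥ_{B,k}‖²` in the RIS-aided system. -/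
def risPower (k : Fin K) : ℝ :=
  L * (‖S.fRis k‖ ^ 2 * S.c k * S.δ * S.ε k + N * S.c k * S.δ * S.e2 k
    + (N * S.c k * (S.ε k + 1) + S.γ k) * S.e1 k)

def risLeak (k : Fin K) : ℝ :=
  L * ‖S.fRis k‖ ^ 2 * S.c k ^ 2 * S.δ * S.ε k *
      (N * (L * S.δ + S.ε k + 1) * (S.e2 k ^ 2 + 1)
        + 2 * (L * S.e1 k + S.e2 k) * (S.e2 k + 1))
    + L * ‖S.fRis k‖ ^ 2 * S.c k * S.δ * S.ε k * (S.γ k + (S.γ k + S.sB) * S.e2 k ^ 2)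
    + (L : ℝ) ^ 2 * (N : ℝ) ^ 2 * S.c k ^ 2 * S.δ ^ 2 * S.e2 k ^ 2
    + 2 * L * (N : ℝ) ^ 2 * S.c k ^ 2 * S.δ * (S.ε k + 1) * S.e2 k ^ 2
    + L * (N : ℝ) ^ 2 * S.c k ^ 2 * (S.ε k + 1) ^ 2 * S.e3 k
    + (L : ℝ) ^ 2 * N * S.c k ^ 2 * ((2 * S.ε k + 1) * S.e1 k ^ 2 + 2 * S.δ * S.e1 k * S.e2 k)
    + L * N * S.c k *
        (S.c k * (2 * S.δ * S.e2 k ^ 2 + (2 * S.ε k + 1) * S.e3 k)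
          + (2 * S.γ k + S.sB) * (S.δ * S.e2 k ^ 2 + (S.ε k + 1) * S.e3 k))
    + L * S.γ k * (S.γ k + S.sB) * S.e3 k

def risInt (k i : Fin K) : ℝ :=
  (L : ℝ) ^ 2 * ‖S.fRis k‖ ^ 2 * ‖S.fRis i‖ ^ 2 * S.c k * S.c i * S.δ ^ 2 * S.ε k * S.ε i
    + L * ‖S.fRis k‖ ^ 2 * S.c k * S.δ * S.ε k *
        (S.c i * (L * N * S.δ + N * S.ε i + N + 2 * L * S.e1 k) + S.γ i)
    + L * ‖S.fRis i‖ ^ 2 * S.c i * S.δ * S.ε i *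
        (S.c k * S.e2 k * (L * N * S.δ * S.e2 k + N * S.ε k * S.e2 k + N * S.e2 k
          + 2 * L * S.e1 k) + (S.γ k + S.sB) * S.e2 k ^ 2)
    + (L : ℝ) ^ 2 * (N : ℝ) ^ 2 * S.c k * S.c i * S.δ ^ 2 * S.e2 k ^ 2
    + L * (N : ℝ) ^ 2 * S.c k * S.c i *
        (S.δ * (S.ε k + S.ε i + 2) * S.e2 k ^ 2 + (S.ε k + 1) * (S.ε i + 1) * S.e3 k)
    + (L : ℝ) ^ 2 * N * S.c k * S.c i * S.e1 k *
        ((S.ε k + S.ε i + 1) * S.e1 k + 2 * S.δ * S.e2 k)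
    + (L : ℝ) ^ 2 * S.c k * S.c i * S.ε k * S.ε i * S.e1 k *
        (‖S.losAll k i‖ ^ 2 * S.e1 k
          + 2 * S.δ * (conj (S.fRis k) * S.fRis i * S.losAll i k).re)
    + L * S.γ i * (S.γ k + S.sB) * S.e3 k
    + L * N *
        ((S.γ k + S.sB) * S.c i * (S.δ * S.e2 k ^ 2 + (S.ε i + 1) * S.e3 k)
          + S.γ i * S.c k * (S.δ * S.e2 k ^ 2 + (S.ε k + 1) * S.e3 k))

/-- SINR of the RIS-aided system (no connected element). -/
def risSinr (k : Fin K) : ℝ :=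
  S.p k * S.risPower k ^ 2 /
    (S.p k * S.risLeak k + ∑ i ∈ Finset.univ.erase k, S.p i * S.risInt k i
      + S.σB ^ 2 * S.risPower k)

/-- LMMSE coefficient `γ_k / (γ_k + σB² / (τ p_p))` of the direct link alone. -/
def eDir (k : Fin K) : ℝ := S.γ k / (S.γ k + S.sB)

/-- SINR of the distributed antenna system (all elements connected). -/
def dasSinr (k : Fin K) : ℝ :=
  S.p k * (L * S.γ k * S.eDir k + N * S.dc k * (S.ε k + S.e4 k)) ^ 2 /
    (S.p k * (L * S.γ k ^ 2 * S.eDir k + N * S.dc k ^ 2 * S.ε k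
        + N * S.dc k * (S.ε k + 1) * (S.dc k + S.sR) * S.e4 k ^ 2)
      + ∑ i ∈ Finset.univ.erase k, S.p i *
          (L * S.γ i * S.γ k * S.eDir k + S.dc k * S.dc i * S.ε k * S.ε i * ‖S.losAll k i‖ ^ 2
            + N * S.dc i * (S.dc k * S.ε k + (S.ε i + 1) * (S.dc k + S.sR) * S.e4 k ^ 2))
      + S.σB ^ 2 * L * S.γ k * S.eDir k + S.σR ^ 2 * N * S.dc k * (S.ε k + S.e4 k))

/-- SINR of the conventional massive MIMO system (no RDARS). -/
def mimoSinr (k : Fin K) : ℝ :=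
  S.p k * L * S.γ k * S.eDir k / (∑ i, S.p i * S.γ i + S.σB ^ 2)

end System

end

end

end RDARS

/-!
The proof computes the first two moments of the gain `q̂_kᴴ q_i` in two stages: first given the
user-RDARS channels `h̃`, then over `h̃`. The point of this split is that, once `h̃` is frozen, both
the channel `q_i` and the estimate `q̂_k` are affine in the remaining Gaussian variables, so that the
gain is a polynomial of bidegree at most `(1, 1)` in them and their conjugates, although its degree
in all variables together is higher.

*Gaussian calculus.* Polynomials `c + p ⬝ z + q ⬝ z̄ + zᴴ S z` in independent centered circular
Gaussians have explicit means and covariances, because `1`, `z s`, `z̄ s` and the centered products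
`z̄ s * z t` form an orthogonal system (`Quad.integral_chaos_mul_conj`, from Isserlis' formula). This
gives `Quad.integral_eval_mul_conj`, and by independence the version with random coefficients,
`Quad.Tame.integral_eval_mul_conj`, which is the law of total covariance.

*The estimate.* Channels, pilot observations and estimates are instances of one family `System.obs` of
affine polynomials. Their covariance matrices (`IsModel.integral_obs_mul_conj`) are block diagonal,
with a multiple of the identity at the RDARS since `A Aᵀ = 1` (`A_mul_transpose`), and a rank-one
perturbation of a multiple of the identity at the BS. This is why the filter
`C[q, y] C[y, y]⁻¹` is `blk(a₃ a_L a_Lᴴ + a₄ I, e₄ I)`; it is found from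
`C[q, y] = filter * C[y, y]` (`filter_mul`), and `e₁`, `e₂`, `e₃` are its normalized trace, its
eigenvalue at `a_L`, and its normalized squared Frobenius norm.

*The gain.* Given `h̃`, the mean of the gain (`mean_gainQuad`) is again a polynomial of bidegree
`(1, 1)`, now in `h̃`, and so the same calculus yields its mean and variance (`mean_meanGainQuad`,
`cov_meanGainQuad`). The variance of the gain given `h̃` (`cov_gainQuad`) is a sum of products of at
most two such polynomials, whose expectations are correlations (`IsModel.integral_cov_gainQuad`). Adding up,
`IsModel.integral_norm_gain_sq` is the law of total variance, and the closed forms follow by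
algebra (`gainVar_self`, `gainVar_eq`). The users `k` and `i` have independent channels if `i ≠ k`,
and the extra correlations for `i = k` are what distinguishes the leakage from the interference.
-/

namespace RDARS
noncomputable section
open MeasureTheory ProbabilityTheory Matrix
open scoped NNReal ComplexConjugate ENNReal

/-! ### Moments of complex Gaussians -/

section Moments
variable {Ω : Type*} [MeasurableSpace Ω] {μ : Measure Ω}

/-- `f` has finite absolute moments of every order. -/
def HasMoments (f : Ω → ℂ) (μ : Measure Ω) : Prop := ∀ p : ℝ≥0∞, p ≠ ⊤ → MemLp f p μ

lemma HasMoments.memLp {f : Ω → ℂ} (hf : HasMoments f μ) : MemLp f 2 μ := hf 2 (by simp)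

lemma HasMoments.integrable {f : Ω → ℂ} (hf : HasMoments f μ) : Integrable f μ :=
  memLp_one_iff_integrable.1 (hf 1 (by simp))

lemma hasMoments_const [IsFiniteMeasure μ] (c : ℂ) : HasMoments (fun _ : Ω => c) μ :=
  fun _ _ => memLp_const c

lemma HasMoments.add {f g : Ω → ℂ} (hf : HasMoments f μ) (hg : HasMoments g μ) :
    HasMoments (fun ω => f ω + g ω) μ := fun p hp => (hf p hp).add (hg p hp)

lemma HasMoments.sub {f g : Ω → ℂ} (hf : HasMoments f μ) (hg : HasMoments g μ) :
    HasMoments (fun ω => f ω - g ω) μ := fun p hp => (hf p hp).sub (hg p hp)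

lemma HasMoments.conj {f : Ω → ℂ} (hf : HasMoments f μ) :
    HasMoments (fun ω => conj (f ω)) μ := fun p hp => (hf p hp).star

lemma HasMoments.mul {f g : Ω → ℂ} (hf : HasMoments f μ) (hg : HasMoments g μ) :
    HasMoments (fun ω => f ω * g ω) μ := by
  intro p hp
  have : ENNReal.HolderTriple (2 * p) (2 * p) p := ⟨by
    rw [ENNReal.mul_inv (by simp) (by simp), ← add_mul, ENNReal.inv_two_add_inv_two, one_mul]⟩
  have h2 : 2 * p ≠ ⊤ := ENNReal.mul_ne_top (by simp) hp
  exact (hg _ h2).mul' (hf _ h2)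

lemma hasMoments_sum {ι : Type*} (s : Finset ι) {f : ι → Ω → ℂ}
    (hf : ∀ i ∈ s, HasMoments (f i) μ) : HasMoments (fun ω => ∑ i ∈ s, f i ω) μ :=
  fun p hp => memLp_finsetSum s fun i hi => hf i hi p hp

lemma HasMoments.comp_hasLaw {ν : Measure ℂ} {z : Ω → ℂ} (hz : HasLaw z ν μ) {f : ℂ → ℂ}
    (hf : HasMoments f ν) : HasMoments (fun ω => f (z ω)) μ := fun p hp => by
  have h := hf p hp
  rw [← hz.map_eq] at h
  exact h.comp_of_map hz.aemeasurable

end Moments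

section ComplexGaussian

variable (v : ℝ≥0)

instance : IsProbabilityMeasure (complexGaussian v) :=
  Measure.isProbabilityMeasure_map (by fun_prop)

lemma hasMoments_id_complexGaussian : HasMoments (fun z => z) (complexGaussian v) := by
  intro p hp
  refine (memLp_map_measure_iff (by fun_prop) (by fun_prop)).2 ?_
  have h : MemLp (fun x : ℝ => (x : ℂ)) p (gaussianReal 0 (v / 2)) :=
    (memLp_id_gaussianReal' p hp).ofReal
  exact (h.comp_fst _).add ((h.comp_snd _).mul_const Complex.I)

lemma integral_complexGaussian (f : ℂ → ℂ) (hf : Continuous f) :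
    ∫ z, f z ∂complexGaussian v =
      ∫ z : ℝ × ℝ, f ((z.1 : ℂ) + z.2 * Complex.I)
        ∂((gaussianReal 0 (v / 2)).prod (gaussianReal 0 (v / 2))) :=
  integral_map (by fun_prop) hf.aestronglyMeasurable

/-- Circular symmetry, for a quarter turn. -/
lemma complexGaussian_map_mul_I :
    (complexGaussian v).map (fun z => Complex.I * z) = complexGaussian v := by
  have h1 : (gaussianReal 0 (v / 2)).map (fun x => -x) = gaussianReal 0 (v / 2) := by
    simpa using gaussianReal_map_neg (μ := 0) (v := v / 2)
  have h2 : ((gaussianReal 0 (v / 2)).prod (gaussianReal 0 (v / 2))).map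
      (fun z : ℝ × ℝ => (-z.2, z.1)) = (gaussianReal 0 (v / 2)).prod (gaussianReal 0 (v / 2)) := by
    have h3 : (fun z : ℝ × ℝ => (-z.2, z.1)) = Prod.map (fun x => -x) id ∘ Prod.swap := rfl
    rw [h3, ← Measure.map_map (by fun_prop) (by fun_prop), Measure.prod_swap,
      ← Measure.map_prod_map _ _ (by fun_prop) (by fun_prop), h1, Measure.map_id]
  unfold complexGaussian
  rw [Measure.map_map (by fun_prop) (by fun_prop)]
  conv_rhs => rw [← h2, Measure.map_map (by fun_prop) (by fun_prop)]
  congr 1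
  ext z
  simp only [Function.comp]
  push_cast
  linear_combination (z.2 : ℂ) * Complex.I_mul_I

/-- By the quarter-turn symmetry, the moments `E[z ^ m * conj z ^ n]` with distinct exponents
`m, n ≤ 2` vanish: `i ^ m * conj i ^ n` is not `1`. -/
lemma integral_monomial_eq_zero {m n : ℕ} (hm : m ≤ 2) (hn : n ≤ 2) (h : m ≠ n) :
    ∫ z, z ^ m * conj z ^ n ∂complexGaussian v = 0 := by
  have h1 : ∫ z, z ^ m * conj z ^ n ∂complexGaussian v =
      (Complex.I ^ m * conj Complex.I ^ n) * ∫ z, z ^ m * conj z ^ n ∂complexGaussian v := by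
    conv_lhs => rw [← complexGaussian_map_mul_I v, integral_map (by fun_prop)
      (Continuous.aestronglyMeasurable (by fun_prop))]
    rw [← integral_const_mul]
    congr 1
    ext z
    simp only [map_mul, mul_pow]
    ring
  have h2 : (Complex.I ^ m * conj Complex.I ^ n) ≠ 1 := by
    interval_cases m <;> interval_cases n <;> simp [Complex.ext_iff, pow_two] at h ⊢ <;> norm_num
  have h3 : (1 - Complex.I ^ m * conj Complex.I ^ n) *
      ∫ z, z ^ m * conj z ^ n ∂complexGaussian v = 0 := by linear_combination h1
  exact (mul_eq_zero.1 h3).resolve_left (sub_ne_zero.2 h2.symm)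

lemma integral_sq_gaussianReal (w : ℝ≥0) : ∫ x, x ^ 2 ∂gaussianReal 0 w = w := by
  have h := variance_fun_id_gaussianReal (μ := 0) (v := w)
  rw [variance_eq_sub (X := fun x => x) (memLp_id_gaussianReal 2)] at h
  simpa using h

lemma integrable_pow_gaussianReal (w : ℝ≥0) (n : ℕ) :
    Integrable (fun x : ℝ => x ^ n) (gaussianReal 0 w) := by
  have h := (memLp_id_gaussianReal' (μ := 0) (v := w) n (by simp)).integrable_norm_pow'
  refine h.mono' (Continuous.aestronglyMeasurable (by fun_prop)) ?_
  filter_upwards with x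
  simp

/-- The fourth moment, from the stability of the Gaussian law: if `x`, `y` are independent with the
same law, then `x + y` is distributed as `√2 x`. -/
lemma integral_pow_four_gaussianReal (w : ℝ≥0) : ∫ x, x ^ 4 ∂gaussianReal 0 w = 3 * w ^ 2 := by
  set ν := gaussianReal 0 w with hν
  have h1 : ν.map (fun x => Real.sqrt 2 * x) = gaussianReal 0 (w + w) := by
    rw [hν, gaussianReal_map_const_mul]
    congr 1
    · simp
    · ext; simp; ring
  have h2 : (ν.prod ν).map (fun z => z.1 + z.2) = gaussianReal 0 (w + w) := by
    have := gaussianReal_conv_gaussianReal (m₁ := 0) (m₂ := 0) (v₁ := w) (v₂ := w)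
    rw [Measure.conv] at this
    simpa using this
  have h3 : ∫ x, (Real.sqrt 2 * x) ^ 4 ∂ν = ∫ z, (z.1 + z.2) ^ 4 ∂(ν.prod ν) := by
    rw [← integral_map (φ := fun x => Real.sqrt 2 * x) (f := fun y => y ^ 4) (by fun_prop)
      (Continuous.aestronglyMeasurable (by fun_prop)), h1, ← h2, integral_map (by fun_prop)
      (Continuous.aestronglyMeasurable (by fun_prop))]
  have hi := integrable_pow_gaussianReal w
  have I4 (c : ℝ) (i j : ℕ) :
      Integrable (fun z : ℝ × ℝ => c * (z.1 ^ i * z.2 ^ j)) (ν.prod ν) :=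
    ((hi i).mul_prod (hi j)).const_mul c
  have h4 : ∫ z, (z.1 + z.2) ^ 4 ∂(ν.prod ν) = ∑ i ∈ Finset.range 5,
      (Nat.choose 4 i : ℝ) * ((∫ x, x ^ i ∂ν) * ∫ x, x ^ (4 - i) ∂ν) := by
    simp_rw [← integral_prod_mul, ← integral_const_mul]
    rw [← integral_finsetSum _ fun i _ => I4 _ _ _]
    congr 1
    ext z
    rw [add_pow]
    exact Finset.sum_congr rfl fun i _ => by ring
  have h5 : (Real.sqrt 2) ^ 4 = 4 := by
    rw [show (4 : ℕ) = 2 * 2 by rfl, pow_mul, Real.sq_sqrt (by norm_num)]; norm_num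
  simp_rw [mul_pow, integral_const_mul, h5] at h3
  rw [h4] at h3
  simp only [Finset.sum_range_succ, Finset.sum_range_zero, pow_zero, integral_const, probReal_univ,
    pow_one, integral_sq_gaussianReal, hν, Nat.choose] at h3
  norm_num at h3
  nlinarith [h3]

lemma integral_mul_conj_complexGaussian : ∫ z, z ^ 1 * conj z ^ 1 ∂complexGaussian v = v := by
  rw [integral_complexGaussian v _ (by fun_prop)]
  have h (z : ℝ × ℝ) : ((z.1 : ℂ) + z.2 * Complex.I) ^ 1 * conj ((z.1 : ℂ) + z.2 * Complex.I) ^ 1 =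
      ((z.1 ^ 2 * 1 + 1 * z.2 ^ 2 : ℝ) : ℂ) := by
    simp only [map_add, map_mul, Complex.conj_ofReal, Complex.conj_I, pow_one]
    push_cast
    linear_combination (-(z.2 : ℂ) ^ 2) * Complex.I_sq
  simp_rw [h]
  rw [integral_complex_ofReal]
  have hi := integrable_pow_gaussianReal (v / 2)
  have h1 : Integrable (fun _ : ℝ => (1 : ℝ)) (gaussianReal 0 (v / 2)) := integrable_const _
  rw [integral_add ((hi 2).mul_prod h1) (h1.mul_prod (hi 2)),
    integral_prod_mul (fun x => x ^ 2) (fun _ => 1), integral_prod_mul (fun _ => 1) (fun x => x ^ 2)]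
  simp [integral_sq_gaussianReal]

lemma integral_sq_mul_conj_sq_complexGaussian :
    ∫ z, z ^ 2 * conj z ^ 2 ∂complexGaussian v = 2 * v ^ 2 := by
  rw [integral_complexGaussian v _ (by fun_prop)]
  have h (z : ℝ × ℝ) : ((z.1 : ℂ) + z.2 * Complex.I) ^ 2 * conj ((z.1 : ℂ) + z.2 * Complex.I) ^ 2 =
      ((z.1 ^ 4 * 1 + (2 * (z.1 ^ 2 * z.2 ^ 2) + 1 * z.2 ^ 4) : ℝ) : ℂ) := by
    simp only [map_add, map_mul, Complex.conj_ofReal, Complex.conj_I, ← mul_pow]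
    have : ((z.1 : ℂ) + z.2 * Complex.I) * (z.1 + z.2 * -Complex.I) = z.1 ^ 2 + z.2 ^ 2 := by
      linear_combination (-(z.2 : ℂ) ^ 2) * Complex.I_sq
    rw [this]
    push_cast
    ring
  simp_rw [h]
  rw [integral_complex_ofReal]
  have hi := integrable_pow_gaussianReal (v / 2)
  have h1 : Integrable (fun _ : ℝ => (1 : ℝ)) (gaussianReal 0 (v / 2)) := integrable_const _
  have i1 := (hi 4).mul_prod h1
  have i2 := ((hi 2).mul_prod (hi 2)).const_mul 2
  have i3 := h1.mul_prod (hi 4)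
  have i23 : Integrable (fun z : ℝ × ℝ => 2 * (z.1 ^ 2 * z.2 ^ 2) + 1 * z.2 ^ 4)
      ((gaussianReal 0 (v / 2)).prod (gaussianReal 0 (v / 2))) := i2.add i3
  rw [integral_add i1 i23, integral_add i2 i3, integral_const_mul,
    integral_prod_mul (fun x => x ^ 4) (fun _ => 1), integral_prod_mul (fun _ => 1) (fun x => x ^ 4),
    integral_prod_mul (fun x => x ^ 2) (fun x => x ^ 2)]
  simp only [integral_sq_gaussianReal, integral_pow_four_gaussianReal]
  simp
  ring

end ComplexGaussian

/-! ### Independent complex Gaussians -/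

/-- The random variables `z j` are independent, centered circular complex Gaussians of
variances `v j`. -/
structure IsGaussianFamily {Ω J : Type*} [MeasurableSpace Ω] (z : J → Ω → ℂ) (v : J → ℝ≥0)
    (μ : Measure Ω) : Prop where
  law : ∀ j, HasLaw (z j) (complexGaussian (v j)) μ
  indep : iIndepFun z μ

namespace IsGaussianFamily
variable {Ω J : Type*} [MeasurableSpace Ω] {μ : Measure Ω} {z : J → Ω → ℂ} {v : J → ℝ≥0}

lemma precomp (hz : IsGaussianFamily z v μ) {I : Type*} {e : I → J} (he : e.Injective) :
    IsGaussianFamily (fun i => z (e i)) (fun i => v (e i)) μ :=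
  ⟨fun i => hz.law (e i), hz.indep.precomp he⟩

lemma hasMoments (hz : IsGaussianFamily z v μ) (j : J) : HasMoments (z j) μ :=
  HasMoments.comp_hasLaw (hz.law j) (hasMoments_id_complexGaussian (v j))

/-- The exponent vector of a single variable. -/
def unit [DecidableEq J] (s j : J) : ℕ := if j = s then 1 else 0

lemma unit_self [DecidableEq J] (s : J) : unit s s = 1 := if_pos rfl

lemma unit_of_ne [DecidableEq J] {s j : J} (h : j ≠ s) : unit s j = 0 := if_neg h

lemma unit_le [DecidableEq J] (s j : J) : unit s j ≤ 1 := by unfold unit; split <;> simp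

variable [Fintype J]

lemma monomial_add (x : J → ℂ) (m n m' n' : J → ℕ) :
    ∏ j, (x j ^ (m j + m' j) * conj (x j) ^ (n j + n' j)) =
      (∏ j, (x j ^ m j * conj (x j) ^ n j)) * ∏ j, (x j ^ m' j * conj (x j) ^ n' j) := by
  rw [← Finset.prod_mul_distrib]
  exact Finset.prod_congr rfl fun j _ => by ring

lemma integral_monomial (hz : IsGaussianFamily z v μ) (m n : J → ℕ) :
    ∫ ω, ∏ j, (z j ω ^ m j * conj (z j ω) ^ n j) ∂μ =
      ∏ j, ∫ x, x ^ m j * conj x ^ n j ∂complexGaussian (v j) := by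
  rw [hz.indep.integral_fun_prod_comp (f := fun j x => x ^ m j * conj x ^ n j)
    (fun j => (hz.law j).aemeasurable)
    (fun j => Continuous.aestronglyMeasurable (by fun_prop))]
  refine Finset.prod_congr rfl fun j _ => ?_
  exact (hz.law j).integral_comp (f := fun x => x ^ m j * conj x ^ n j)
    (Continuous.aestronglyMeasurable (by fun_prop))

lemma integral_monomial_eq_zero (hz : IsGaussianFamily z v μ) (m n : J → ℕ) (j : J)
    (hm : m j ≤ 2) (hn : n j ≤ 2) (h : m j ≠ n j) :
    ∫ ω, ∏ j, (z j ω ^ m j * conj (z j ω) ^ n j) ∂μ = 0 := by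
  rw [hz.integral_monomial]
  exact Finset.prod_eq_zero (Finset.mem_univ j) (RDARS.integral_monomial_eq_zero _ hm hn h)

variable [DecidableEq J]

lemma prod_pow_unit (x : J → ℂ) (s : J) : ∏ j, x j ^ unit s j = x s := by
  simp [unit, pow_ite, Finset.prod_ite_eq']

lemma monomial_left (x : J → ℂ) (s : J) : ∏ j, (x j ^ unit s j * conj (x j) ^ 0) = x s := by
  simp [prod_pow_unit]

lemma monomial_right (x : J → ℂ) (s : J) :
    ∏ j, (x j ^ 0 * conj (x j) ^ unit s j) = conj (x s) := by
  simp [prod_pow_unit (fun j => conj (x j))]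

/-- The variables and their conjugates as monomials. -/
lemma eq_monomial (x : J → ℂ) (s t a b : J) :
    x s = ∏ j, (x j ^ unit s j * conj (x j) ^ 0) ∧
    x s * x t = ∏ j, (x j ^ (unit s j + unit t j) * conj (x j) ^ (0 + 0)) ∧
    x s * conj (x a) = ∏ j, (x j ^ (unit s j + 0) * conj (x j) ^ (0 + unit a j)) ∧
    x s * x t * conj (x a) =
      ∏ j, (x j ^ (unit s j + unit t j + 0) * conj (x j) ^ (0 + 0 + unit a j)) ∧
    x s * x t * conj (x a) * conj (x b) =
      ∏ j, (x j ^ (unit s j + unit t j + 0 + 0) *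
        conj (x j) ^ (0 + 0 + unit a j + unit b j)) := by
  refine ⟨?_, ?_, ?_, ?_, ?_⟩ <;>
    simp only [monomial_add x, monomial_left, monomial_right]

lemma integral_var (hz : IsGaussianFamily z v μ) (s : J) : ∫ ω, z s ω ∂μ = 0 := by
  simp_rw [fun ω => (eq_monomial (fun j => z j ω) s s s s).1]
  exact hz.integral_monomial_eq_zero (unit s) (fun _ => 0) s (by simp [unit_self])
    (by simp) (by simp [unit_self])

lemma integral_mul (hz : IsGaussianFamily z v μ) (s t : J) : ∫ ω, z s ω * z t ω ∂μ = 0 := by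
  simp_rw [fun ω => (eq_monomial (fun j => z j ω) s t s s).2.1]
  have := unit_le t s
  exact hz.integral_monomial_eq_zero (fun j => unit s j + unit t j) (fun _ => 0 + 0) s
    (by simp only [unit_self]; omega) (by simp) (by simp [unit_self])

lemma integral_mul_conj (hz : IsGaussianFamily z v μ) (s t : J) :
    ∫ ω, z s ω * conj (z t ω) ∂μ = if s = t then (v s : ℂ) else 0 := by
  split_ifs with h
  · subst h
    have := (hz.law s).integral_comp (f := fun x => x ^ 1 * conj x ^ 1)
      (Continuous.aestronglyMeasurable (by fun_prop))
    simp only [Function.comp_def] at this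
    rw [integral_mul_conj_complexGaussian] at this
    simpa using this
  · simp_rw [fun ω => (eq_monomial (fun j => z j ω) s s t s).2.2.1]
    exact hz.integral_monomial_eq_zero (fun j => unit s j + 0) (fun j => 0 + unit t j) s
      (by simp [unit_self]) (by simp [unit_of_ne h]) (by simp [unit_self, unit_of_ne h])

lemma integral_mul_mul_conj (hz : IsGaussianFamily z v μ) (s t a : J) :
    ∫ ω, z s ω * z t ω * conj (z a ω) ∂μ = 0 := by
  simp_rw [fun ω => (eq_monomial (fun j => z j ω) s t a s).2.2.2.1]
  have h1 := unit_le t s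
  have h2 := unit_le a s
  by_cases hs : s = a
  · subst hs
    have h3 := unit_le s t
    by_cases ht : t = s
    · subst ht
      exact hz.integral_monomial_eq_zero (fun j => unit t j + unit t j + 0)
        (fun j => 0 + 0 + unit t j) t (by simp [unit_self]) (by simp [unit_self])
        (by simp [unit_self])
    · exact hz.integral_monomial_eq_zero (fun j => unit s j + unit t j + 0)
        (fun j => 0 + 0 + unit s j) t (by simp only [unit_self]; omega) (by omega)
        (by simp [unit_self, unit_of_ne ht])
  · exact hz.integral_monomial_eq_zero (fun j => unit s j + unit t j + 0)
      (fun j => 0 + 0 + unit a j) s (by simp only [unit_self]; omega) (by omega)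
      (by simp [unit_self, unit_of_ne hs])

/-- Isserlis' formula for fourth moments. -/
lemma integral_mul_mul_conj_conj (hz : IsGaussianFamily z v μ) (s t a b : J) :
    ∫ ω, z s ω * z t ω * conj (z a ω) * conj (z b ω) ∂μ =
      (if s = a ∧ t = b then (v s * v t : ℂ) else 0) +
        if s = b ∧ t = a then (v s * v t : ℂ) else 0 := by
  have vanish (j : J) (hj : unit s j + unit t j ≠ unit a j + unit b j) :
      ∫ ω, z s ω * z t ω * conj (z a ω) * conj (z b ω) ∂μ = 0 := by
    simp_rw [fun ω => (eq_monomial (fun j => z j ω) s t a b).2.2.2.2]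
    have h1 := unit_le s j
    have h2 := unit_le t j
    have h3 := unit_le a j
    have h4 := unit_le b j
    exact hz.integral_monomial_eq_zero (fun j => unit s j + unit t j + 0 + 0)
      (fun j => 0 + 0 + unit a j + unit b j) j (by omega) (by omega) (by simpa using hj)
  have indep (s t : J) (h : s ≠ t) :
      ∫ ω, z s ω * z t ω * conj (z s ω) * conj (z t ω) ∂μ = v s * v t := by
    have h1 := (hz.indep.indepFun h).comp (φ := fun x => x * conj x) (ψ := fun x => x * conj x)
      (by fun_prop) (by fun_prop)
    have h2 := h1.integral_fun_mul_eq_mul_integral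
      ((hz.hasMoments s).mul (hz.hasMoments s).conj).integrable.aestronglyMeasurable
      ((hz.hasMoments t).mul (hz.hasMoments t).conj).integrable.aestronglyMeasurable
    simp only [Function.comp_def, hz.integral_mul_conj, if_true] at h2
    rw [← h2]
    congr 1
    ext ω
    ring
  by_cases h1 : s = a
  · subst h1
    by_cases h2 : t = b
    · subst h2
      by_cases h3 : s = t
      · subst h3
        have := (hz.law s).integral_comp (f := fun x => x ^ 2 * conj x ^ 2)
          (Continuous.aestronglyMeasurable (by fun_prop))
        simp only [Function.comp_def] at this
        rw [integral_sq_mul_conj_sq_complexGaussian] at this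
        simp only [and_self, if_true]
        rw [← two_mul, ← pow_two, ← this]
        congr 1
        ext ω
        ring
      · rw [indep s t h3]
        simp [h3]
    · have h3 : ¬(s = b ∧ t = s) := fun h => h2 (h.2.trans h.1)
      rw [if_neg (by simp [h2]), if_neg h3, vanish t]
      · simp
      · rw [unit_self, unit_of_ne h2]; omega
  · rw [if_neg (by simp [h1])]
    by_cases h2 : s = b
    · subst h2
      by_cases h3 : t = a
      · subst h3
        simp only [and_self, if_true, zero_add]
        rw [← indep s t h1]
        congr 1
        ext ω
        ring
      · rw [if_neg (by simp [h3]), vanish a]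
        · simp
        · rw [unit_self, unit_of_ne (Ne.symm h1), unit_of_ne (Ne.symm h3)]; omega
    · rw [if_neg (by simp [h2]), vanish s]
      · simp
      · rw [unit_self, unit_of_ne h1, unit_of_ne h2]; omega

end IsGaussianFamily

/-! ### Polynomials of bidegree one in complex Gaussians -/

/-- A polynomial `c + p ⬝ z + q ⬝ z̄ + zᴴ S z` in complex variables `z j` and their conjugates. -/
structure Quad (J : Type*) where
  /-- The constant term. -/
  c : ℂ
  /-- The coefficients of `z j`. -/
  p : J → ℂ
  /-- The coefficients of `conj (z j)`. -/
  q : J → ℂ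
  /-- The matrix of the sesquilinear part. -/
  S : J → J → ℂ

namespace Quad
variable {Ω J : Type*} [MeasurableSpace Ω] {μ : Measure Ω} [Fintype J]

/-- The value of the polynomial. -/
def eval (Q : Quad J) (z : J → ℂ) : ℂ :=
  Q.c + ∑ s, Q.p s * z s + ∑ s, Q.q s * conj (z s) + ∑ s, ∑ t, Q.S s t * (conj (z s) * z t)

/-- The expectation of the polynomial at independent centered circular Gaussians of
variances `v`. -/
def mean (v : J → ℝ≥0) (Q : Quad J) : ℂ := Q.c + ∑ s, (v s : ℂ) * Q.S s s

/-- The covariance of two polynomials at independent centered circular Gaussians of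
variances `v`. -/
def cov (v : J → ℝ≥0) (Q Q' : Quad J) : ℂ :=
  ∑ s, Q.p s * conj (Q'.p s) * v s + ∑ s, Q.q s * conj (Q'.q s) * v s
    + ∑ s, ∑ t, Q.S s t * conj (Q'.S s t) * (v s * v t)

lemma hasMoments_eval [IsFiniteMeasure μ] {z : J → Ω → ℂ} (hz : ∀ j, HasMoments (z j) μ)
    (Q : Quad J) : HasMoments (fun ω => Q.eval (fun j => z j ω)) μ := by
  have h1 (c : ℂ) := hasMoments_const (μ := μ) c
  refine (((h1 _).add ?_).add ?_).add ?_
  · exact hasMoments_sum _ fun s _ => (h1 _).mul (hz s)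
  · exact hasMoments_sum _ fun s _ => (h1 _).mul (hz s).conj
  · exact hasMoments_sum _ fun s _ => hasMoments_sum _ fun t _ =>
      (h1 _).mul ((hz s).conj.mul (hz t))

variable [DecidableEq J]

/-- Index set of the orthogonal system `1`, `z s`, `conj (z s)`,
`conj (z s) * z t - E[conj (z s) * z t]`. -/
abbrev Idx (J : Type*) : Type _ := Unit ⊕ J ⊕ J ⊕ J × J

/-- The orthogonal system in which a polynomial is expanded. -/
def chaos (v : J → ℝ≥0) (x : J → ℂ) : Idx J → ℂ
  | .inl _ => 1
  | .inr (.inl s) => x s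
  | .inr (.inr (.inl s)) => conj (x s)
  | .inr (.inr (.inr s)) => conj (x s.1) * x s.2 - if s.1 = s.2 then (v s.1 : ℂ) else 0

/-- The squared norms of the orthogonal system. -/
def chaosVar (v : J → ℝ≥0) : Idx J → ℂ
  | .inl _ => 1
  | .inr (.inl s) => v s
  | .inr (.inr (.inl s)) => v s
  | .inr (.inr (.inr s)) => v s.1 * v s.2

/-- The coefficients of a polynomial in the orthogonal system. -/
def coeff (v : J → ℝ≥0) (Q : Quad J) : Idx J → ℂ
  | .inl _ => Q.mean v
  | .inr (.inl s) => Q.p s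
  | .inr (.inr (.inl s)) => Q.q s
  | .inr (.inr (.inr s)) => Q.S s.1 s.2

lemma eval_eq_sum_chaos (v : J → ℝ≥0) (Q : Quad J) (x : J → ℂ) :
    Q.eval x = ∑ i, Q.coeff v i * chaos v x i := by
  simp only [Fintype.sum_sum_type, Fintype.sum_prod_type, coeff, chaos, eval, mean, mul_sub,
    Finset.sum_sub_distrib, mul_ite, mul_zero, Finset.sum_ite_eq, Finset.mem_univ, if_true,
    Finset.univ_unique, Finset.sum_singleton]
  simp_rw [mul_comm (v _ : ℂ)]
  ring

lemma hasMoments_chaos {I : Type*} [DecidableEq I] [IsFiniteMeasure μ] {z : I → Ω → ℂ}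
    (v : I → ℝ≥0) (hz : ∀ j, HasMoments (z j) μ) (i : Idx I) :
    HasMoments (fun ω => chaos v (fun j => z j ω) i) μ := by
  rcases i with _ | s | s | s
  · exact hasMoments_const _
  · exact hz s
  · exact (hz s).conj
  · exact ((hz _).conj.mul (hz _)).sub (hasMoments_const _)

variable [IsProbabilityMeasure μ]

/-- The system is orthogonal in `L²`. -/
lemma integral_chaos_mul_conj {z : J → Ω → ℂ} {v : J → ℝ≥0} (hz : IsGaussianFamily z v μ)
    (i j : Idx J) :
    ∫ ω, chaos v (fun j => z j ω) i * conj (chaos v (fun j => z j ω) j) ∂μ =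
      if i = j then chaosVar v i else 0 := by
  have M := hz.hasMoments
  have C (c : ℂ) := hasMoments_const (μ := μ) c
  have E1 (s : J) : ∫ ω, conj (z s ω) ∂μ = 0 := by rw [integral_conj, hz.integral_var, map_zero]
  have E2 (s t : J) : ∫ ω, conj (z s ω) * z t ω ∂μ = if s = t then (v s : ℂ) else 0 := by
    simp_rw [mul_comm (conj (z s _)), hz.integral_mul_conj]
    by_cases h : s = t
    · simp [h]
    · simp [h, Ne.symm h]
  have E3 (s t : J) (c : ℂ) :
      ∫ ω, (conj (z s ω) * z t ω - c) ∂μ = (if s = t then (v s : ℂ) else 0) - c := by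
    rw [integral_sub ((M s).conj.mul (M t)).integrable (C c).integrable, E2]
    simp
  -- It suffices to treat one of each pair `(i, j)`, `(j, i)`.
  have symm (i j : Idx J) (h : ∫ ω, chaos v (fun j => z j ω) i *
      conj (chaos v (fun j => z j ω) j) ∂μ = if i = j then chaosVar v i else 0) :
      ∫ ω, chaos v (fun j => z j ω) j * conj (chaos v (fun j => z j ω) i) ∂μ =
        if j = i then chaosVar v j else 0 := by
    have h1 := congrArg conj h
    rw [← integral_conj] at h1
    simp only [map_mul, Complex.conj_conj, mul_comm (conj (chaos v _ i))] at h1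
    rw [h1]
    by_cases hij : i = j
    · subst hij
      rcases i with _ | s | s | s <;> simp [chaosVar]
    · rw [if_neg hij, if_neg (Ne.symm hij), map_zero]
  have h01 (s : J) := symm (.inl ()) (.inr (.inl s)) (by simp [chaos, E1])
  have h02 (s : J) := symm (.inl ()) (.inr (.inr (.inl s))) (by simp [chaos, hz.integral_var])
  have h03 (s : J × J) := symm (.inr (.inr (.inr s))) (.inl ()) (by simp [chaos, E3])
  have h12 (s t : J) := symm (.inr (.inl s)) (.inr (.inr (.inl t)))
    (by simp [chaos, hz.integral_mul])
  have h13 (s : J) (t : J × J) := symm (.inr (.inl s)) (.inr (.inr (.inr t))) (by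
    have h1 : ∀ ω, z s ω * conj (conj (z t.1 ω) * z t.2 ω -
        if t.1 = t.2 then (v t.1 : ℂ) else 0) = z s ω * z t.1 ω * conj (z t.2 ω) -
        z s ω * conj (if t.1 = t.2 then (v t.1 : ℂ) else 0) := fun ω => by
      simp only [map_sub, map_mul, Complex.conj_conj]; ring
    simp only [chaos, h1]
    rw [integral_sub (((M _).mul (M _)).mul (M _).conj).integrable ((M _).mul (C _)).integrable,
      hz.integral_mul_mul_conj, integral_mul_const, hz.integral_var]
    simp)
  have h23 (s : J) (t : J × J) := symm (.inr (.inr (.inr t))) (.inr (.inr (.inl s))) (by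
    have h1 : ∀ ω, (conj (z t.1 ω) * z t.2 ω - if t.1 = t.2 then (v t.1 : ℂ) else 0) *
        conj (conj (z s ω)) = z t.2 ω * z s ω * conj (z t.1 ω) -
        z s ω * (if t.1 = t.2 then (v t.1 : ℂ) else 0) := fun ω => by
      simp only [Complex.conj_conj]; ring
    simp only [chaos, h1]
    rw [integral_sub (((M _).mul (M _)).mul (M _).conj).integrable ((M _).mul (C _)).integrable,
      hz.integral_mul_mul_conj, integral_mul_const, hz.integral_var]
    simp)
  rcases i with _ | s | s | ⟨s, t⟩ <;> rcases j with _ | a | a | ⟨a, b⟩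
  · simp [chaos, chaosVar]
  · exact symm _ _ (h01 a)
  · exact symm _ _ (h02 a)
  · exact h03 _
  · exact h01 s
  · simp [chaos, chaosVar, hz.integral_mul_conj]
  · exact symm _ _ (h12 s a)
  · exact symm _ _ (h13 s _)
  · exact h02 s
  · exact h12 a s
  · simp [chaos, chaosVar, E2]
  · exact h23 s _
  · exact symm _ _ (h03 _)
  · exact h13 a _
  · exact symm _ _ (h23 a _)
  · simp only [chaos, chaosVar, Sum.inr.injEq, Prod.mk.injEq]
    set κ : ℂ := if s = t then (v s : ℂ) else 0 with hκ
    set κ' : ℂ := if a = b then (v a : ℂ) else 0 with hκ'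
    have hc : conj κ' = κ' := by rw [hκ']; split_ifs <;> simp
    have h1 : ∀ ω, (conj (z s ω) * z t ω - κ) * conj (conj (z a ω) * z b ω - κ') =
        z t ω * z a ω * conj (z s ω) * conj (z b ω) - (conj (z s ω) * z t ω - κ) * κ'
          - κ * (z a ω * conj (z b ω)) := fun ω => by
      simp only [map_sub, map_mul, Complex.conj_conj, hc]; ring
    simp_rw [h1]
    rw [integral_sub, integral_sub, integral_mul_const, integral_const_mul, E3,
      hz.integral_mul_mul_conj_conj, hz.integral_mul_conj]
    · rw [← hκ, sub_self, zero_mul, sub_zero, hκ]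
      by_cases h2 : s = t
      · subst h2
        by_cases h3 : a = b
        · subst h3
          by_cases h4 : s = a
          · subst h4; simp
          · simp [h4]
        · by_cases h4 : s = b
          · subst h4; simp [h3, Ne.symm h3]
          · simp [h3, h4]
      · by_cases h4 : s = a
        · subst h4
          simp [h2, Ne.symm h2, mul_comm]
        · simp [h2, Ne.symm h2, h4, Ne.symm h4]
    · exact (((((M _).mul (M _)).mul (M _).conj).mul (M _).conj)).integrable
    · exact ((((M _).conj.mul (M _)).sub (C _)).mul (C _)).integrable
    · exact ((((((M _).mul (M _)).mul (M _).conj).mul (M _).conj)).sub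
        ((((M _).conj.mul (M _)).sub (C _)).mul (C _))).integrable
    · exact ((C _).mul ((M _).mul (M _).conj)).integrable

lemma integral_eval {z : J → Ω → ℂ} {v : J → ℝ≥0} (hz : IsGaussianFamily z v μ) (Q : Quad J) :
    ∫ ω, Q.eval (fun j => z j ω) ∂μ = Q.mean v := by
  simp_rw [Q.eval_eq_sum_chaos v]
  rw [integral_finsetSum _ fun i _ =>
    ((hasMoments_const _).mul (hasMoments_chaos v hz.hasMoments i)).integrable]
  have h (i : Idx J) : ∫ ω, chaos v (fun j => z j ω) i ∂μ = if i = .inl () then 1 else 0 := by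
    have h1 := integral_chaos_mul_conj hz i (.inl ())
    have h0 (x : J → ℂ) : chaos v x (.inl ()) = 1 := rfl
    simp only [h0, map_one, mul_one] at h1
    rw [h1]
    split_ifs with h2
    · subst h2; rfl
    · rfl
  simp_rw [integral_const_mul, h, mul_ite, mul_one, mul_zero, Finset.sum_ite_eq', Finset.mem_univ,
    if_true, coeff]

/-- Wick calculus for polynomials of bidegree at most `(1, 1)`: the correlation of two of them in
closed form. -/
theorem integral_eval_mul_conj {z : J → Ω → ℂ} {v : J → ℝ≥0} (hz : IsGaussianFamily z v μ)
    (Q Q' : Quad J) :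
    ∫ ω, Q.eval (fun j => z j ω) * conj (Q'.eval (fun j => z j ω)) ∂μ =
      Q.mean v * conj (Q'.mean v) + Q.cov v Q' := by
  have h1 (ω : Ω) : Q.eval (fun j => z j ω) * conj (Q'.eval (fun j => z j ω)) =
      ∑ i, ∑ j, (Q.coeff v i * conj (Q'.coeff v j)) *
        (chaos v (fun j => z j ω) i * conj (chaos v (fun j => z j ω) j)) := by
    rw [Q.eval_eq_sum_chaos v, Q'.eval_eq_sum_chaos v, map_sum, Finset.sum_mul_sum]
    refine Finset.sum_congr rfl fun i _ => Finset.sum_congr rfl fun j _ => ?_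
    rw [map_mul]
    ring
  have M (i j : Idx J) : HasMoments (fun ω => (Q.coeff v i * conj (Q'.coeff v j)) *
      (chaos v (fun j => z j ω) i * conj (chaos v (fun j => z j ω) j))) μ :=
    (hasMoments_const _).mul
      ((hasMoments_chaos v hz.hasMoments i).mul (hasMoments_chaos v hz.hasMoments j).conj)
  simp_rw [h1]
  rw [integral_finsetSum _ fun i _ => (hasMoments_sum _ fun j _ => M i j).integrable]
  simp_rw [fun i => integral_finsetSum Finset.univ fun j _ => (M i j).integrable,
    integral_const_mul, integral_chaos_mul_conj hz, mul_ite, mul_zero, Finset.sum_ite_eq,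
    Finset.mem_univ, if_true]
  simp only [Fintype.sum_sum_type, Fintype.sum_prod_type, coeff, chaosVar, cov,
    Finset.univ_unique, Finset.sum_singleton, mul_one]
  ring

end Quad

/-- Decoupling: in an expectation over two independent families, the first one can be integrated
out with the second one frozen. -/
lemma integral_decouple {Ω α β : Type*} [MeasurableSpace Ω] [MeasurableSpace α]
    [MeasurableSpace β] {μ : Measure Ω} [IsProbabilityMeasure μ] {U : Ω → α} {V : Ω → β}
    (hUV : IndepFun U V μ) (hU : AEMeasurable U μ) (hV : AEMeasurable V μ) {F : α → β → ℂ}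
    (hF : Measurable (Function.uncurry F)) (hi : Integrable (fun ω => F (U ω) (V ω)) μ) :
    ∫ ω, F (U ω) (V ω) ∂μ = ∫ ω', ∫ ω, F (U ω) (V ω') ∂μ ∂μ := by
  have h1 := hUV.map_prod_eq_prod_map_map hU hV
  have := Measure.isProbabilityMeasure_map hU
  have := Measure.isProbabilityMeasure_map hV
  have h2 : ∫ ω, F (U ω) (V ω) ∂μ = ∫ x, Function.uncurry F x ∂((μ.map U).prod (μ.map V)) := by
    rw [← h1, integral_map (hU.prodMk hV) hF.aestronglyMeasurable]
    rfl
  have h3 : Integrable (Function.uncurry F) ((μ.map U).prod (μ.map V)) := by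
    rw [← h1]
    exact (integrable_map_measure hF.aestronglyMeasurable (hU.prodMk hV)).2 hi
  rw [h2, integral_prod_symm _ h3, integral_map hV]
  · congr 1
    ext ω'
    exact integral_map hU (hF.comp (by fun_prop)).aestronglyMeasurable
  · exact (hF.stronglyMeasurable.integral_prod_left' (μ := μ.map U)).aestronglyMeasurable

/-! ### Polynomials with random coefficients -/

/-- `g` is measurable, and `g (V ω)` has finite moments of every order. -/
structure Tame {Ω α : Type*} [MeasurableSpace Ω] [MeasurableSpace α] (V : Ω → α) (μ : Measure Ω)
    (g : α → ℂ) : Prop where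
  measurable : Measurable g
  hasMoments : HasMoments (fun ω => g (V ω)) μ

namespace Tame
variable {Ω α : Type*} [MeasurableSpace Ω] [MeasurableSpace α] {V : Ω → α} {μ : Measure Ω}
  {f g : α → ℂ}

lemma const [IsFiniteMeasure μ] (c : ℂ) : Tame V μ (fun _ => c) :=
  ⟨measurable_const, hasMoments_const c⟩

lemma add (hf : Tame V μ f) (hg : Tame V μ g) : Tame V μ (fun x => f x + g x) :=
  ⟨hf.1.add hg.1, hf.2.add hg.2⟩

lemma mul (hf : Tame V μ f) (hg : Tame V μ g) : Tame V μ (fun x => f x * g x) :=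
  ⟨hf.1.mul hg.1, hf.2.mul hg.2⟩

lemma star (hf : Tame V μ f) : Tame V μ (fun x => conj (f x)) :=
  ⟨Complex.continuous_conj.measurable.comp hf.1, hf.2.conj⟩

lemma sum {ι : Type*} [Fintype ι] {F : ι → α → ℂ} (hF : ∀ i, Tame V μ (F i)) :
    Tame V μ (fun x => ∑ i, F i x) :=
  ⟨Finset.measurable_fun_sum _ fun i _ => (hF i).1, hasMoments_sum _ fun i _ => (hF i).2⟩

end Tame

/-- All coefficients of the polynomial `Q x` are tame functions of `x`. -/
structure Quad.Tame {Ω α J : Type*} [MeasurableSpace Ω] [MeasurableSpace α] (V : Ω → α)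
    (μ : Measure Ω) (Q : α → Quad J) : Prop where
  c : RDARS.Tame V μ (fun x => (Q x).c)
  p : ∀ j, RDARS.Tame V μ (fun x => (Q x).p j)
  q : ∀ j, RDARS.Tame V μ (fun x => (Q x).q j)
  S : ∀ i j, RDARS.Tame V μ (fun x => (Q x).S i j)

namespace Quad
section TwoStage
variable {Ω α J : Type*} [MeasurableSpace Ω] [MeasurableSpace α] {V : Ω → α} {μ : Measure Ω}
  [Fintype J] {z : J → Ω → ℂ} {v : J → ℝ≥0} {Q Q' : α → Quad J}

lemma Tame.hasMoments_eval (hQ : Quad.Tame V μ Q) (hz : ∀ j, HasMoments (z j) μ) :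
    HasMoments (fun ω => (Q (V ω)).eval (fun j => z j ω)) μ := by
  refine ((hQ.c.2.add ?_).add ?_).add ?_
  · exact hasMoments_sum _ fun s _ => (hQ.p s).2.mul (hz s)
  · exact hasMoments_sum _ fun s _ => (hQ.q s).2.mul (hz s).conj
  · exact hasMoments_sum _ fun s _ => hasMoments_sum _ fun t _ =>
      (hQ.S s t).2.mul ((hz s).conj.mul (hz t))

lemma Tame.measurable_eval (hQ : Quad.Tame V μ Q) :
    Measurable (Function.uncurry fun (x : J → ℂ) (h : α) => (Q h).eval x) := by
  have h1 (s : J) : Measurable fun y : (J → ℂ) × α => y.1 s := by fun_prop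
  have h2 (s : J) : Measurable fun y : (J → ℂ) × α => conj (y.1 s) :=
    Complex.continuous_conj.measurable.comp (h1 s)
  refine (((hQ.c.1.comp measurable_snd).add ?_).add ?_).add ?_
  · exact Finset.measurable_fun_sum _ fun s _ => ((hQ.p s).1.comp measurable_snd).mul (h1 s)
  · exact Finset.measurable_fun_sum _ fun s _ => ((hQ.q s).1.comp measurable_snd).mul (h2 s)
  · exact Finset.measurable_fun_sum _ fun s _ => Finset.measurable_fun_sum _ fun t _ =>
      ((hQ.S s t).1.comp measurable_snd).mul ((h2 s).mul (h1 t))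

variable [DecidableEq J] [IsProbabilityMeasure μ]

/-- Expectation of a polynomial whose coefficients are independent of its variables. -/
lemma Tame.integral_eval (hQ : Quad.Tame V μ Q) (hz : IsGaussianFamily z v μ)
    (hV : AEMeasurable V μ) (hi : IndepFun (fun ω j => z j ω) V μ) :
    ∫ ω, (Q (V ω)).eval (fun j => z j ω) ∂μ = ∫ ω, (Q (V ω)).mean v ∂μ := by
  have hU : AEMeasurable (fun ω j => z j ω) μ :=
    aemeasurable_pi_lambda _ fun j => (hz.law j).aemeasurable
  rw [integral_decouple hi hU hV (F := fun x h => (Q h).eval x) hQ.measurable_eval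
    (hQ.hasMoments_eval hz.hasMoments).integrable]
  simp_rw [fun ω' => Quad.integral_eval hz (Q (V ω'))]

/-- Correlation of two polynomials whose coefficients are independent of their variables: the
variables can be integrated out first. -/
lemma Tame.integral_eval_mul_conj (hQ : Quad.Tame V μ Q) (hQ' : Quad.Tame V μ Q')
    (hz : IsGaussianFamily z v μ) (hV : AEMeasurable V μ)
    (hi : IndepFun (fun ω j => z j ω) V μ) :
    ∫ ω, (Q (V ω)).eval (fun j => z j ω) * conj ((Q' (V ω)).eval (fun j => z j ω)) ∂μ =
      ∫ ω, ((Q (V ω)).mean v * conj ((Q' (V ω)).mean v) + (Q (V ω)).cov v (Q' (V ω))) ∂μ := by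
  have hU : AEMeasurable (fun ω j => z j ω) μ :=
    aemeasurable_pi_lambda _ fun j => (hz.law j).aemeasurable
  rw [integral_decouple hi hU hV (F := fun x h => (Q h).eval x * conj ((Q' h).eval x))
    (hQ.measurable_eval.mul (Complex.continuous_conj.measurable.comp hQ'.measurable_eval))
    ((hQ.hasMoments_eval hz.hasMoments).mul (hQ'.hasMoments_eval hz.hasMoments).conj).integrable]
  simp_rw [fun ω' => Quad.integral_eval_mul_conj hz (Q (V ω')) (Q' (V ω'))]

end TwoStage

section OfPair
variable {K N : ℕ}

/-- The polynomial `c + p ⬝ h i + q ⬝ conj (h k) + (h k)ᴴ S (h i)` in the components of the vectors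
`h 1, …, h K`. -/
def ofPair (k i : Fin K) (c : ℂ) (p q : Fin N → ℂ) (S : Fin N → Fin N → ℂ) :
    Quad (Fin K × Fin N) where
  c := c
  p s := if s.1 = i then p s.2 else 0
  q s := if s.1 = k then q s.2 else 0
  S s t := if s.1 = k then if t.1 = i then S s.2 t.2 else 0 else 0

lemma eval_ofPair (k i : Fin K) (c : ℂ) (p q : Fin N → ℂ) (S : Fin N → Fin N → ℂ)
    (h : Fin K → Fin N → ℂ) :
    (ofPair k i c p q S).eval (fun s => h s.1 s.2) =
      c + ∑ n, p n * h i n + ∑ n, q n * conj (h k n)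
        + ∑ n, ∑ m, S n m * (conj (h k n) * h i m) := by
  simp only [eval, ofPair, Fintype.sum_prod_type, ite_mul, zero_mul]
  simp_rw [Finset.sum_comm (s := (Finset.univ : Finset (Fin K)))
    (t := (Finset.univ : Finset (Fin N)))]
  simp

lemma mean_ofPair (k i : Fin K) (c : ℂ) (p q : Fin N → ℂ) (S : Fin N → Fin N → ℂ) :
    (ofPair k i c p q S).mean (fun _ => 1) = c + if k = i then ∑ n, S n n else 0 := by
  simp only [mean, ofPair, Fintype.sum_prod_type]
  rw [Finset.sum_comm]
  by_cases h : k = i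
  · subst h
    simp
  · simp [h]

lemma cov_ofPair (k i k' i' : Fin K) (c c' : ℂ) (p q p' q' : Fin N → ℂ)
    (S S' : Fin N → Fin N → ℂ) :
    (ofPair k i c p q S).cov (fun _ => 1) (ofPair k' i' c' p' q' S') =
      (if i = i' then ∑ n, p n * conj (p' n) else 0)
        + (if k = k' then ∑ n, q n * conj (q' n) else 0)
        + if k = k' ∧ i = i' then ∑ n, ∑ m, S n m * conj (S' n m) else 0 := by
  have e1 (x y : Fin K) (P P' : Fin N → ℂ) :
      ∑ s : Fin K × Fin N, (if s.1 = x then P s.2 else 0) *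
        conj (if s.1 = y then P' s.2 else 0) * ((1 : ℝ≥0) : ℂ) =
      if x = y then ∑ n, P n * conj (P' n) else 0 := by
    rw [Fintype.sum_prod_type, Finset.sum_comm]
    by_cases h : x = y
    · subst h
      simp [apply_ite]
    · simp [h, Ne.symm h, apply_ite]
  unfold cov
  refine congrArg₂ (· + ·) (congrArg₂ (· + ·) (e1 i i' p p') (e1 k k' q q')) ?_
  simp only [ofPair, Fintype.sum_prod_type]
  by_cases h1 : k = k'
  · subst h1
    by_cases h2 : i = i'
    · subst h2
      rw [Finset.sum_comm]
      simp only [apply_ite conj, map_zero, and_self, if_true]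
      refine Finset.sum_congr rfl fun n _ => ?_
      rw [Finset.sum_eq_single k (by intro b _ hb; simp [hb]) (by simp), Finset.sum_comm]
      refine Finset.sum_congr rfl fun m _ => ?_
      rw [Finset.sum_eq_single i (by intro b _ hb; simp [hb]) (by simp)]
      simp
    · simp only [h2, and_false, if_false]
      refine Finset.sum_eq_zero fun x _ => Finset.sum_eq_zero fun n _ =>
        Finset.sum_eq_zero fun y _ => Finset.sum_eq_zero fun m _ => ?_
      by_cases h3 : y = i
      · subst h3; simp [h2]
      · simp [h3]
  · simp only [h1, false_and, if_false]
    refine Finset.sum_eq_zero fun x _ => Finset.sum_eq_zero fun n _ =>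
      Finset.sum_eq_zero fun y _ => Finset.sum_eq_zero fun m _ => ?_
    by_cases h3 : x = k
    · subst h3; simp [h1]
    · simp [h3]

end OfPair
end Quad

/-! ### Array responses and mode indicators -/

lemma arrayResponse_mul_conj (ds lam : ℝ) (X Xy : ℕ) (ψa ψe : ℝ) (x : Fin X) :
    arrayResponse ds lam X Xy ψa ψe x * conj (arrayResponse ds lam X Xy ψa ψe x) = 1 := by
  rw [Complex.mul_conj', arrayResponse, mul_comm, Complex.norm_exp_ofReal_mul_I]
  simp

lemma conj_exp_I_mul_ofReal (x : ℝ) :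
    conj (Complex.exp (Complex.I * (x : ℂ))) = Complex.exp (Complex.I * ((-x : ℝ) : ℂ)) := by
  rw [← Complex.exp_conj]
  simp

namespace System
variable {K L N a τ : ℕ} (S : System K L N a τ)

lemma aL_mul_conj (l : Fin L) : S.aL l * conj (S.aL l) = 1 := arrayResponse_mul_conj ..

lemma aN_mul_conj (n : Fin N) : S.aN n * conj (S.aN n) = 1 := arrayResponse_mul_conj ..

lemma hbar_mul_conj (k : Fin K) (n : Fin N) : S.hbar k n * conj (S.hbar k n) = 1 :=
  arrayResponse_mul_conj ..

lemma mode_cases (n : Fin N) : S.mode n = 0 ∨ S.mode n = 1 := S.A_mode n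

lemma transpose_mul_A : S.Aᵀ * S.A = Matrix.diagonal S.mode :=
  S.A_diag.diagonal_diag.symm

lemma sum_mode : ∑ n, S.mode n = a := by
  have h1 : ∀ n, S.mode n = if (S.Aᵀ * S.A) n n = 1 then 1 else 0 := fun n => by
    rcases S.A_mode n with h | h <;> simp [mode, h]
  have h2 := S.A_card
  rw [Nat.card_eq_fintype_card, Fintype.card_subtype] at h2
  rw [Finset.sum_congr rfl fun n _ => h1 n, Finset.sum_boole, h2]

lemma a_le_N (S : System K L N a τ) : a ≤ N := by
  have h := S.sum_mode
  have h1 : ∑ n, S.mode n ≤ ∑ _n : Fin N, 1 := Finset.sum_le_sum fun n _ => by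
    rcases S.mode_cases n with h | h <;> simp [h]
  rw [h] at h1
  simpa using h1

lemma A_mul_mode (j : Fin a) (n : Fin N) : S.A j n * S.mode n = S.A j n := by
  rcases S.mode_cases n with h | h
  · have h1 : ∑ i, S.A i n * S.A i n = 0 := by
      simpa [mode, Matrix.mul_apply] using h
    have h2 := (Finset.sum_eq_zero_iff_of_nonneg fun i _ => mul_self_nonneg _).1 h1 j
      (Finset.mem_univ j)
    simp [mul_self_eq_zero.1 h2]
  · simp [h]

/-- The rows of the indicator matrix are orthonormal: `A Aᵀ` is idempotent and has the trace `a` of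
`Aᵀ A`, so that the trace of `(1 - A Aᵀ)²` vanishes. -/
lemma A_mul_transpose : S.A * S.Aᵀ = 1 := by
  set Q := S.A * S.Aᵀ with hQ
  have h1 : S.A * (S.Aᵀ * S.A) = S.A := by
    rw [transpose_mul_A]
    ext j n
    rw [Matrix.mul_diagonal, A_mul_mode]
  have h2 : Q * Q = Q := by
    calc Q * Q = S.A * (S.Aᵀ * S.A) * S.Aᵀ := by simp only [hQ, Matrix.mul_assoc]
      _ = Q := by rw [h1]
  have h3 : Q.trace = a := by
    rw [hQ, Matrix.trace_mul_comm, transpose_mul_A, Matrix.trace_diagonal, sum_mode]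
  have h4 : (1 - Q)ᴴ * (1 - Q) = 1 - Q := by
    have : Qᴴ = Q := by
      rw [Matrix.conjTranspose_eq_transpose_of_trivial, hQ, Matrix.transpose_mul,
        Matrix.transpose_transpose]
    rw [Matrix.conjTranspose_sub, Matrix.conjTranspose_one, this, sub_mul, mul_sub, mul_sub, h2]
    simp
  have h5 : ((1 - Q)ᴴ * (1 - Q)).trace = 0 := by
    rw [h4, Matrix.trace_sub, h3, Matrix.trace_one]
    simp
  rw [Matrix.trace_conjTranspose_mul_self_eq_zero_iff] at h5
  exact (sub_eq_zero.1 h5).symm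

lemma sum_A_mul_A (i j : Fin a) :
    ∑ n, (S.A i n : ℂ) * (S.A j n : ℂ) = if i = j then 1 else 0 := by
  have h := congrFun (congrFun S.A_mul_transpose i) j
  rw [Matrix.mul_apply, Matrix.one_apply] at h
  simp only [Matrix.transpose_apply] at h
  rw [← Complex.ofReal_one, ← Complex.ofReal_zero, ← apply_ite, ← h]
  push_cast
  rfl

lemma sum_A_mul_A' (n m : Fin N) :
    ∑ j, (S.A j n : ℂ) * (S.A j m : ℂ) = if n = m then (S.mode n : ℂ) else 0 := by
  have h := congrFun (congrFun S.transpose_mul_A n) m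
  rw [Matrix.mul_apply, Matrix.diagonal_apply] at h
  simp only [Matrix.transpose_apply] at h
  rw [← Complex.ofReal_zero, ← apply_ite, ← h]
  push_cast
  rfl

lemma conjTranspose_mul_Ac : S.Acᴴ * S.Ac = Matrix.diagonal fun n => (S.mode n : ℂ) := by
  ext n m
  rw [Matrix.mul_apply, Matrix.diagonal_apply, ← sum_A_mul_A']
  simp [Ac]

lemma refl_eq : S.refl = Matrix.diagonal fun n => ((1 - S.mode n : ℝ) : ℂ) := by
  rw [refl, conjTranspose_mul_Ac, ← Matrix.diagonal_one, Matrix.diagonal_sub]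
  congr 1
  ext n
  simp

/-- The indicator `1 - a_n` of the reflecting elements. -/
def rmode (n : Fin N) : ℂ := ((1 - S.mode n : ℝ) : ℂ)

lemma conj_rmode (n : Fin N) : conj (S.rmode n) = S.rmode n := Complex.conj_ofReal _

lemma rmode_mul_self (n : Fin N) : S.rmode n * S.rmode n = S.rmode n := by
  rcases S.mode_cases n with h | h <;> simp [rmode, h]

lemma rmode_mul_mode (n : Fin N) : S.rmode n * S.mode n = 0 := by
  rcases S.mode_cases n with h | h <;> simp [rmode, h]

lemma sum_mode_complex : ∑ n, (S.mode n : ℂ) = a := by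
  have := S.sum_mode
  exact_mod_cast this

lemma sum_rmode : ∑ n, S.rmode n = (N : ℂ) - a := by
  simp [rmode, S.sum_mode_complex]

/-- The diagonal of `B`. -/
def ρ (n : Fin N) : ℂ := S.rmode n * S.θ n

lemma B_eq : S.B = Matrix.diagonal S.ρ := by
  rw [B, refl_eq, Matrix.diagonal_mul_diagonal]
  rfl

lemma ρ_mul_conj (n : Fin N) : S.ρ n * conj (S.ρ n) = S.rmode n := by
  rcases S.mode_cases n with h | h
  · have h1 : S.θ n * conj (S.θ n) = 1 := by
      rw [Complex.mul_conj', S.θ_unit n h]; simp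
    simp [ρ, rmode, h, h1]
  · simp [ρ, rmode, h]

/-- The row vector `a_Nᴴ B`. -/
def bvec (n : Fin N) : ℂ := conj (S.aN n) * S.ρ n

lemma bvec_mul_conj (n : Fin N) : S.bvec n * conj (S.bvec n) = S.rmode n := by
  have h := S.aN_mul_conj n
  have h1 := S.ρ_mul_conj n
  simp only [bvec, map_mul, Complex.conj_conj]
  linear_combination S.ρ n * conj (S.ρ n) * h + h1

lemma bvec_mul_rmode (n : Fin N) : S.bvec n * S.rmode n = S.bvec n := by
  simp only [bvec, ρ]
  linear_combination (conj (S.aN n) * S.θ n) * S.rmode_mul_self n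

lemma bvec_mul_mode (n : Fin N) : S.bvec n * S.mode n = 0 := by
  rw [← bvec_mul_rmode, mul_assoc, rmode_mul_mode, mul_zero]

lemma A_mul_rmode (j : Fin a) (n : Fin N) : (S.A j n : ℂ) * S.rmode n = 0 := by
  have h := S.A_mul_mode j n
  have h1 : (S.A j n : ℂ) * S.mode n = S.A j n := by exact_mod_cast h
  have h2 := S.rmode_mul_mode n
  linear_combination (-S.rmode n) * h1 + S.A j n * h2

lemma A_mul_bvec (j : Fin a) (n : Fin N) : (S.A j n : ℂ) * S.bvec n = 0 := by
  have h := S.A_mul_rmode j n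
  rw [← bvec_mul_rmode]
  linear_combination S.bvec n * h

lemma f_eq_sum (k : Fin K) : S.f k = ∑ n, S.bvec n * S.hbar k n := by
  refine Finset.sum_congr rfl fun n _ => ?_
  rcases S.mode_cases n with h | h
  · have h1 : S.θ n = Complex.exp (Complex.I * (Complex.arg (S.θ n) : ℂ)) := by
      conv_lhs => rw [← Complex.norm_mul_exp_arg_mul_I (S.θ n), S.θ_unit n h]
      simp [mul_comm]
    simp only [bvec, ρ, rmode, h, aN, hbar, arrayResponse]
    rw [conj_exp_I_mul_ofReal]
    conv_rhs => rw [h1]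
    simp only [sub_zero, Complex.ofReal_one, one_mul, ← Complex.exp_add]
    congr 1
    rw [ζ]
    push_cast
    ring
  · simp [bvec, ρ, rmode, h]

lemma f_eq (k : Fin K) : S.f k = star S.aN ⬝ᵥ (S.B.mulVec (S.hbar k)) := by
  rw [f_eq_sum, B_eq]
  simp only [dotProduct, Matrix.mulVec_diagonal, Pi.star_apply, RCLike.star_def, bvec]
  exact Finset.sum_congr rfl fun n _ => by ring

lemma g_eq_sum (k i : Fin K) :
    S.g k i = ∑ n, (S.mode n : ℂ) * (conj (S.hbar k n) * S.hbar i n) := by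
  refine Finset.sum_congr rfl fun n _ => ?_
  simp only [hbar, arrayResponse]
  rw [conj_exp_I_mul_ofReal, ← Complex.exp_add]
  congr 2
  rw [ς]
  push_cast
  ring

lemma g_eq (k i : Fin K) :
    S.g k i = star (S.hbar k) ⬝ᵥ ((S.Acᴴ * S.Ac).mulVec (S.hbar i)) := by
  rw [g_eq_sum, conjTranspose_mul_Ac]
  simp only [dotProduct, Matrix.mulVec_diagonal, Pi.star_apply, RCLike.star_def]
  exact Finset.sum_congr rfl fun n _ => by ring

lemma losRefl_eq_sum (k i : Fin K) :
    S.losRefl k i = ∑ n, S.rmode n * (conj (S.hbar k n) * S.hbar i n) := by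
  rw [losRefl, refl_eq]
  simp only [dotProduct, Matrix.mulVec_diagonal, Pi.star_apply, RCLike.star_def, rmode]
  exact Finset.sum_congr rfl fun n _ => by ring

lemma losAll_sub_g (k i : Fin K) : S.losAll k i - S.g k i = S.losRefl k i := by
  rw [losRefl_eq_sum, g_eq_sum, losAll]
  simp only [dotProduct, Pi.star_apply, RCLike.star_def, rmode, ← Finset.sum_sub_distrib]
  exact Finset.sum_congr rfl fun n _ => by push_cast; ring

lemma conj_g (k i : Fin K) : conj (S.g k i) = S.g i k := by
  rw [g_eq_sum, g_eq_sum, map_sum]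
  refine Finset.sum_congr rfl fun n _ => ?_
  simp only [map_mul, Complex.conj_ofReal, Complex.conj_conj]
  ring

lemma conj_losRefl (k i : Fin K) : conj (S.losRefl k i) = S.losRefl i k := by
  rw [losRefl_eq_sum, losRefl_eq_sum, map_sum]
  refine Finset.sum_congr rfl fun n _ => ?_
  simp only [map_mul, conj_rmode, Complex.conj_conj]
  ring

end System

/-! ### Splitting of the randomness -/

/-- Column index of the `L × (N + K + τ)` matrix `[H̃, d̃₁, …, d̃_K, N_B]` which collects the
randomness at the BS. -/
abbrev Col (K N τ : ℕ) : Type := Fin N ⊕ Fin K ⊕ Fin τ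

/-- Index of all scalar entries of the random quantities except for the user-RDARS channels. -/
abbrev Inner (K L N a τ : ℕ) : Type := (Fin L × Col K N τ) ⊕ (Fin a × Fin τ)

section
variable {K L N a τ : ℕ}

/-- `Inner` as a part of the index set of all scalar entries. -/
def innerSrc : Inner K L N a τ → Src K L N a τ
  | .inl (l, .inl n) => .inl (l, n)
  | .inl (l, .inr (.inl k)) => .inr (.inr (.inl (k, l)))
  | .inl (l, .inr (.inr t)) => .inr (.inr (.inr (.inl (l, t))))
  | .inr s => .inr (.inr (.inr (.inr s)))

lemma innerSrc_injective : Function.Injective (innerSrc (K := K) (L := L) (N := N) (a := a)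
    (τ := τ)) := by
  rintro (⟨l, n | k | t⟩ | s) (⟨l', n' | k' | t'⟩ | s') h <;> simp_all [innerSrc]

lemma innerSrc_ne (j : Inner K L N a τ) (s : Fin K × Fin N) : innerSrc j ≠ .inr (.inl s) := by
  rcases j with ⟨l, n | k | t⟩ | j <;> simp [innerSrc]

variable {Ω : Type*} (X : Randomness K L N a τ Ω)

/-- The scalar entries of the random quantities except for the user-RDARS channels. -/
def Randomness.inner (j : Inner K L N a τ) (ω : Ω) : ℂ := X.entry (innerSrc j) ω

/-- The small-scale components of all user-RDARS channels. -/
def Randomness.outer (ω : Ω) (k : Fin K) : Fin N → ℂ := X.htil k ω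

namespace System
variable (S : System K L N a τ)

/-- Variances of the scalar entries except for the user-RDARS channels. -/
def innerVar (j : Inner K L N a τ) : ℝ≥0 := S.entryVar (innerSrc j)

section Model
variable [MeasurableSpace Ω] {μ : Measure Ω} {S} {X}

lemma IsModel.inner (hX : S.IsModel X μ) : IsGaussianFamily X.inner S.innerVar μ :=
  IsGaussianFamily.precomp ⟨hX.law, hX.indep⟩ innerSrc_injective

lemma IsModel.outer (hX : S.IsModel X μ) :
    IsGaussianFamily (fun (s : Fin K × Fin N) ω => X.outer ω s.1 s.2) (fun _ => 1) μ :=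
  IsGaussianFamily.precomp (z := X.entry) (v := S.entryVar)
    (e := fun s : Fin K × Fin N => .inr (.inl s)) ⟨hX.law, hX.indep⟩
    (Sum.inr_injective.comp Sum.inl_injective)

lemma IsModel.aemeasurable_outer (hX : S.IsModel X μ) : AEMeasurable X.outer μ :=
  aemeasurable_pi_lambda _ fun k => aemeasurable_pi_lambda _ fun n =>
    (hX.outer.law (k, n)).aemeasurable

lemma IsModel.indepFun (hX : S.IsModel X μ) :
    IndepFun (fun ω j => X.inner j ω) X.outer μ := by
  classical
  set T₁ : Finset (Src K L N a τ) := Finset.univ.image innerSrc with hT₁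
  set T₂ : Finset (Src K L N a τ) := Finset.univ.image fun s : Fin K × Fin N => .inr (.inl s)
    with hT₂
  have hd : Disjoint T₁ T₂ := by
    rw [Finset.disjoint_left]
    intro x h1 h2
    simp only [hT₁, hT₂, Finset.mem_image, Finset.mem_univ, true_and] at h1 h2
    obtain ⟨j, rfl⟩ := h1
    obtain ⟨s, hs⟩ := h2
    exact innerSrc_ne j s hs.symm
  have h := hX.indep.indepFun_finset₀ T₁ T₂ hd fun s => (hX.law s).aemeasurable
  have m1 (j : Inner K L N a τ) : innerSrc j ∈ T₁ := by simp [hT₁]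
  have m2 (k : Fin K) (n : Fin N) : (.inr (.inl (k, n)) : Src K L N a τ) ∈ T₂ := by simp [hT₂]
  exact h.comp (φ := fun x j => x ⟨innerSrc j, m1 j⟩)
    (ψ := fun x k n => x ⟨.inr (.inl (k, n)), m2 k n⟩) (by fun_prop) (by fun_prop)

lemma IsModel.tame_outer [IsFiniteMeasure μ] (hX : S.IsModel X μ) (k : Fin K) (n : Fin N) :
    Tame X.outer μ (fun h => h k n) :=
  ⟨by fun_prop, hX.outer.hasMoments (k, n)⟩

end Model

/-! ### Channel, observation and estimate as polynomials -/

/-- The square root of `c k`, as a factor of the cascaded channel. -/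
def rc (k : Fin K) : ℝ := Real.sqrt (S.β / (S.δ + 1)) * Real.sqrt (S.α k / (S.ε k + 1))

/-- The square root of `d_k`. -/
def rd (k : Fin K) : ℝ := Real.sqrt (S.α k / (S.ε k + 1))

lemma rc_sq (k : Fin K) : S.rc k ^ 2 = S.c k := by
  have h1 := S.β_nonneg
  have h2 := S.α_nonneg k
  have h3 := S.ε_nonneg k
  have h4 := S.δ_nonneg
  rw [rc, mul_pow, Real.sq_sqrt (by positivity), Real.sq_sqrt (by positivity), c]
  field_simp

lemma rd_sq (k : Fin K) : S.rd k ^ 2 = S.dc k := by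
  have h2 := S.α_nonneg k
  have h3 := S.ε_nonneg k
  rw [rd, Real.sq_sqrt (by positivity), dc]

lemma c_nonneg (k : Fin K) : 0 ≤ S.c k := S.rc_sq k ▸ sq_nonneg _

lemma dc_nonneg (k : Fin K) : 0 ≤ S.dc k := S.rd_sq k ▸ sq_nonneg _

lemma rc_nonneg (k : Fin K) : 0 ≤ S.rc k := by unfold rc; positivity

lemma rd_nonneg (k : Fin K) : 0 ≤ S.rd k := by unfold rd; positivity

/-- The small-scale fading of a user-RDARS channel, with weight `g` on the random component. -/
def fade (g : ℝ) (k : Fin K) (h : Fin K → Fin N → ℂ) (n : Fin N) : ℂ :=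
  Real.sqrt (S.ε k) * S.hbar k n + g * h k n

/-- The component of the reflected user-RDARS channel along the RDARS-BS line of sight, with weight
`e` on the random component. -/
def along (e : ℝ) (k : Fin K) (h : Fin K → Fin N → ℂ) : ℂ :=
  Real.sqrt (S.ε k) * S.f k + e * ∑ n, S.bvec n * h k n

lemma along_one (k : Fin K) (h : Fin K → Fin N → ℂ) :
    S.along 1 k h = ∑ n, S.bvec n * S.fade 1 k h n := by
  rw [along, f_eq_sum, Finset.mul_sum, Finset.mul_sum, ← Finset.sum_add_distrib]
  refine Finset.sum_congr rfl fun n _ => ?_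
  rw [fade]
  push_cast
  ring

/-- The weights with which the columns of `[H̃, d̃₁, …, d̃_K, N_B]` enter the channel (`κ = 0`)
or the pilot observation (`κ = 1`) of user `k`. -/
def weight (κ : ℝ) (k : Fin K) (h : Fin K → Fin N → ℂ) : Col K N τ → ℂ
  | .inl n => S.rc k * (S.ρ n * S.fade 1 k h n)
  | .inr (.inl i) => if i = k then (Real.sqrt (S.γ k) : ℂ) else 0
  | .inr (.inr t) => κ * (S.pilots t k / Real.sqrt (τ * S.pp))

/-- Given the user-RDARS channels `h`, the components of the vector
`[√(c_k δ) (√ε_k f_k + e a_Nᴴ B h) a_L + Φ W w; √d_k A (√ε_k h̄_k + g h) + g κ N_R s_k / √(τ p_p)]`,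
where `W = [H̃, d̃₁, …, d̃_K, N_B]` and `w` are the weights. This is the channel for
`e = Φ = g = 1`, `κ = 0`, the pilot observation for `e = Φ = g = κ = 1`, and with suitable values of
`e`, `Φ`, `g` also the LMMSE estimate. -/
def obs (e : ℝ) (Φ : Matrix (Fin L) (Fin L) ℂ) (g κ : ℝ) (k : Fin K) (h : Fin K → Fin N → ℂ) :
    Fin L ⊕ Fin a → Quad (Inner K L N a τ)
  | .inl l =>
    { c := S.rc k * Real.sqrt S.δ * S.along e k h * S.aL l
      p := Sum.elim (fun s => Φ l s.1 * S.weight κ k h s.2) (fun _ => 0)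
      q := 0
      S := 0 }
  | .inr j =>
    { c := S.rd k * ∑ n, S.A j n * S.fade g k h n
      p := Sum.elim (fun _ => 0)
        (fun s => if s.1 = j then g * κ * (S.pilots s.2 k / Real.sqrt (τ * S.pp)) else 0)
      q := 0
      S := 0 }

lemma eval_obs_inl (e : ℝ) (Φ : Matrix (Fin L) (Fin L) ℂ) (g κ : ℝ) (k : Fin K)
    (h : Fin K → Fin N → ℂ) (l : Fin L) (z : Inner K L N a τ → ℂ) :
    (S.obs e Φ g κ k h (.inl l)).eval z = S.rc k * Real.sqrt S.δ * S.along e k h * S.aL l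
      + ∑ l', Φ l l' * ∑ m, S.weight κ k h m * z (.inl (l', m)) := by
  simp only [Quad.eval, obs, Fintype.sum_sum_type, Sum.elim_inl, Sum.elim_inr, zero_mul,
    Finset.sum_const_zero, add_zero, Pi.zero_apply]
  simp only [Fintype.sum_prod_type (α₁ := Fin L), Finset.mul_sum, mul_add, mul_assoc,
    Fintype.sum_sum_type]

lemma eval_obs_inr (e : ℝ) (Φ : Matrix (Fin L) (Fin L) ℂ) (g κ : ℝ) (k : Fin K)
    (h : Fin K → Fin N → ℂ) (j : Fin a) (z : Inner K L N a τ → ℂ) :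
    (S.obs e Φ g κ k h (.inr j)).eval z = S.rd k * ∑ n, S.A j n * S.fade g k h n
      + g * κ * ∑ t, (S.pilots t k / Real.sqrt (τ * S.pp)) * z (.inr (j, t)) := by
  simp only [Quad.eval, obs, Fintype.sum_sum_type, Sum.elim_inl, Sum.elim_inr, zero_mul,
    Finset.sum_const_zero, add_zero, Pi.zero_apply, zero_add]
  simp only [Fintype.sum_prod_type, ite_mul, zero_mul]
  rw [Finset.sum_comm]
  simp [Finset.mul_sum, mul_assoc]

lemma τ_pos (S : System K L N a τ) (k : Fin K) : 0 < τ := by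
  rcases Nat.eq_zero_or_pos τ with h | h
  · subst h
    have h1 := congrFun (congrFun S.pilots_orth k) k
    simp [Matrix.mul_apply] at h1
  · exact h

lemma sqrt_τpp_ne (k : Fin K) : (Real.sqrt (τ * S.pp) : ℂ) ≠ 0 := by
  have h1 := S.pp_pos
  have h2 : (0 : ℝ) < τ := by exact_mod_cast S.τ_pos k
  exact_mod_cast (Real.sqrt_pos.2 (mul_pos h2 h1)).ne'

lemma q_eq_eval (k : Fin K) (ω : Ω) (j : Fin L ⊕ Fin a) :
    S.q X k ω j = (S.obs 1 1 1 0 k (X.outer ω) j).eval fun s => X.inner s ω := by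
  rcases j with l | j
  · rw [eval_obs_inl]
    simp only [q, Sum.elim_inl, Pi.add_apply, B_eq, Matrix.mulVec, dotProduct,
      Matrix.mul_diagonal, d, Pi.smul_apply, smul_eq_mul]
    simp only [Matrix.one_apply, ite_mul, one_mul, zero_mul, Finset.sum_ite_eq, Finset.mem_univ,
      if_true, Fintype.sum_sum_type, weight, Complex.ofReal_zero, Finset.sum_const_zero, add_zero]
    rw [← add_assoc]
    congr 1
    · rw [along_one, Finset.mul_sum, Finset.sum_mul, ← Finset.sum_add_distrib]
      refine Finset.sum_congr rfl fun n _ => ?_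
      simp only [H, h, Matrix.smul_apply, Matrix.add_apply, Hbar, Matrix.vecMulVec_apply,
        Pi.star_apply, RCLike.star_def, smul_eq_mul, Pi.smul_apply, Pi.add_apply, rc, fade, bvec,
        Randomness.outer, Randomness.inner, innerSrc, Randomness.entry]
      push_cast
      ring
    · simp [Randomness.inner, innerSrc, Randomness.entry]
  · rw [eval_obs_inr]
    simp only [q, Sum.elim_inr, Matrix.mulVec, dotProduct, Ac, Matrix.map_apply, h,
      Pi.smul_apply, Pi.add_apply, smul_eq_mul, fade, rd, Randomness.outer]
    rw [Finset.mul_sum]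
    simp only [Complex.ofReal_zero, mul_zero, zero_mul, add_zero]
    refine Finset.sum_congr rfl fun n _ => ?_
    push_cast
    ring

lemma y_eq (k : Fin K) (ω : Ω) (j : Fin L ⊕ Fin a) :
    S.y X k ω j = S.q X k ω j + ∑ t, (S.pilots t k / Real.sqrt (τ * S.pp)) *
      Sum.elim (fun l => X.NB ω l t) (fun m => X.NR ω m t) j := by
  have hr := S.sqrt_τpp_ne k
  have h1 : S.pilotsᴴ *ᵥ (fun t => S.pilots t k) = Pi.single k 1 := by
    ext i
    have := congrFun (congrFun S.pilots_orth i) k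
    rw [Matrix.mul_apply] at this
    rw [Matrix.mulVec, dotProduct, this, Matrix.one_apply, Pi.single_apply]
  rw [y, Yp, Matrix.add_mulVec, Matrix.smul_mulVec, ← Matrix.mulVec_mulVec, h1]
  simp only [Pi.smul_apply, Pi.add_apply, smul_eq_mul, Matrix.mulVec_single_one, Matrix.col_apply,
    Matrix.of_apply, mul_add]
  congr 1
  · field_simp
  · rw [Matrix.mulVec, dotProduct, Finset.mul_sum]
    refine Finset.sum_congr rfl fun t _ => ?_
    rw [Matrix.of_apply]
    ring

lemma y_eq_eval (k : Fin K) (ω : Ω) (j : Fin L ⊕ Fin a) :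
    S.y X k ω j = (S.obs 1 1 1 1 k (X.outer ω) j).eval fun s => X.inner s ω := by
  rw [y_eq, q_eq_eval]
  rcases j with l | j
  · rw [eval_obs_inl, eval_obs_inl]
    simp only [Matrix.one_apply, ite_mul, one_mul, zero_mul, Finset.sum_ite_eq, Finset.mem_univ,
      if_true, Fintype.sum_sum_type, weight, Complex.ofReal_zero, Finset.sum_const_zero, add_zero,
      Sum.elim_inl, Complex.ofReal_one, add_assoc]
    rfl
  · rw [eval_obs_inr, eval_obs_inr]
    simp only [Complex.ofReal_zero, Complex.ofReal_one, mul_zero, zero_mul, add_zero, one_mul,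
      Sum.elim_inr]
    rfl

section Tame
variable [MeasurableSpace Ω] {μ : Measure Ω} [IsFiniteMeasure μ] {X}

lemma tame_fade (hX : S.IsModel X μ) (g : ℝ) (k : Fin K) (n : Fin N) :
    Tame X.outer μ (fun h => S.fade g k h n) :=
  (Tame.const _).add ((Tame.const _).mul (hX.tame_outer k n))

lemma tame_along (hX : S.IsModel X μ) (e : ℝ) (k : Fin K) :
    Tame X.outer μ (fun h => S.along e k h) :=
  (Tame.const _).add ((Tame.const _).mul (Tame.sum fun n =>
    (Tame.const _).mul (hX.tame_outer k n)))

lemma tame_weight (hX : S.IsModel X μ) (κ : ℝ) (k : Fin K) (m : Col K N τ) :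
    Tame X.outer μ (fun h => S.weight κ k h m) := by
  rcases m with n | i | t
  · exact (Tame.const _).mul ((Tame.const _).mul (S.tame_fade hX 1 k n))
  · exact Tame.const _
  · exact Tame.const _

lemma tame_obs (hX : S.IsModel X μ) (e : ℝ) (Φ : Matrix (Fin L) (Fin L) ℂ) (g κ : ℝ)
    (k : Fin K) (j : Fin L ⊕ Fin a) :
    Quad.Tame X.outer μ (fun h => S.obs e Φ g κ k h j) := by
  rcases j with l | j
  · refine ⟨((Tame.const _).mul (S.tame_along hX e k)).mul (Tame.const _), ?_,
      fun _ => Tame.const _, fun _ _ => Tame.const _⟩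
    rintro (s | s)
    · exact (Tame.const _).mul (S.tame_weight hX κ k s.2)
    · exact Tame.const _
  · refine ⟨(Tame.const _).mul (Tame.sum fun n => (Tame.const _).mul (S.tame_fade hX g k n)), ?_,
      fun _ => Tame.const _, fun _ _ => Tame.const _⟩
    rintro (s | s)
    · exact Tame.const _
    · exact Tame.const _

end Tame

end System
end

/-! ### Weights and quadratic forms of the fading -/

section
variable {K L N a τ : ℕ} {Ω : Type*} {X : Randomness K L N a τ Ω}
namespace System
variable (S : System K L N a τ)

lemma sqrt_mul_sqrt {x : ℝ} (hx : 0 ≤ x) : (Real.sqrt x : ℂ) * Real.sqrt x = x := by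
  rw [← Complex.ofReal_mul, Real.mul_self_sqrt hx]

/-- Variances of the columns of `[H̃, d̃₁, …, d̃_K, N_B]`. -/
def colVar : Col K N τ → ℝ
  | .inl _ => 1
  | .inr (.inl _) => 1
  | .inr (.inr _) => S.σB ^ 2

lemma innerVar_inl (s : Fin L × Col K N τ) : (S.innerVar (.inl s) : ℂ) = S.colVar s.2 := by
  rcases s with ⟨l, n | k | t⟩
  · simp [innerVar, innerSrc, entryVar, colVar]
  · simp [innerVar, innerSrc, entryVar, colVar]
  · simp only [innerVar, innerSrc, entryVar, colVar]
    rw [← NNReal.coe_toRealHom, NNReal.coe_toRealHom, Real.coe_toNNReal _ (sq_nonneg _)]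

lemma innerVar_inr (s : Fin a × Fin τ) : (S.innerVar (.inr s) : ℂ) = S.σR ^ 2 := by
  simp only [innerVar, innerSrc, entryVar]
  rw [Real.coe_toNNReal _ (sq_nonneg _)]
  push_cast
  rfl

lemma sum_pilots (k i : Fin K) (σ : ℝ) :
    ∑ t, conj (S.pilots t k / Real.sqrt (τ * S.pp)) * (S.pilots t i / Real.sqrt (τ * S.pp)) *
      (σ ^ 2 : ℂ) = if k = i then ((σ ^ 2 / (τ * S.pp) : ℝ) : ℂ) else 0 := by
  have h1 := congrFun (congrFun S.pilots_orth k) i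
  rw [Matrix.mul_apply, Matrix.one_apply] at h1
  simp only [Matrix.conjTranspose_apply, RCLike.star_def] at h1
  have h2 : (Real.sqrt (τ * S.pp) : ℂ) * Real.sqrt (τ * S.pp) = τ * S.pp := by
    rw [sqrt_mul_sqrt (mul_nonneg (Nat.cast_nonneg _) S.pp_pos.le)]
    push_cast
    rfl
  have h3 : ∑ t, conj (S.pilots t k / Real.sqrt (τ * S.pp)) *
      (S.pilots t i / Real.sqrt (τ * S.pp)) * (σ ^ 2 : ℂ) =
      (∑ t, conj (S.pilots t k) * S.pilots t i) * ((σ ^ 2 : ℂ) / (τ * S.pp)) := by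
    rw [Finset.sum_mul]
    refine Finset.sum_congr rfl fun t _ => ?_
    rw [map_div₀, Complex.conj_ofReal, ← h2]
    ring
  rw [h3, h1]
  split_ifs
  · push_cast
    ring
  · simp

/-- `∑ n, χ n * conj (fade g k n) * fade 1 i n` as a function of the user-RDARS channels. -/
def fadeForm (χ : Fin N → ℂ) (g : ℝ) (k i : Fin K) (h : Fin K → Fin N → ℂ) : ℂ :=
  ∑ n, χ n * (conj (S.fade g k h n) * S.fade 1 i h n)

/-- The weighted inner product of the weights of two users. -/
lemma sum_weight (κ κ' : ℝ) (k i : Fin K) (h : Fin K → Fin N → ℂ) :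
    ∑ m, conj (S.weight κ k h m) * S.weight κ' i h m * S.colVar m =
      S.rc k * S.rc i * S.fadeForm S.rmode 1 k i h
        + if k = i then ((S.γ k + κ * κ' * S.sB : ℝ) : ℂ) else 0 := by
  simp only [Fintype.sum_sum_type, weight, colVar, fadeForm, map_mul, Complex.conj_ofReal]
  congr 1
  · rw [Finset.mul_sum]
    refine Finset.sum_congr rfl fun n _ => ?_
    rw [← ρ_mul_conj]
    push_cast
    ring
  · have h1 := S.sum_pilots k i S.σB
    have h2 : ∑ t, (κ : ℂ) * conj (S.pilots t k / Real.sqrt (τ * S.pp)) *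
        (κ' * (S.pilots t i / Real.sqrt (τ * S.pp))) * ((S.σB ^ 2 : ℝ) : ℂ) =
        κ * κ' * if k = i then (S.sB : ℂ) else 0 := by
      rw [sB, ← h1, Finset.mul_sum]
      refine Finset.sum_congr rfl fun t _ => ?_
      push_cast
      ring
    rw [h2]
    by_cases hk : k = i
    · subst hk
      simp only [if_true, Complex.ofReal_one, mul_one, apply_ite, map_zero, Complex.conj_ofReal,
        ite_mul, mul_zero, zero_mul, Finset.sum_ite_eq', Finset.mem_univ]
      simp [sqrt_mul_sqrt (S.γ_nonneg k)]
    · simp [hk, Ne.symm hk]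

/-! ### Expectations over the user-RDARS channels -/

/-- The polynomial `conj (along e k) * along e' i`. -/
def alongQuad (e e' : ℝ) (k i : Fin K) : Quad (Fin K × Fin N) :=
  Quad.ofPair k i (Real.sqrt (S.ε k) * Real.sqrt (S.ε i) * (conj (S.f k) * S.f i))
    (fun n => Real.sqrt (S.ε k) * conj (S.f k) * (e' * S.bvec n))
    (fun n => Real.sqrt (S.ε i) * S.f i * (e * conj (S.bvec n)))
    (fun n m => e * conj (S.bvec n) * (e' * S.bvec m))

lemma eval_alongQuad (e e' : ℝ) (k i : Fin K) (h : Fin K → Fin N → ℂ) :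
    (S.alongQuad e e' k i).eval (fun s => h s.1 s.2) =
      conj (S.along e k h) * S.along e' i h := by
  rw [alongQuad, Quad.eval_ofPair]
  simp only [along, map_add, map_mul, Complex.conj_ofReal, map_sum]
  have h1 : ∑ n, (Real.sqrt (S.ε k) * conj (S.f k) * (e' * S.bvec n) : ℂ) * h i n =
      Real.sqrt (S.ε k) * conj (S.f k) * (e' * ∑ n, S.bvec n * h i n) := by
    simp only [Finset.mul_sum, mul_assoc]
  have h2 : ∑ n, (Real.sqrt (S.ε i) * S.f i * (e * conj (S.bvec n)) : ℂ) * conj (h k n) =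
      Real.sqrt (S.ε i) * S.f i * (e * ∑ n, conj (S.bvec n) * conj (h k n)) := by
    simp only [Finset.mul_sum, mul_assoc]
  have h3 : ∑ n, ∑ m, (e * conj (S.bvec n) * (e' * S.bvec m) : ℂ) * (conj (h k n) * h i m) =
      (e * ∑ n, conj (S.bvec n) * conj (h k n)) * (e' * ∑ n, S.bvec n * h i n) := by
    rw [Finset.mul_sum, Finset.mul_sum, Finset.sum_mul_sum]
    exact Finset.sum_congr rfl fun n _ => Finset.sum_congr rfl fun m _ => by ring
  rw [h1, h2, h3]
  ring

/-- The polynomial `fadeForm χ g k i`. -/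
def fadeQuad (χ : Fin N → ℂ) (g : ℝ) (k i : Fin K) : Quad (Fin K × Fin N) :=
  Quad.ofPair k i
    (Real.sqrt (S.ε k) * Real.sqrt (S.ε i) * ∑ n, χ n * (conj (S.hbar k n) * S.hbar i n))
    (fun n => Real.sqrt (S.ε k) * (χ n * conj (S.hbar k n)))
    (fun n => g * Real.sqrt (S.ε i) * (χ n * S.hbar i n))
    (fun n m => if n = m then g * χ n else 0)

lemma eval_fadeQuad (χ : Fin N → ℂ) (g : ℝ) (k i : Fin K) (h : Fin K → Fin N → ℂ) :
    (S.fadeQuad χ g k i).eval (fun s => h s.1 s.2) = S.fadeForm χ g k i h := by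
  rw [fadeQuad, Quad.eval_ofPair]
  simp only [ite_mul, zero_mul, Finset.sum_ite_eq, Finset.mem_univ, if_true]
  rw [Finset.mul_sum, ← Finset.sum_add_distrib, ← Finset.sum_add_distrib,
    ← Finset.sum_add_distrib]
  refine Finset.sum_congr rfl fun n _ => ?_
  simp only [fade, map_add, map_mul, Complex.conj_ofReal]
  push_cast
  ring

lemma sum_bvec_mul_conj : ∑ n, S.bvec n * conj (S.bvec n) = (N : ℂ) - a := by
  simp_rw [bvec_mul_conj, sum_rmode]

lemma sqrt_ε_mul (k : Fin K) : (Real.sqrt (S.ε k) : ℂ) * Real.sqrt (S.ε k) = S.ε k :=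
  sqrt_mul_sqrt (S.ε_nonneg k)

lemma mean_alongQuad_self (e e' : ℝ) (k : Fin K) :
    (S.alongQuad e e' k k).mean (fun _ => 1) =
      S.ε k * (conj (S.f k) * S.f k) + e * e' * ((N : ℂ) - a) := by
  rw [alongQuad, Quad.mean_ofPair, if_pos rfl, sqrt_ε_mul, ← sum_bvec_mul_conj, Finset.mul_sum]
  congr 1
  exact Finset.sum_congr rfl fun n _ => by ring

lemma mean_fadeQuad_self (χ : Fin N → ℂ) (k : Fin K) :
    (S.fadeQuad χ 1 k k).mean (fun _ => 1) = (S.ε k + 1) * ∑ n, χ n := by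
  rw [fadeQuad, Quad.mean_ofPair, if_pos rfl, sqrt_ε_mul]
  simp_rw [mul_comm (conj (S.hbar k _)), hbar_mul_conj]
  simp
  ring

section Model
variable [MeasurableSpace Ω] {μ : Measure Ω} [IsProbabilityMeasure μ] {S}

lemma IsModel.integral_affine (hX : S.IsModel X μ) (k : Fin K) (c : ℂ) (p : Fin N → ℂ) :
    ∫ ω, (c + ∑ n, p n * X.outer ω k n) ∂μ = c := by
  have h := Quad.integral_eval hX.outer (Quad.ofPair k k c p 0 0)
  rw [Quad.mean_ofPair] at h
  simpa [Quad.eval_ofPair k k c p 0 0 (X.outer _)] using h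

lemma IsModel.integral_affine_mul_conj (hX : S.IsModel X μ) (k : Fin K) (c c' : ℂ)
    (p p' : Fin N → ℂ) :
    ∫ ω, (c + ∑ n, p n * X.outer ω k n) * conj (c' + ∑ n, p' n * X.outer ω k n) ∂μ =
      c * conj c' + ∑ n, p n * conj (p' n) := by
  have h := Quad.integral_eval_mul_conj hX.outer (Quad.ofPair k k c p 0 0)
    (Quad.ofPair k k c' p' 0 0)
  rw [Quad.mean_ofPair, Quad.mean_ofPair, Quad.cov_ofPair] at h
  simpa [Quad.eval_ofPair k k c p 0 0 (X.outer _), Quad.eval_ofPair k k c' p' 0 0 (X.outer _)]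
    using h

lemma IsModel.hasMoments_outer (hX : S.IsModel X μ) (Q : Quad (Fin K × Fin N)) :
    HasMoments (fun ω => Q.eval fun s => X.outer ω s.1 s.2) μ :=
  Quad.hasMoments_eval hX.outer.hasMoments Q

lemma IsModel.integral_fadeForm (hX : S.IsModel X μ) (χ : Fin N → ℂ) (k : Fin K) :
    ∫ ω, S.fadeForm χ 1 k k (X.outer ω) ∂μ = (S.ε k + 1) * ∑ n, χ n := by
  simp_rw [← eval_fadeQuad, ← mean_fadeQuad_self]
  exact Quad.integral_eval hX.outer _

lemma IsModel.hasMoments_fadeForm (hX : S.IsModel X μ) (χ : Fin N → ℂ) (g : ℝ) (k i : Fin K) :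
    HasMoments (fun ω => S.fadeForm χ g k i (X.outer ω)) μ := by
  simp_rw [← eval_fadeQuad]
  exact hX.hasMoments_outer _

end Model

/-! ### Second-order statistics of channel and observation -/

/-- The constant coefficients of `obs` as affine functions of the user-RDARS channel: the mean. -/
def obsMean (k : Fin K) : Fin L ⊕ Fin a → ℂ
  | .inl l => S.rc k * Real.sqrt S.δ * Real.sqrt (S.ε k) * S.f k * S.aL l
  | .inr j => S.rd k * Real.sqrt (S.ε k) * ∑ n, S.A j n * S.hbar k n

/-- The linear coefficients of the mean of `obs` given the user-RDARS channel. -/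
def obsLin (e g : ℝ) (k : Fin K) : Fin L ⊕ Fin a → Fin N → ℂ
  | .inl l => fun n => S.rc k * Real.sqrt S.δ * S.aL l * (e * S.bvec n)
  | .inr j => fun n => S.rd k * (g * S.A j n)

lemma mean_obs (e : ℝ) (Φ : Matrix (Fin L) (Fin L) ℂ) (g κ : ℝ) (k : Fin K)
    (h : Fin K → Fin N → ℂ) (j : Fin L ⊕ Fin a) :
    (S.obs e Φ g κ k h j).mean S.innerVar = S.obsMean k j + ∑ n, S.obsLin e g k j n * h k n := by
  rcases j with l | j
  · simp only [Quad.mean, obs, Pi.zero_apply, mul_zero, Finset.sum_const_zero, add_zero, along,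
      obsMean, obsLin, mul_add, add_mul, Finset.mul_sum, Finset.sum_mul]
    congr 1
    · ring
    · exact Finset.sum_congr rfl fun n _ => by ring
  · simp only [Quad.mean, obs, Pi.zero_apply, mul_zero, Finset.sum_const_zero, add_zero, fade,
      obsMean, obsLin, mul_add, Finset.mul_sum, Finset.sum_add_distrib]
    congr 1
    · exact Finset.sum_congr rfl fun n _ => by ring
    · exact Finset.sum_congr rfl fun n _ => by ring

/-- The covariance matrix of two vectors of the form `obs`. -/
def obsCov (e : ℝ) (Φ : Matrix (Fin L) (Fin L) ℂ) (g κ e' : ℝ) (Φ' : Matrix (Fin L) (Fin L) ℂ)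
    (g' κ' : ℝ) (k : Fin K) : Matrix (Fin L ⊕ Fin a) (Fin L ⊕ Fin a) ℂ :=
  Matrix.fromBlocks
    (((e * e' * S.a1 k : ℝ) : ℂ) • Matrix.vecMulVec S.aL (star S.aL)
      + ((S.a2 k + κ * κ' * S.sB : ℝ) : ℂ) • (Φ * Φ'ᴴ)) 0 0
    (((g * g' * (S.dc k + κ * κ' * S.sR) : ℝ) : ℂ) • 1)

/-- The covariance over the user-RDARS channel of the means given this channel. -/
lemma sum_obsLin (e g e' g' : ℝ) (k : Fin K) (i j : Fin L ⊕ Fin a) :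
    ∑ n, S.obsLin e g k i n * conj (S.obsLin e' g' k j n) =
      (Matrix.fromBlocks (((e * e' * S.a1 k : ℝ) : ℂ) • Matrix.vecMulVec S.aL (star S.aL)) 0 0
        (((g * g' * S.dc k : ℝ) : ℂ) • 1) : Matrix (Fin L ⊕ Fin a) (Fin L ⊕ Fin a) ℂ) i j := by
  have hb (j : Fin a) (n : Fin N) : (S.A j n : ℂ) * conj (S.bvec n) = 0 := by
    have := congrArg conj (S.A_mul_bvec j n)
    simpa using this
  rcases i with l | i <;> rcases j with l' | j
  · rw [Matrix.fromBlocks_apply₁₁, Matrix.smul_apply, Matrix.vecMulVec_apply]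
    have h1 : ((S.a1 k : ℝ) : ℂ) = S.rc k * S.rc k * (Real.sqrt S.δ * Real.sqrt S.δ) *
        ∑ n, S.bvec n * conj (S.bvec n) := by
      rw [sqrt_mul_sqrt S.δ_nonneg, sum_bvec_mul_conj, a1, ← rc_sq]
      push_cast
      ring
    rw [smul_eq_mul, Complex.ofReal_mul, h1]
    simp only [obsLin, map_mul, Complex.conj_ofReal, Finset.mul_sum, Finset.sum_mul]
    refine Finset.sum_congr rfl fun n _ => ?_
    simp only [Pi.star_apply, RCLike.star_def]
    push_cast
    ring
  · simp only [obsLin, map_mul, Complex.conj_ofReal, Matrix.fromBlocks_apply₁₂, Matrix.zero_apply]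
    refine Finset.sum_eq_zero fun n _ => ?_
    linear_combination (S.rc k * Real.sqrt S.δ * S.aL l * e * S.rd k * g') * S.A_mul_bvec j n
  · simp only [obsLin, map_mul, Complex.conj_ofReal, Matrix.fromBlocks_apply₂₁, Matrix.zero_apply]
    refine Finset.sum_eq_zero fun n _ => ?_
    linear_combination (S.rc k * Real.sqrt S.δ * conj (S.aL l') * e' * S.rd k * g) * hb i n
  · rw [Matrix.fromBlocks_apply₂₂, Matrix.smul_apply, Matrix.one_apply, ← sum_A_mul_A, ← rd_sq,
      smul_eq_mul, Finset.mul_sum]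
    refine Finset.sum_congr rfl fun n _ => ?_
    simp only [obsLin, map_mul, Complex.conj_ofReal]
    push_cast
    ring

lemma cov_obs (e : ℝ) (Φ : Matrix (Fin L) (Fin L) ℂ) (g κ e' : ℝ)
    (Φ' : Matrix (Fin L) (Fin L) ℂ) (g' κ' : ℝ) (k : Fin K) (h : Fin K → Fin N → ℂ)
    (i j : Fin L ⊕ Fin a) :
    (S.obs e Φ g κ k h i).cov S.innerVar (S.obs e' Φ' g' κ' k h j) =
      (Matrix.fromBlocks ((S.rc k * S.rc k * S.fadeForm S.rmode 1 k k h +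
          ((S.γ k + κ * κ' * S.sB : ℝ) : ℂ)) • (Φ * Φ'ᴴ)) 0 0
        (((g * g' * (κ * κ' * S.sR) : ℝ) : ℂ) • 1) :
          Matrix (Fin L ⊕ Fin a) (Fin L ⊕ Fin a) ℂ) i j := by
  have h0 := S.sum_weight κ' κ k k h
  rw [if_pos rfl] at h0
  have hR := S.sum_pilots k k S.σR
  rw [if_pos rfl] at hR
  rcases i with l | i <;> rcases j with l' | j
  · rw [Matrix.fromBlocks_apply₁₁, Matrix.smul_apply, Matrix.mul_apply, smul_eq_mul,
      mul_comm κ κ', ← h0, Finset.sum_mul_sum]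
    simp only [Quad.cov, obs, Fintype.sum_sum_type (α₁ := Fin L × Col K N τ), Sum.elim_inl,
      Sum.elim_inr, Pi.zero_apply, zero_mul, Finset.sum_const_zero, add_zero, innerVar_inl,
      Fintype.sum_prod_type (α₁ := Fin L), map_mul]
    rw [Finset.sum_comm]
    refine Finset.sum_congr rfl fun m _ => Finset.sum_congr rfl fun x _ => ?_
    rw [Matrix.conjTranspose_apply, RCLike.star_def]
    ring
  · simp [Quad.cov, obs, Fintype.sum_sum_type]
  · simp [Quad.cov, obs, Fintype.sum_sum_type]
  · rw [Matrix.fromBlocks_apply₂₂, Matrix.smul_apply, Matrix.one_apply, smul_eq_mul]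
    simp only [Quad.cov, obs, Fintype.sum_sum_type, Sum.elim_inl,
      Sum.elim_inr, Pi.zero_apply, zero_mul, Finset.sum_const_zero, add_zero, innerVar_inr,
      zero_add]
    rw [Fintype.sum_prod_type, Finset.sum_comm]
    by_cases hij : i = j
    · subst hij
      rw [if_pos rfl, mul_one]
      have h1 : ((g * g' * (κ * κ' * S.sR) : ℝ) : ℂ) = g * g' * κ * κ' *
          ((S.σR ^ 2 / (τ * S.pp) : ℝ) : ℂ) := by
        rw [sR]; push_cast; ring
      rw [h1, ← hR, Finset.mul_sum]
      refine Finset.sum_congr rfl fun t _ => ?_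
      rw [Finset.sum_eq_single i (by intro b _ hb; simp [hb]) (by simp)]
      simp only [if_true, map_mul, Complex.conj_ofReal]
      ring
    · rw [if_neg hij, mul_zero]
      refine Finset.sum_eq_zero fun t _ => Finset.sum_eq_zero fun x _ => ?_
      by_cases hx : x = i
      · subst hx; simp [hij]
      · simp [hx]

section Model
variable [MeasurableSpace Ω] {μ : Measure Ω} [IsProbabilityMeasure μ] {S}

lemma IsModel.hasMoments_obs (hX : S.IsModel X μ) (e : ℝ) (Φ : Matrix (Fin L) (Fin L) ℂ)
    (g κ : ℝ) (k : Fin K) (j : Fin L ⊕ Fin a) :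
    HasMoments (fun ω => (S.obs e Φ g κ k (X.outer ω) j).eval fun s => X.inner s ω) μ :=
  (S.tame_obs hX e Φ g κ k j).hasMoments_eval hX.inner.hasMoments

lemma IsModel.integral_obs (hX : S.IsModel X μ) (e : ℝ) (Φ : Matrix (Fin L) (Fin L) ℂ)
    (g κ : ℝ) (k : Fin K) (j : Fin L ⊕ Fin a) :
    ∫ ω, (S.obs e Φ g κ k (X.outer ω) j).eval (fun s => X.inner s ω) ∂μ = S.obsMean k j := by
  rw [(S.tame_obs hX e Φ g κ k j).integral_eval hX.inner hX.aemeasurable_outer hX.indepFun]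
  simp_rw [mean_obs]
  exact hX.integral_affine k _ _

/-- Correlation of two vectors of the form `obs`: covariance plus product of the means. -/
lemma IsModel.integral_obs_mul_conj (hX : S.IsModel X μ) (e : ℝ)
    (Φ : Matrix (Fin L) (Fin L) ℂ) (g κ e' : ℝ) (Φ' : Matrix (Fin L) (Fin L) ℂ) (g' κ' : ℝ)
    (k : Fin K) (i j : Fin L ⊕ Fin a) :
    ∫ ω, (S.obs e Φ g κ k (X.outer ω) i).eval (fun s => X.inner s ω) *
        conj ((S.obs e' Φ' g' κ' k (X.outer ω) j).eval fun s => X.inner s ω) ∂μ =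
      S.obsMean k i * conj (S.obsMean k j) + S.obsCov e Φ g κ e' Φ' g' κ' k i j := by
  rw [(S.tame_obs hX e Φ g κ k i).integral_eval_mul_conj (S.tame_obs hX e' Φ' g' κ' k j)
    hX.inner hX.aemeasurable_outer hX.indepFun]
  simp_rw [mean_obs, cov_obs]
  have m1 (e g : ℝ) (j : Fin L ⊕ Fin a) : HasMoments
      (fun ω => S.obsMean k j + ∑ n, S.obsLin e g k j n * X.outer ω k n) μ :=
    (hasMoments_const _).add (hasMoments_sum _ fun n _ =>
      (hasMoments_const _).mul (hX.outer.hasMoments (k, n)))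
  have m2 := hX.hasMoments_fadeForm S.rmode 1 k k
  have m3 : HasMoments (fun ω => (Matrix.fromBlocks ((S.rc k * S.rc k *
      S.fadeForm S.rmode 1 k k (X.outer ω) +
          ((S.γ k + κ * κ' * S.sB : ℝ) : ℂ)) • (Φ * Φ'ᴴ)) 0 0
        (((g * g' * (κ * κ' * S.sR) : ℝ) : ℂ) • 1) :
          Matrix (Fin L ⊕ Fin a) (Fin L ⊕ Fin a) ℂ) i j) μ := by
    rcases i with l | i <;> rcases j with l' | j
    · exact (((hasMoments_const _).mul m2).add (hasMoments_const _)).mul (hasMoments_const _)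
    · exact hasMoments_const _
    · exact hasMoments_const _
    · exact hasMoments_const _
  rw [integral_add ((m1 e g i).mul (m1 e' g' j).conj).integrable m3.integrable,
    hX.integral_affine_mul_conj, sum_obsLin, add_assoc]
  congr 1
  rcases i with l | i <;> rcases j with l' | j
  · simp only [Matrix.fromBlocks_apply₁₁, obsCov, Matrix.smul_apply, Matrix.add_apply, smul_eq_mul]
    rw [integral_mul_const, integral_add ((hasMoments_const _).mul m2).integrable
      (hasMoments_const _).integrable, integral_const_mul, hX.integral_fadeForm, sum_rmode]
    simp only [integral_const, probReal_univ, one_smul, a2, ← rc_sq]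
    push_cast
    ring
  · simp [obsCov]
  · simp [obsCov]
  · simp only [Matrix.fromBlocks_apply₂₂, obsCov, Matrix.smul_apply, smul_eq_mul]
    simp only [integral_const, probReal_univ, one_smul]
    push_cast
    ring

end Model
end System
end

/-! ### The LMMSE filter -/

section
variable {K L N a τ : ℕ} {Ω : Type*} {X : Randomness K L N a τ Ω}

lemma cov_eq_integral_sub [MeasurableSpace Ω] {μ : Measure Ω} [IsProbabilityMeasure μ]
    {ι κ : Type*} {U : Ω → ι → ℂ} {V : Ω → κ → ℂ} (hU : ∀ i, HasMoments (fun ω => U ω i) μ)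
    (hV : ∀ j, HasMoments (fun ω => V ω j) μ) (i : ι) (j : κ) :
    cov μ U V i j = ∫ ω, U ω i * conj (V ω j) ∂μ - mean μ U i * conj (mean μ V j) := by
  have C (c : ℂ) := hasMoments_const (μ := μ) c
  have h1 (ω : Ω) : (U ω i - mean μ U i) * conj (V ω j - mean μ V j) =
      U ω i * conj (V ω j) - mean μ U i * conj (V ω j) - (U ω i - mean μ U i) *
        conj (mean μ V j) := by
    rw [map_sub]; ring
  simp only [cov, Matrix.of_apply, h1]
  rw [integral_sub (((hU i).mul (hV j).conj).sub ((C _).mul (hV j).conj)).integrable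
      (((hU i).sub (C _)).mul (C _)).integrable,
    integral_sub ((hU i).mul (hV j).conj).integrable ((C _).mul (hV j).conj).integrable,
    integral_const_mul, integral_mul_const, integral_sub (hU i).integrable (C _).integrable,
    integral_conj]
  simp [mean]

namespace System
variable (S : System K L N a τ)

lemma sB_pos (k : Fin K) : 0 < S.sB := by
  have h1 := S.pp_pos
  have h2 := S.σB_pos
  have h3 : (0 : ℝ) < τ := by exact_mod_cast S.τ_pos k
  unfold sB; positivity

lemma sR_pos (k : Fin K) : 0 < S.sR := by
  have h1 := S.pp_pos
  have h2 := S.σR_pos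
  have h3 : (0 : ℝ) < τ := by exact_mod_cast S.τ_pos k
  unfold sR; positivity

lemma M_nonneg (S : System K L N a τ) : 0 ≤ (N : ℝ) - a := by
  have : (a : ℝ) ≤ N := by exact_mod_cast S.a_le_N
  linarith

lemma a1_nonneg (k : Fin K) : 0 ≤ S.a1 k :=
  mul_nonneg (mul_nonneg S.M_nonneg (S.c_nonneg k)) S.δ_nonneg

lemma a2_nonneg (k : Fin K) : 0 ≤ S.a2 k := by
  have h1 := S.M_nonneg
  have h2 := S.c_nonneg k
  have h3 := S.ε_nonneg k
  have h4 := S.γ_nonneg k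
  unfold a2; positivity

/-- The block of the LMMSE filter at the BS. -/
def filterB (k : Fin K) : Matrix (Fin L) (Fin L) ℂ :=
  (S.a3 k : ℂ) • Matrix.vecMulVec S.aL (star S.aL) + (S.a4 k : ℂ) • 1

lemma vecMulVec_aL_mul_self : Matrix.vecMulVec S.aL (star S.aL) * Matrix.vecMulVec S.aL (star S.aL)
    = (L : ℂ) • Matrix.vecMulVec S.aL (star S.aL) := by
  ext i j
  rw [Matrix.mul_apply, Matrix.smul_apply, smul_eq_mul]
  simp only [Matrix.vecMulVec_apply, Pi.star_apply, RCLike.star_def]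
  have h (x : Fin L) : S.aL i * conj (S.aL x) * (S.aL x * conj (S.aL j)) =
      S.aL i * conj (S.aL j) := by
    linear_combination S.aL i * conj (S.aL j) * S.aL_mul_conj x
  simp [h]

lemma filterB_mulVec_aL (k : Fin K) (l : Fin L) :
    ∑ l', S.filterB k l l' * S.aL l' = S.e2 k * S.aL l := by
  simp only [filterB, Matrix.add_apply, Matrix.smul_apply, smul_eq_mul, Matrix.vecMulVec_apply,
    Pi.star_apply, RCLike.star_def, add_mul, Finset.sum_add_distrib]
  have h (x : Fin L) : S.a3 k * (S.aL l * conj (S.aL x)) * S.aL x = S.a3 k * S.aL l := by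
    linear_combination S.a3 k * S.aL l * S.aL_mul_conj x
  simp [h, Matrix.one_apply, e2]
  ring

lemma conj_filterB (k : Fin K) (l l' : Fin L) :
    conj (S.filterB k l l') = S.filterB k l' l := by
  simp only [filterB, Matrix.add_apply, Matrix.smul_apply, smul_eq_mul, Matrix.vecMulVec_apply,
    Pi.star_apply, RCLike.star_def, map_add, map_mul, Complex.conj_ofReal, Complex.conj_conj,
    Matrix.one_apply, eq_comm (a := l), apply_ite conj, map_one, map_zero]
  ring

lemma trace_filterB (k : Fin K) : ∑ l, S.filterB k l l = L * S.e1 k := by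
  simp only [filterB, Matrix.add_apply, Matrix.smul_apply, smul_eq_mul, Matrix.vecMulVec_apply,
    Pi.star_apply, RCLike.star_def, aL_mul_conj, Matrix.one_apply_eq]
  simp [e1, mul_add]

lemma sum_filterB_sq (k : Fin K) :
    ∑ l, ∑ l', S.filterB k l l' * conj (S.filterB k l l') = L * S.e3 k := by
  have h (l : Fin L) : ∑ l', S.filterB k l l' * conj (S.filterB k l l') = (S.e3 k : ℂ) := by
    have h1 (l' : Fin L) : S.filterB k l l' * conj (S.filterB k l l') =
        (S.a3 k : ℂ) ^ 2 +
          if l = l' then 2 * (S.a3 k : ℂ) * S.a4 k + (S.a4 k : ℂ) ^ 2 else 0 := by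
      simp only [filterB, Matrix.add_apply, Matrix.smul_apply, smul_eq_mul,
        Matrix.vecMulVec_apply, Pi.star_apply, RCLike.star_def, map_add, map_mul,
        Complex.conj_ofReal, Complex.conj_conj]
      have e1 := S.aL_mul_conj l
      have e2 := S.aL_mul_conj l'
      by_cases hl : l = l'
      · subst hl
        simp only [Matrix.one_apply_eq, if_true, map_one]
        linear_combination ((S.a3 k : ℂ) ^ 2 * S.aL l * conj (S.aL l) + (S.a3 k : ℂ) ^ 2
          + 2 * S.a3 k * S.a4 k) * e1
      · simp only [Matrix.one_apply_ne hl, if_neg hl, map_zero]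
        linear_combination ((S.a3 k : ℂ) ^ 2 * S.aL l' * conj (S.aL l')) * e1
          + (S.a3 k : ℂ) ^ 2 * e2
    simp_rw [h1]
    simp [Finset.sum_add_distrib, e3]
    ring
  simp [h]

/-- The LMMSE filter. -/
def filter (k : Fin K) : Matrix (Fin L ⊕ Fin a) (Fin L ⊕ Fin a) ℂ :=
  Matrix.fromBlocks (S.filterB k) 0 0 ((S.e4 k : ℂ) • 1)

lemma filter_mul (k : Fin K) :
    S.filter k * S.obsCov 1 1 1 1 1 1 1 1 k = S.obsCov 1 1 1 0 1 1 1 1 k := by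
  have h1 := S.sB_pos k
  have h2 := S.sR_pos k
  have h3 := S.a1_nonneg k
  have h4 := S.a2_nonneg k
  have h5 := S.dc_nonneg k
  have e1 : S.a3 k * (L * S.a1 k + (S.a2 k + S.sB)) + S.a4 k * S.a1 k = S.a1 k := by
    have h6 : S.a2 k + S.sB ≠ 0 := by positivity
    have h7 : S.a2 k + S.sB + L * S.a1 k ≠ 0 := by positivity
    rw [a3, a4]
    field_simp
    ring
  have e2 : S.a4 k * (S.a2 k + S.sB) = S.a2 k := by
    have h6 : S.a2 k + S.sB ≠ 0 := by positivity
    rw [a4]; field_simp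
  have e3 : S.e4 k * (S.dc k + S.sR) = S.dc k := by
    have h6 : S.dc k + S.sR ≠ 0 := by positivity
    rw [e4, a5]; field_simp
  have c1 : (S.a3 k * (L * S.a1 k + (S.a2 k + S.sB)) + S.a4 k * S.a1 k : ℂ) = S.a1 k := by
    exact_mod_cast e1
  have c2 : (S.a4 k * (S.a2 k + S.sB) : ℂ) = S.a2 k := by exact_mod_cast e2
  have c3 : (S.e4 k * (S.dc k + S.sR) : ℂ) = S.dc k := by exact_mod_cast e3
  rw [filter, obsCov, obsCov, Matrix.fromBlocks_multiply]
  simp only [Matrix.conjTranspose_one, mul_one, Matrix.mul_zero, Matrix.zero_mul, add_zero,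
    zero_add, filterB, one_mul, Matrix.add_mul, Matrix.mul_add, Matrix.smul_mul, Matrix.mul_smul,
    vecMulVec_aL_mul_self, Matrix.mul_one, smul_smul, Complex.ofReal_add, zero_mul, smul_zero]
  congr 1
  · rw [← sub_eq_zero]
    have c4 : (S.a3 k * (L * S.a1 k + (S.a2 k + S.sB)) + S.a4 k * S.a1 k - S.a1 k : ℂ) •
        Matrix.vecMulVec S.aL (star S.aL) +
        (S.a4 k * (S.a2 k + S.sB) - S.a2 k : ℂ) • (1 : Matrix (Fin L) (Fin L) ℂ) = 0 := by
      rw [c1, c2]; simp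
    rw [← c4]
    module
  · rw [mul_comm, c3]

/-- The covariance matrix of the pilot observation is invertible (Sherman–Morrison). -/
lemma isUnit_det_obsCov (k : Fin K) : IsUnit (S.obsCov 1 1 1 1 1 1 1 1 k).det := by
  have h1 := S.sB_pos k
  have h2 := S.sR_pos k
  have h3 := S.a1_nonneg k
  have h4 := S.a2_nonneg k
  have h5 := S.dc_nonneg k
  have h6 : S.a2 k + S.sB ≠ 0 := by positivity
  have h7 : S.a2 k + S.sB + L * S.a1 k ≠ 0 := by positivity
  have h8 : S.dc k + S.sR ≠ 0 := by positivity
  have e1 : S.a1 k * (1 / (S.a2 k + S.sB)) - (S.a1 k * L + (S.a2 k + S.sB)) *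
      (S.a1 k / ((S.a2 k + S.sB) * (S.a2 k + S.sB + L * S.a1 k))) = 0 := by
    field_simp
    ring
  have e2 : (S.a2 k + S.sB) * (1 / (S.a2 k + S.sB)) = 1 := by field_simp
  have e3 : (S.dc k + S.sR) * (1 / (S.dc k + S.sR)) = 1 := by field_simp
  set x := 1 / (S.a2 k + S.sB)
  set y := S.a1 k / ((S.a2 k + S.sB) * (S.a2 k + S.sB + L * S.a1 k))
  set w := 1 / (S.dc k + S.sR)
  have c1 : (S.a1 k * x - (S.a1 k * L + (S.a2 k + S.sB)) * y : ℂ) = 0 := by exact_mod_cast e1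
  have c2 : ((S.a2 k + S.sB) * x : ℂ) = 1 := by exact_mod_cast e2
  have c3 : ((S.dc k + S.sR) * w : ℂ) = 1 := by exact_mod_cast e3
  refine Matrix.isUnit_det_of_right_inverse (B := Matrix.fromBlocks ((x : ℂ) • 1 - (y : ℂ) •
    Matrix.vecMulVec S.aL (star S.aL)) 0 0 ((w : ℂ) • 1)) ?_
  rw [obsCov, Matrix.fromBlocks_multiply, ← Matrix.fromBlocks_one]
  simp only [Matrix.conjTranspose_one, mul_one, Matrix.mul_zero, Matrix.zero_mul, add_zero,
    zero_add, one_mul, Matrix.add_mul, Matrix.mul_sub, Matrix.smul_mul, Matrix.mul_smul,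
    vecMulVec_aL_mul_self, Matrix.mul_one, smul_smul, Complex.ofReal_add, smul_zero, sub_zero]
  congr 1
  · rw [← sub_eq_zero]
    have e4 : (S.a1 k * x - (S.a1 k * L + (S.a2 k + S.sB)) * y : ℂ) •
        Matrix.vecMulVec S.aL (star S.aL) +
        ((S.a2 k + S.sB) * x - 1 : ℂ) • (1 : Matrix (Fin L) (Fin L) ℂ) = 0 := by
      rw [c1, c2]; simp
    rw [← e4]
    module
  · rw [mul_comm, c3, one_smul]

lemma noiseForm_eq [MeasurableSpace Ω] (μ : Measure Ω) (k : Fin K) (ω : Ω) : S.noiseForm X μ k ω =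
    S.σB ^ 2 * ∑ l, S.qhat X μ k ω (.inl l) * conj (S.qhat X μ k ω (.inl l)) +
    S.σR ^ 2 * ∑ j, S.qhat X μ k ω (.inr j) * conj (S.qhat X μ k ω (.inr j)) := by
  simp only [noiseForm, noiseCov, dotProduct, Fintype.sum_sum_type, Matrix.mulVec, Pi.star_apply,
    RCLike.star_def, Matrix.fromBlocks_apply₁₁, Matrix.fromBlocks_apply₁₂,
    Matrix.fromBlocks_apply₂₁, Matrix.fromBlocks_apply₂₂, Matrix.zero_apply, zero_mul,
    Finset.sum_const_zero, add_zero, zero_add, Matrix.smul_apply, Matrix.one_apply, smul_eq_mul,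
    mul_ite, mul_one, mul_zero, ite_mul, Finset.sum_ite_eq, Finset.mem_univ, if_true]
  rw [Finset.mul_sum, Finset.mul_sum]
  congr 1
  · exact Finset.sum_congr rfl fun l _ => by ring
  · exact Finset.sum_congr rfl fun l _ => by ring

section Model
variable [MeasurableSpace Ω] {μ : Measure Ω} [IsProbabilityMeasure μ] {S}

lemma IsModel.hasMoments_q (hX : S.IsModel X μ) (k : Fin K) (j : Fin L ⊕ Fin a) :
    HasMoments (fun ω => S.q X k ω j) μ := by
  simp_rw [q_eq_eval]
  exact hX.hasMoments_obs _ _ _ _ _ _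

lemma IsModel.hasMoments_y (hX : S.IsModel X μ) (k : Fin K) (j : Fin L ⊕ Fin a) :
    HasMoments (fun ω => S.y X k ω j) μ := by
  simp_rw [y_eq_eval]
  exact hX.hasMoments_obs _ _ _ _ _ _

lemma IsModel.mean_q (hX : S.IsModel X μ) (k : Fin K) : mean μ (S.q X k) = S.obsMean k := by
  ext j
  simp_rw [mean, q_eq_eval]
  exact hX.integral_obs ..

lemma IsModel.mean_y (hX : S.IsModel X μ) (k : Fin K) : mean μ (S.y X k) = S.obsMean k := by
  ext j
  simp_rw [mean, y_eq_eval]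
  exact hX.integral_obs ..

lemma IsModel.cov_q_y (hX : S.IsModel X μ) (k : Fin K) :
    cov μ (S.q X k) (S.y X k) = S.obsCov 1 1 1 0 1 1 1 1 k := by
  ext i j
  rw [cov_eq_integral_sub (hX.hasMoments_q k) (hX.hasMoments_y k), hX.mean_q, hX.mean_y]
  simp_rw [q_eq_eval, y_eq_eval]
  rw [hX.integral_obs_mul_conj]
  ring

lemma IsModel.cov_y_y (hX : S.IsModel X μ) (k : Fin K) :
    cov μ (S.y X k) (S.y X k) = S.obsCov 1 1 1 1 1 1 1 1 k := by
  ext i j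
  rw [cov_eq_integral_sub (hX.hasMoments_y k) (hX.hasMoments_y k), hX.mean_y]
  simp_rw [y_eq_eval]
  rw [hX.integral_obs_mul_conj]
  ring

lemma IsModel.qhat_eq (hX : S.IsModel X μ) (k : Fin K) (ω : Ω) :
    S.qhat X μ k ω = S.obsMean k + S.filter k *ᵥ (S.y X k ω - S.obsMean k) := by
  rw [qhat, hX.mean_q, hX.mean_y, hX.cov_q_y, hX.cov_y_y, ← filter_mul,
    Matrix.mul_nonsing_inv_cancel_right _ _ (S.isUnit_det_obsCov k)]

lemma IsModel.qhat_eq_eval (hX : S.IsModel X μ) (k : Fin K) (ω : Ω) (j : Fin L ⊕ Fin a) :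
    S.qhat X μ k ω j =
      (S.obs (S.e2 k) (S.filterB k) (S.e4 k) 1 k (X.outer ω) j).eval fun s => X.inner s ω := by
  rw [hX.qhat_eq]
  simp only [Pi.add_apply, filter, Matrix.mulVec, dotProduct, Fintype.sum_sum_type, Pi.sub_apply,
    y_eq_eval]
  rcases j with l | j
  · rw [eval_obs_inl]
    simp only [Matrix.fromBlocks_apply₁₁, Matrix.fromBlocks_apply₁₂, Matrix.zero_apply, zero_mul,
      Finset.sum_const_zero, add_zero, eval_obs_inl, Matrix.one_apply, ite_mul, one_mul,
      Finset.sum_ite_eq, Finset.mem_univ, if_true]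
    set x : Fin L → ℂ := fun l' => ∑ m, S.weight 1 k (X.outer ω) m * X.inner (.inl (l', m)) ω
    set u : ℂ := ∑ n, S.bvec n * X.outer ω k n with hu
    have h1 (l' : Fin L) : S.filterB k l l' * (S.rc k * Real.sqrt S.δ * S.along 1 k (X.outer ω) *
        S.aL l' + x l' - S.obsMean k (.inl l')) = S.rc k * Real.sqrt S.δ * u *
          (S.filterB k l l' * S.aL l') + S.filterB k l l' * x l' := by
      rw [obsMean, along, ← hu]
      push_cast
      ring
    rw [Finset.sum_congr rfl fun l' _ => h1 l', Finset.sum_add_distrib, ← Finset.mul_sum,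
      filterB_mulVec_aL, obsMean, along]
    ring
  · rw [eval_obs_inr]
    simp only [Matrix.fromBlocks_apply₂₁, Matrix.fromBlocks_apply₂₂, Matrix.zero_apply, zero_mul,
      Finset.sum_const_zero, zero_add, eval_obs_inr, Matrix.smul_apply, Matrix.one_apply,
      smul_eq_mul, mul_ite, mul_one, mul_zero, ite_mul, Finset.sum_ite_eq, Finset.mem_univ, if_true]
    have h1 (g : ℝ) : ∑ n, (S.A j n : ℂ) * S.fade g k (X.outer ω) n =
        Real.sqrt (S.ε k) * ∑ n, S.A j n * S.hbar k n + g * ∑ n, S.A j n * X.outer ω k n := by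
      rw [Finset.mul_sum, Finset.mul_sum, ← Finset.sum_add_distrib]
      refine Finset.sum_congr rfl fun n _ => ?_
      rw [fade]; ring
    rw [h1, h1, obsMean]
    push_cast
    ring

lemma IsModel.hasMoments_qhat (hX : S.IsModel X μ) (k : Fin K) (j : Fin L ⊕ Fin a) :
    HasMoments (fun ω => S.qhat X μ k ω j) μ := by
  simp_rw [hX.qhat_eq_eval]
  exact hX.hasMoments_obs _ _ _ _ _ _

lemma IsModel.hasMoments_gain (hX : S.IsModel X μ) (k i : Fin K) :
    HasMoments (S.gain X μ k i) μ :=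
  hasMoments_sum Finset.univ (f := fun j ω => conj (S.qhat X μ k ω j) * S.q X i ω j)
    fun j _ => (hX.hasMoments_qhat k j).conj.mul (hX.hasMoments_q i j)

lemma IsModel.hasMoments_noiseForm (hX : S.IsModel X μ) (k : Fin K) :
    HasMoments (S.noiseForm X μ k) μ := by
  have h : S.noiseForm X μ k = fun ω => _ := funext fun ω => S.noiseForm_eq μ k ω
  rw [h]
  exact ((hasMoments_const _).mul (hasMoments_sum _ fun l _ =>
    (hX.hasMoments_qhat k _).mul (hX.hasMoments_qhat k _).conj)).add
    ((hasMoments_const _).mul (hasMoments_sum _ fun l _ =>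
    (hX.hasMoments_qhat k _).mul (hX.hasMoments_qhat k _).conj))

end Model
end System
end

/-! ### The noise term -/

section
variable {K L N a τ : ℕ} {Ω : Type*} {X : Randomness K L N a τ Ω}
namespace System
variable (S : System K L N a τ)

lemma sum_aL_mul_conj : ∑ l, S.aL l * conj (S.aL l) = L := by
  simp [aL_mul_conj]

lemma conj_f_mul_f (k : Fin K) : conj (S.f k) * S.f k = ((‖S.f k‖ ^ 2 : ℝ) : ℂ) := by
  rw [Complex.conj_mul']; push_cast; rfl

lemma sum_obsMean_inl (k : Fin K) :
    ∑ l, S.obsMean k (.inl l) * conj (S.obsMean k (.inl l)) =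
      ((L * (‖S.f k‖ ^ 2 * S.c k * S.δ * S.ε k) : ℝ) : ℂ) := by
  have h (l : Fin L) : S.obsMean k (.inl l) * conj (S.obsMean k (.inl l)) =
      ((‖S.f k‖ ^ 2 * S.c k * S.δ * S.ε k : ℝ) : ℂ) := by
    simp only [obsMean, map_mul, Complex.conj_ofReal]
    rw [Complex.ofReal_mul, Complex.ofReal_mul, Complex.ofReal_mul, ← conj_f_mul_f, ← rc_sq,
      ← sqrt_mul_sqrt S.δ_nonneg, ← sqrt_ε_mul]
    push_cast
    linear_combination (S.rc k ^ 2 * (Real.sqrt S.δ * Real.sqrt S.δ) *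
      (Real.sqrt (S.ε k) * Real.sqrt (S.ε k)) * conj (S.f k) * S.f k) * S.aL_mul_conj l
  simp [h]

lemma sum_A_hbar (k : Fin K) :
    ∑ j, (∑ n, (S.A j n : ℂ) * S.hbar k n) * conj (∑ n, (S.A j n : ℂ) * S.hbar k n) = a := by
  have h (j : Fin a) : (∑ n, (S.A j n : ℂ) * S.hbar k n) * conj (∑ n, (S.A j n : ℂ) * S.hbar k n) =
      ∑ n, ∑ m, (S.A j n * S.A j m : ℂ) * (S.hbar k n * conj (S.hbar k m)) := by
    rw [map_sum, Finset.sum_mul_sum]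
    refine Finset.sum_congr rfl fun n _ => Finset.sum_congr rfl fun m _ => ?_
    rw [map_mul, Complex.conj_ofReal]; ring
  simp_rw [h]
  rw [Finset.sum_comm]
  simp_rw [Finset.sum_comm (s := (Finset.univ : Finset (Fin a))), ← Finset.sum_mul, sum_A_mul_A',
    ite_mul, zero_mul, Finset.sum_ite_eq, Finset.mem_univ, if_true, hbar_mul_conj, mul_one,
    sum_mode_complex]

lemma sum_obsMean_inr (k : Fin K) :
    ∑ j, S.obsMean k (.inr j) * conj (S.obsMean k (.inr j)) =
      ((a * (S.dc k * S.ε k) : ℝ) : ℂ) := by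
  have h (j : Fin a) : S.obsMean k (.inr j) * conj (S.obsMean k (.inr j)) =
      (S.dc k * S.ε k) * ((∑ n, (S.A j n : ℂ) * S.hbar k n) *
        conj (∑ n, (S.A j n : ℂ) * S.hbar k n)) := by
    simp only [obsMean, map_mul, Complex.conj_ofReal]
    rw [← rd_sq, ← sqrt_ε_mul]
    push_cast
    ring
  simp_rw [h]
  rw [← Finset.mul_sum, sum_A_hbar]
  push_cast
  ring

/-- The trace form of `Ψ C_y Ψᴴ = Ψ C_q`, where `Ψ` is the block of the LMMSE filter at the BS. -/
lemma filterB_energy (k : Fin K) : S.e2 k ^ 2 * S.a1 k + (S.a2 k + S.sB) * S.e3 k =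
    S.a1 k * S.e2 k + S.a2 k * S.e1 k := by
  have h1 := S.sB_pos k
  have h3 := S.a1_nonneg k
  have h4 := S.a2_nonneg k
  have h6 : S.a2 k + S.sB ≠ 0 := by positivity
  have h7 : S.a2 k + S.sB + L * S.a1 k ≠ 0 := by positivity
  rw [e1, e2, e3, a3, a4]
  field_simp
  ring

lemma filterR_energy (k : Fin K) : S.e4 k ^ 2 * (S.dc k + S.sR) = S.e4 k * S.dc k := by
  have h2 := S.sR_pos k
  have h5 := S.dc_nonneg k
  have h6 : S.dc k + S.sR ≠ 0 := by positivity
  rw [e4, a5]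
  field_simp

lemma IsModel.integral_noiseForm [MeasurableSpace Ω] {μ : Measure Ω} [IsProbabilityMeasure μ]
    {S : System K L N a τ} (hX : S.IsModel X μ) (k : Fin K) :
    ∫ ω, S.noiseForm X μ k ω ∂μ = (S.Enoise k : ℂ) := by
  have M (j : Fin L ⊕ Fin a) :
      HasMoments (fun ω => S.qhat X μ k ω j * conj (S.qhat X μ k ω j)) μ :=
    (hX.hasMoments_qhat k j).mul (hX.hasMoments_qhat k j).conj
  have E (j : Fin L ⊕ Fin a) : ∫ ω, S.qhat X μ k ω j * conj (S.qhat X μ k ω j) ∂μ =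
      S.obsMean k j * conj (S.obsMean k j) + S.obsCov (S.e2 k) (S.filterB k) (S.e4 k) 1
        (S.e2 k) (S.filterB k) (S.e4 k) 1 k j j := by
    simp_rw [hX.qhat_eq_eval]
    exact hX.integral_obs_mul_conj ..
  simp_rw [noiseForm_eq]
  rw [integral_add ((hasMoments_const _).mul (hasMoments_sum _ fun l _ => M _)).integrable
    ((hasMoments_const _).mul (hasMoments_sum _ fun l _ => M _)).integrable, integral_const_mul,
    integral_const_mul, integral_finsetSum _ fun l _ => (M _).integrable,
    integral_finsetSum _ fun l _ => (M _).integrable]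
  simp_rw [E]
  rw [Finset.sum_add_distrib, Finset.sum_add_distrib, sum_obsMean_inl, sum_obsMean_inr]
  have h1 : ∑ l, S.obsCov (S.e2 k) (S.filterB k) (S.e4 k) 1
        (S.e2 k) (S.filterB k) (S.e4 k) 1 k (.inl l) (.inl l) =
      ((L * (S.e2 k ^ 2 * S.a1 k + (S.a2 k + S.sB) * S.e3 k) : ℝ) : ℂ) := by
    have h2 (l : Fin L) : (S.filterB k * (S.filterB k)ᴴ) l l =
        ∑ l', S.filterB k l l' * conj (S.filterB k l l') := by
      rw [Matrix.mul_apply]; rfl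
    simp only [obsCov, Matrix.fromBlocks_apply₁₁, Matrix.add_apply, Matrix.smul_apply, smul_eq_mul,
      h2, Finset.sum_add_distrib, ← Finset.mul_sum, sum_filterB_sq, Matrix.vecMulVec_apply,
      Pi.star_apply, RCLike.star_def, sum_aL_mul_conj]
    push_cast
    ring
  have h2 : ∑ j, S.obsCov (S.e2 k) (S.filterB k) (S.e4 k) 1
        (S.e2 k) (S.filterB k) (S.e4 k) 1 k (.inr j) (.inr j) =
      ((a * (S.e4 k ^ 2 * (S.dc k + S.sR)) : ℝ) : ℂ) := by
    simp only [obsCov, Matrix.fromBlocks_apply₂₂, Matrix.smul_apply, smul_eq_mul,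
      Matrix.one_apply_eq, Finset.sum_const, Finset.card_univ, Fintype.card_fin, nsmul_eq_mul,
      mul_one]
    push_cast
    ring
  rw [h1, h2, filterB_energy, filterR_energy, Enoise, ← a2, ← a1]
  push_cast
  ring

/-! ### The gain given the user-RDARS channels -/

/-- The gain `q̂_kᴴ q_i` as a polynomial in the remaining randomness, given the user-RDARS
channels. -/
def gainQuad (k i : Fin K) (h : Fin K → Fin N → ℂ) : Quad (Inner K L N a τ) where
  c := S.rc k * S.rc i * S.δ * L * (conj (S.along (S.e2 k) k h) * S.along 1 i h)
    + S.rd k * S.rd i * S.fadeForm (fun n => S.mode n) (S.e4 k) k i h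
  p := Sum.elim (fun s => S.rc k * Real.sqrt S.δ * conj (S.along (S.e2 k) k h) *
    (conj (S.aL s.1) * S.weight 0 i h s.2)) (fun _ => 0)
  q := Sum.elim (fun s => S.rc i * Real.sqrt S.δ * S.e2 k * S.along 1 i h *
      (S.aL s.1 * conj (S.weight 1 k h s.2)))
    (fun s => S.e4 k * S.rd i * ((∑ n, S.A s.1 n * S.fade 1 i h n) *
      conj (S.pilots s.2 k / Real.sqrt (τ * S.pp))))
  S := Sum.elim (fun s => Sum.elim (fun s' => S.filterB k s.1 s'.1 *
    (conj (S.weight 1 k h s.2) * S.weight 0 i h s'.2)) (fun _ => 0)) (fun _ _ => 0)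

lemma sum_A_fade (g : ℝ) (k i : Fin K) (h : Fin K → Fin N → ℂ) :
    ∑ j, conj (∑ n, (S.A j n : ℂ) * S.fade g k h n) * (∑ n, (S.A j n : ℂ) * S.fade 1 i h n) =
      S.fadeForm (fun n => S.mode n) g k i h := by
  have h1 (j : Fin a) : conj (∑ n, (S.A j n : ℂ) * S.fade g k h n) *
      (∑ n, (S.A j n : ℂ) * S.fade 1 i h n) =
      ∑ n, ∑ m, (S.A j n * S.A j m : ℂ) * (conj (S.fade g k h n) * S.fade 1 i h m) := by
    rw [map_sum, Finset.sum_mul_sum]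
    refine Finset.sum_congr rfl fun n _ => Finset.sum_congr rfl fun m _ => ?_
    rw [map_mul, Complex.conj_ofReal]; ring
  simp_rw [h1]
  rw [Finset.sum_comm]
  simp_rw [Finset.sum_comm (s := (Finset.univ : Finset (Fin a))), ← Finset.sum_mul, sum_A_mul_A',
    ite_mul, zero_mul, Finset.sum_ite_eq, Finset.mem_univ, if_true]
  rfl

lemma eval_gainQuad (k i : Fin K) (h : Fin K → Fin N → ℂ) (z : Inner K L N a τ → ℂ) :
    ∑ j, conj ((S.obs (S.e2 k) (S.filterB k) (S.e4 k) 1 k h j).eval z) *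
      (S.obs 1 1 1 0 i h j).eval z = (S.gainQuad k i h).eval z := by
  set x : Fin L → ℂ := fun l => ∑ m, S.weight 1 k h m * z (.inl (l, m)) with hx
  set u : Fin L → ℂ := fun l => ∑ m, S.weight 0 i h m * z (.inl (l, m)) with hu
  set C : ℂ := S.rc k * Real.sqrt S.δ * S.along (S.e2 k) k h with hC
  set D : ℂ := S.rc i * Real.sqrt S.δ * S.along 1 i h with hD
  set y : Fin a → ℂ := fun j =>
    ∑ t, (S.pilots t k / Real.sqrt (τ * S.pp)) * z (.inr (j, t)) with hy
  have hB : ∑ l, conj (C * S.aL l + ∑ l', S.filterB k l l' * x l') * (D * S.aL l + u l) =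
      conj C * D * L + conj C * ∑ l, conj (S.aL l) * u l
        + S.e2 k * D * ∑ l, S.aL l * conj (x l)
        + ∑ l, ∑ l', S.filterB k l l' * (conj (x l) * u l') := by
    have h1 (l : Fin L) : conj (C * S.aL l + ∑ l', S.filterB k l l' * x l') * (D * S.aL l + u l) =
        conj C * D * (S.aL l * conj (S.aL l)) + conj C * (conj (S.aL l) * u l)
        + D * ∑ l', conj (x l') * (S.filterB k l' l * S.aL l)
        + ∑ l', S.filterB k l' l * (conj (x l') * u l) := by
      have h2 : conj (C * S.aL l + ∑ l', S.filterB k l l' * x l') =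
          conj C * conj (S.aL l) + ∑ l', S.filterB k l' l * conj (x l') := by
        simp only [map_add, map_mul, map_sum, conj_filterB]
      have h3 : ∑ l', conj (x l') * (S.filterB k l' l * S.aL l) =
          (∑ l', S.filterB k l' l * conj (x l')) * S.aL l := by
        rw [Finset.sum_mul]; exact Finset.sum_congr rfl fun _ _ => by ring
      have h4 : ∑ l', S.filterB k l' l * (conj (x l') * u l) =
          (∑ l', S.filterB k l' l * conj (x l')) * u l := by
        rw [Finset.sum_mul]; exact Finset.sum_congr rfl fun _ _ => by ring
      rw [h2, h3, h4]
      ring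
    simp_rw [h1, Finset.sum_add_distrib, ← Finset.mul_sum, sum_aL_mul_conj]
    have h5 : ∑ l, ∑ l', conj (x l') * (S.filterB k l' l * S.aL l) =
        S.e2 k * ∑ l, S.aL l * conj (x l) := by
      rw [Finset.sum_comm, Finset.mul_sum]
      refine Finset.sum_congr rfl fun l _ => ?_
      rw [← Finset.mul_sum, filterB_mulVec_aL]
      ring
    rw [h5, Finset.sum_comm (f := fun l l' => S.filterB k l' l * (conj (x l') * u l))]
    ring
  have hR : ∑ j, conj (S.rd k * ∑ n, S.A j n * S.fade (S.e4 k) k h n + S.e4 k * y j) *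
      (S.rd i * ∑ n, S.A j n * S.fade 1 i h n) =
      S.rd k * S.rd i * S.fadeForm (fun n => S.mode n) (S.e4 k) k i h
        + S.e4 k * S.rd i * ∑ j, (∑ n, S.A j n * S.fade 1 i h n) * conj (y j) := by
    rw [← sum_A_fade, Finset.mul_sum, Finset.mul_sum, ← Finset.sum_add_distrib]
    refine Finset.sum_congr rfl fun j _ => ?_
    rw [map_add, map_mul, map_mul, Complex.conj_ofReal, Complex.conj_ofReal]
    ring
  have hp : ∑ s, (S.gainQuad k i h).p s * z s = conj C * ∑ l, conj (S.aL l) * u l := by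
    simp only [gainQuad, Fintype.sum_sum_type (α₁ := Fin L × Col K N τ), Sum.elim_inl,
      Sum.elim_inr, zero_mul, Finset.sum_const_zero, add_zero,
      Fintype.sum_prod_type (α₁ := Fin L), hu, hC, map_mul, Complex.conj_ofReal, Finset.mul_sum]
    exact Finset.sum_congr rfl fun l _ => Finset.sum_congr rfl fun m _ => by ring
  have hq : ∑ s, (S.gainQuad k i h).q s * conj (z s) =
      S.e2 k * D * ∑ l, S.aL l * conj (x l)
        + S.e4 k * S.rd i * ∑ j, (∑ n, S.A j n * S.fade 1 i h n) * conj (y j) := by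
    simp only [gainQuad, Fintype.sum_sum_type (α₁ := Fin L × Col K N τ), Sum.elim_inl,
      Sum.elim_inr, Fintype.sum_prod_type (α₁ := Fin L), Fintype.sum_prod_type (α₁ := Fin a)]
    congr 1
    · simp only [hx, hD, map_sum, map_mul, Finset.mul_sum]
      exact Finset.sum_congr rfl fun l _ => Finset.sum_congr rfl fun m _ => by ring
    · rw [Finset.mul_sum]
      refine Finset.sum_congr rfl fun j _ => ?_
      simp only [hy, map_sum, map_mul, Finset.mul_sum (s := (Finset.univ : Finset (Fin τ)))]
      exact Finset.sum_congr rfl fun m _ => by ring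
  have hS : ∑ s, ∑ t, (S.gainQuad k i h).S s t * (conj (z s) * z t) =
      ∑ l, ∑ l', S.filterB k l l' * (conj (x l) * u l') := by
    simp only [gainQuad, Fintype.sum_sum_type (α₁ := Fin L × Col K N τ), Sum.elim_inl,
      Sum.elim_inr, zero_mul, Finset.sum_const_zero, add_zero,
      Fintype.sum_prod_type (α₁ := Fin L)]
    refine Finset.sum_congr rfl fun l _ => ?_
    rw [Finset.sum_comm]
    refine Finset.sum_congr rfl fun l' _ => ?_
    rw [hx, hu, map_sum, Finset.sum_mul_sum, Finset.mul_sum]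
    refine Finset.sum_congr rfl fun m _ => ?_
    rw [Finset.mul_sum]
    refine Finset.sum_congr rfl fun m' _ => ?_
    rw [map_mul]
    ring
  have hδ : (Real.sqrt S.δ : ℂ) * Real.sqrt S.δ = S.δ := sqrt_mul_sqrt S.δ_nonneg
  rw [Fintype.sum_sum_type]
  simp only [eval_obs_inl, eval_obs_inr, Matrix.one_apply, ite_mul, one_mul, zero_mul,
    Finset.sum_ite_eq, Finset.mem_univ, if_true, Complex.ofReal_one, Complex.ofReal_zero, mul_zero,
    add_zero, mul_one]
  rw [hB, hR, Quad.eval, hp, hq, hS, gainQuad]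
  simp only [hC, hD, map_mul, Complex.conj_ofReal]
  linear_combination (S.rc k * S.rc i * L * (conj (S.along (S.e2 k) k h) * S.along 1 i h)) * hδ

lemma mean_gainQuad (k i : Fin K) (h : Fin K → Fin N → ℂ) :
    (S.gainQuad k i h).mean S.innerVar =
      S.rc k * S.rc i * S.δ * L * (conj (S.along (S.e2 k) k h) * S.along 1 i h)
        + S.rd k * S.rd i * S.fadeForm (fun n => S.mode n) (S.e4 k) k i h
        + L * S.e1 k * S.rc k * S.rc i * S.fadeForm S.rmode 1 k i h
        + if k = i then ((L * S.e1 k * S.γ k : ℝ) : ℂ) else 0 := by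
  have h0 := S.sum_weight 1 0 k i h
  have h1 : ∑ s, (S.innerVar s : ℂ) * (S.gainQuad k i h).S s s = (∑ l, S.filterB k l l) *
      ∑ m, conj (S.weight 1 k h m) * S.weight 0 i h m * S.colVar m := by
    simp only [gainQuad, Fintype.sum_sum_type (α₁ := Fin L × Col K N τ), Sum.elim_inl,
      Sum.elim_inr, mul_zero, Finset.sum_const_zero, add_zero, innerVar_inl,
      Fintype.sum_prod_type (α₁ := Fin L), Finset.sum_mul_sum]
    exact Finset.sum_congr rfl fun l _ => Finset.sum_congr rfl fun m _ => by ring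
  rw [Quad.mean, h1, h0, trace_filterB, gainQuad]
  split_ifs <;> push_cast <;> ring

lemma conj_fadeForm (χ : Fin N → ℂ) (hχ : ∀ n, conj (χ n) = χ n) (k : Fin K)
    (h : Fin K → Fin N → ℂ) : conj (S.fadeForm χ 1 k k h) = S.fadeForm χ 1 k k h := by
  simp only [fadeForm, map_sum, map_mul, hχ, Complex.conj_conj]
  exact Finset.sum_congr rfl fun n _ => by ring

/-- The variance of the gain given the user-RDARS channels. -/
lemma cov_gainQuad (k i : Fin K) (h : Fin K → Fin N → ℂ) :
    (S.gainQuad k i h).cov S.innerVar (S.gainQuad k i h) =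
      L * S.c k * S.δ * (conj (S.along (S.e2 k) k h) * S.along (S.e2 k) k h) *
          (S.c i * S.fadeForm S.rmode 1 i i h + S.γ i)
        + L * S.c i * S.δ * S.e2 k ^ 2 * (conj (S.along 1 i h) * S.along 1 i h) *
          (S.c k * S.fadeForm S.rmode 1 k k h + (S.γ k + S.sB))
        + S.e4 k ^ 2 * S.sR * S.dc i * S.fadeForm (fun n => S.mode n) 1 i i h
        + L * S.e3 k * (S.c k * S.fadeForm S.rmode 1 k k h + (S.γ k + S.sB)) *
          (S.c i * S.fadeForm S.rmode 1 i i h + S.γ i) := by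
  have hk := S.sum_weight 1 1 k k h
  have hi := S.sum_weight 0 0 i i h
  rw [if_pos rfl] at hk hi
  have hR := S.sum_pilots k k S.σR
  rw [if_pos rfl] at hR
  have hδ : (Real.sqrt S.δ : ℂ) * Real.sqrt S.δ = S.δ := sqrt_mul_sqrt S.δ_nonneg
  have hck : (S.c k : ℂ) = S.rc k * S.rc k := by rw [← rc_sq]; push_cast; ring
  have hci : (S.c i : ℂ) = S.rc i * S.rc i := by rw [← rc_sq]; push_cast; ring
  have hdi : (S.dc i : ℂ) = S.rd i * S.rd i := by rw [← rd_sq]; push_cast; ring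
  have hp : ∑ s, (S.gainQuad k i h).p s * conj ((S.gainQuad k i h).p s) * S.innerVar s =
      L * S.c k * S.δ * (conj (S.along (S.e2 k) k h) * S.along (S.e2 k) k h) *
          (S.c i * S.fadeForm S.rmode 1 i i h + S.γ i) := by
    have h1 : (S.c i * S.fadeForm S.rmode 1 i i h + S.γ i : ℂ) =
        ∑ m, conj (S.weight 0 i h m) * S.weight 0 i h m * S.colVar m := by
      rw [hi, hci]; push_cast; ring
    simp only [gainQuad, Fintype.sum_sum_type (α₁ := Fin L × Col K N τ), Sum.elim_inl,
      Sum.elim_inr, zero_mul, Finset.sum_const_zero, add_zero,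
      Fintype.sum_prod_type (α₁ := Fin L), innerVar_inl, map_mul, Complex.conj_ofReal,
      Complex.conj_conj]
    rw [h1, ← sum_aL_mul_conj, hck, ← hδ, Finset.sum_mul, Finset.sum_mul, Finset.sum_mul,
      Finset.sum_mul]
    refine Finset.sum_congr rfl fun l _ => ?_
    rw [Finset.mul_sum]
    exact Finset.sum_congr rfl fun m _ => by ring
  have hq : ∑ s, (S.gainQuad k i h).q s * conj ((S.gainQuad k i h).q s) * S.innerVar s =
      L * S.c i * S.δ * S.e2 k ^ 2 * (conj (S.along 1 i h) * S.along 1 i h) *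
          (S.c k * S.fadeForm S.rmode 1 k k h + (S.γ k + S.sB))
        + S.e4 k ^ 2 * S.sR * S.dc i * S.fadeForm (fun n => S.mode n) 1 i i h := by
    have h1 : (S.c k * S.fadeForm S.rmode 1 k k h + (S.γ k + S.sB) : ℂ) =
        ∑ m, conj (S.weight 1 k h m) * S.weight 1 k h m * S.colVar m := by
      rw [hk, hck]; push_cast; ring
    simp only [gainQuad, Fintype.sum_sum_type (α₁ := Fin L × Col K N τ), Sum.elim_inl,
      Sum.elim_inr, Fintype.sum_prod_type (α₁ := Fin L), Fintype.sum_prod_type (α₁ := Fin a),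
      innerVar_inl, innerVar_inr, map_mul, Complex.conj_ofReal, Complex.conj_conj]
    congr 1
    · rw [h1, ← sum_aL_mul_conj, hci, ← hδ, Finset.sum_mul, Finset.sum_mul, Finset.sum_mul,
        Finset.sum_mul, Finset.sum_mul]
      refine Finset.sum_congr rfl fun l _ => ?_
      rw [Finset.mul_sum]
      exact Finset.sum_congr rfl fun m _ => by ring
    · rw [← sum_A_fade, hdi, sR, ← hR, Finset.mul_sum]
      refine Finset.sum_congr rfl fun j _ => ?_
      rw [Finset.mul_sum, Finset.sum_mul, Finset.sum_mul]
      refine Finset.sum_congr rfl fun t _ => ?_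
      ring
  have hS : ∑ s, ∑ t, (S.gainQuad k i h).S s t * conj ((S.gainQuad k i h).S s t) *
        (S.innerVar s * S.innerVar t) =
      L * S.e3 k * (S.c k * S.fadeForm S.rmode 1 k k h + (S.γ k + S.sB)) *
          (S.c i * S.fadeForm S.rmode 1 i i h + S.γ i) := by
    have h1 : (S.c k * S.fadeForm S.rmode 1 k k h + (S.γ k + S.sB) : ℂ) =
        ∑ m, conj (S.weight 1 k h m) * S.weight 1 k h m * S.colVar m := by
      rw [hk, hck]; push_cast; ring
    have h2 : (S.c i * S.fadeForm S.rmode 1 i i h + S.γ i : ℂ) =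
        ∑ m, conj (S.weight 0 i h m) * S.weight 0 i h m * S.colVar m := by
      rw [hi, hci]; push_cast; ring
    simp only [gainQuad, Fintype.sum_sum_type (α₁ := Fin L × Col K N τ), Sum.elim_inl,
      Sum.elim_inr, zero_mul, Finset.sum_const_zero, add_zero,
      Fintype.sum_prod_type (α₁ := Fin L), innerVar_inl, map_mul, Complex.conj_conj]
    rw [h1, h2, ← sum_filterB_sq, mul_assoc, Finset.sum_mul_sum, Finset.sum_mul]
    refine Finset.sum_congr rfl fun l _ => ?_
    rw [Finset.sum_comm, Finset.sum_mul]
    refine Finset.sum_congr rfl fun l' _ => ?_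
    rw [Finset.mul_sum]
    refine Finset.sum_congr rfl fun m _ => ?_
    rw [Finset.mul_sum]
    exact Finset.sum_congr rfl fun m' _ => by ring
  rw [Quad.cov, hp, hq, hS]
  ring

end System
end

/-! ### The mean gain given the user-RDARS channels -/

section
variable {K L N a τ : ℕ} {Ω : Type*} {X : Randomness K L N a τ Ω}

lemma Quad.eval_ofPair_linear (k i : Fin K) (x y w b c₁ c₂ c₃ : ℂ) (p₁ p₂ p₃ q₁ q₂ q₃ : Fin N → ℂ)
    (S₁ S₂ S₃ : Fin N → Fin N → ℂ) (h : Fin K → Fin N → ℂ) :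
    (Quad.ofPair k i (x * c₁ + y * c₂ + w * c₃ + b) (fun n => x * p₁ n + y * p₂ n + w * p₃ n)
      (fun n => x * q₁ n + y * q₂ n + w * q₃ n)
      (fun n m => x * S₁ n m + y * S₂ n m + w * S₃ n m)).eval (fun s => h s.1 s.2) =
    x * (Quad.ofPair k i c₁ p₁ q₁ S₁).eval (fun s => h s.1 s.2)
      + y * (Quad.ofPair k i c₂ p₂ q₂ S₂).eval (fun s => h s.1 s.2)
      + w * (Quad.ofPair k i c₃ p₃ q₃ S₃).eval (fun s => h s.1 s.2) + b := by
  simp only [Quad.eval_ofPair, add_mul, Finset.sum_add_distrib, mul_add, Finset.mul_sum, mul_assoc]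
  ring

namespace System
variable (S : System K L N a τ)

/-- Coefficient of the line-of-sight part of the mean gain given the user-RDARS channels. -/
def xc (k i : Fin K) : ℝ := S.rc k * S.rc i * S.δ * L

/-- Coefficient of the part received by the connected elements. -/
def yc (k i : Fin K) : ℝ := S.rd k * S.rd i

/-- Coefficient of the non-line-of-sight part. -/
def wc (k i : Fin K) : ℝ := L * S.e1 k * S.rc k * S.rc i

/-- The mean gain given the user-RDARS channels, as a polynomial in these channels. -/
def meanGainQuad (k i : Fin K) : Quad (Fin K × Fin N) :=
  Quad.ofPair k i
    (S.xc k i * (Real.sqrt (S.ε k) * Real.sqrt (S.ε i) * (conj (S.f k) * S.f i))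
      + S.yc k i * (Real.sqrt (S.ε k) * Real.sqrt (S.ε i) *
        ∑ n, S.mode n * (conj (S.hbar k n) * S.hbar i n))
      + S.wc k i * (Real.sqrt (S.ε k) * Real.sqrt (S.ε i) *
        ∑ n, S.rmode n * (conj (S.hbar k n) * S.hbar i n))
      + if k = i then ((L * S.e1 k * S.γ k : ℝ) : ℂ) else 0)
    (fun n => S.xc k i * (Real.sqrt (S.ε k) * conj (S.f k) * ((1 : ℝ) * S.bvec n))
      + S.yc k i * (Real.sqrt (S.ε k) * (S.mode n * conj (S.hbar k n)))
      + S.wc k i * (Real.sqrt (S.ε k) * (S.rmode n * conj (S.hbar k n))))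
    (fun n => S.xc k i * (Real.sqrt (S.ε i) * S.f i * (S.e2 k * conj (S.bvec n)))
      + S.yc k i * (S.e4 k * Real.sqrt (S.ε i) * (S.mode n * S.hbar i n))
      + S.wc k i * ((1 : ℝ) * Real.sqrt (S.ε i) * (S.rmode n * S.hbar i n)))
    (fun n m => S.xc k i * (S.e2 k * conj (S.bvec n) * ((1 : ℝ) * S.bvec m))
      + S.yc k i * (if n = m then (S.e4 k : ℂ) * (S.mode n : ℂ) else 0)
      + S.wc k i * (if n = m then (1 : ℝ) * S.rmode n else 0))

lemma eval_meanGainQuad (k i : Fin K) (h : Fin K → Fin N → ℂ) :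
    (S.meanGainQuad k i).eval (fun s => h s.1 s.2) = (S.gainQuad k i h).mean S.innerVar := by
  rw [mean_gainQuad, meanGainQuad, Quad.eval_ofPair_linear]
  have h1 := S.eval_alongQuad (S.e2 k) 1 k i h
  have h2 := S.eval_fadeQuad (fun n => S.mode n) (S.e4 k) k i h
  have h3 := S.eval_fadeQuad S.rmode 1 k i h
  rw [alongQuad] at h1
  rw [fadeQuad] at h2 h3
  rw [h1, h2, h3, xc, yc, wc]
  push_cast
  ring

/-- The mean of the gain. -/
def meanGain (k i : Fin K) : ℂ :=
  Real.sqrt (S.ε k) * Real.sqrt (S.ε i) *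
      (S.xc k i * (conj (S.f k) * S.f i) + S.yc k i * S.g k i + S.wc k i * S.losRefl k i)
    + if k = i then ((L * S.e1 k * S.γ k + S.xc k i * S.e2 k * ((N : ℝ) - a)
        + S.yc k i * S.e4 k * a + S.wc k i * ((N : ℝ) - a) : ℝ) : ℂ) else 0

lemma mean_meanGainQuad (k i : Fin K) :
    (S.meanGainQuad k i).mean (fun _ => 1) = S.meanGain k i := by
  rw [meanGainQuad, Quad.mean_ofPair, meanGain, g_eq_sum, losRefl_eq_sum]
  have h1 : ∑ n, (S.xc k i * (S.e2 k * conj (S.bvec n) * ((1 : ℝ) * S.bvec n))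
      + S.yc k i * (if n = n then (S.e4 k : ℂ) * (S.mode n : ℂ) else 0)
      + S.wc k i * (if n = n then (1 : ℝ) * S.rmode n else 0) : ℂ) =
      S.xc k i * S.e2 k * (N - a) + S.yc k i * S.e4 k * a + S.wc k i * (N - a) := by
    simp only [if_true]
    rw [← S.sum_rmode, ← S.sum_mode_complex, Finset.mul_sum, Finset.mul_sum, Finset.mul_sum,
      ← Finset.sum_add_distrib, ← Finset.sum_add_distrib]
    refine Finset.sum_congr rfl fun n _ => ?_
    rw [← bvec_mul_conj]
    push_cast
    ring
  rw [h1]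
  split_ifs
  · push_cast
    ring
  · ring

/-- The variance of the mean gain given the user-RDARS channels. -/
def meanGainVar (k i : Fin K) : ℝ :=
  S.ε k * (S.xc k i ^ 2 * ‖S.f k‖ ^ 2 * ((N : ℝ) - a) + S.yc k i ^ 2 * a
      + S.wc k i ^ 2 * ((N : ℝ) - a) + 2 * S.xc k i * S.wc k i * ‖S.f k‖ ^ 2)
    + S.ε i * (S.xc k i ^ 2 * S.e2 k ^ 2 * ‖S.f i‖ ^ 2 * ((N : ℝ) - a)
      + S.yc k i ^ 2 * S.e4 k ^ 2 * a
      + S.wc k i ^ 2 * ((N : ℝ) - a) + 2 * S.xc k i * S.wc k i * S.e2 k * ‖S.f i‖ ^ 2)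
    + (S.xc k i ^ 2 * S.e2 k ^ 2 * ((N : ℝ) - a) ^ 2 + S.yc k i ^ 2 * S.e4 k ^ 2 * a
      + S.wc k i ^ 2 * ((N : ℝ) - a) + 2 * S.xc k i * S.wc k i * S.e2 k * ((N : ℝ) - a))

lemma bvec_of_mode {n : Fin N} (h : S.mode n = 1) : S.bvec n = 0 := by
  have := S.bvec_mul_mode n
  simpa [h] using this

lemma rmode_of_mode {n : Fin N} (h : S.mode n = 1) : S.rmode n = 0 := by simp [rmode, h]

lemma rmode_of_mode_eq_zero {n : Fin N} (h : S.mode n = 0) : S.rmode n = 1 := by simp [rmode, h]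

/-- The squared norm of a linear form whose coefficients mix the three kinds of entries. -/
lemma sum_mixed_sq (u x y w : ℂ) (k : Fin K) :
    ∑ n, (x * (u * S.bvec n) + y * (S.mode n * conj (S.hbar k n))
        + w * (S.rmode n * conj (S.hbar k n))) *
      conj (x * (u * S.bvec n) + y * (S.mode n * conj (S.hbar k n))
        + w * (S.rmode n * conj (S.hbar k n))) =
      x * conj x * (u * conj u) * (N - a) + y * conj y * a + w * conj w * (N - a)
        + x * conj w * u * S.f k + conj x * w * conj u * conj (S.f k) := by
  rw [f_eq_sum, map_sum, ← S.sum_rmode, ← S.sum_mode_complex, Finset.mul_sum, Finset.mul_sum,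
    Finset.mul_sum, Finset.mul_sum, Finset.mul_sum, ← Finset.sum_add_distrib,
    ← Finset.sum_add_distrib, ← Finset.sum_add_distrib, ← Finset.sum_add_distrib]
  refine Finset.sum_congr rfl fun n _ => ?_
  have h1 := S.hbar_mul_conj k n
  rcases S.mode_cases n with h | h
  · have h2 := S.bvec_mul_conj n
    rw [S.rmode_of_mode_eq_zero h] at h2 ⊢
    simp only [h, Complex.ofReal_zero, map_add, map_mul, map_zero, map_one, Complex.conj_conj]
    linear_combination (x * conj x * (u * conj u)) * h2 + w * conj w * h1
  · rw [S.rmode_of_mode h, S.bvec_of_mode h, h]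
    simp only [Complex.ofReal_one, map_add, map_mul, map_zero, map_one, Complex.conj_conj]
    linear_combination y * conj y * h1

/-- The squared Frobenius norm of the sesquilinear part. -/
lemma sum_mixed_frobenius (x y w : ℝ) (e : ℝ) (g : ℝ) :
    ∑ n, ∑ m, (x * (e * conj (S.bvec n) * ((1 : ℝ) * S.bvec m))
        + y * (if n = m then (g : ℂ) * (S.mode n : ℂ) else 0) + w * (if n = m then (1 : ℝ) * S.rmode n else 0)) *
      conj (x * (e * conj (S.bvec n) * ((1 : ℝ) * S.bvec m))
        + y * (if n = m then (g : ℂ) * (S.mode n : ℂ) else 0)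
        + w * (if n = m then (1 : ℝ) * S.rmode n else 0) : ℂ) =
      (x ^ 2 * e ^ 2 * (N - a) ^ 2 + y ^ 2 * g ^ 2 * a + w ^ 2 * (N - a)
        + 2 * x * w * e * (N - a) : ℂ) := by
  have h1 (n m : Fin N) : (x * (e * conj (S.bvec n) * ((1 : ℝ) * S.bvec m))
        + y * (if n = m then (g : ℂ) * (S.mode n : ℂ) else 0) + w * (if n = m then (1 : ℝ) * S.rmode n else 0)) *
      conj (x * (e * conj (S.bvec n) * ((1 : ℝ) * S.bvec m))
        + y * (if n = m then (g : ℂ) * (S.mode n : ℂ) else 0)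
        + w * (if n = m then (1 : ℝ) * S.rmode n else 0) : ℂ) =
      x ^ 2 * e ^ 2 * (S.rmode n * S.rmode m) + if n = m then
        y ^ 2 * g ^ 2 * S.mode n + (w ^ 2 + 2 * x * w * e) * S.rmode n else 0 := by
    have e1 := S.bvec_mul_conj n
    have e2 := S.bvec_mul_conj m
    by_cases hnm : n = m
    · subst hnm
      simp only [if_true, map_add, map_mul, Complex.conj_ofReal, Complex.conj_conj, conj_rmode]
      rcases S.mode_cases n with h | h
      · rw [S.rmode_of_mode_eq_zero h] at e1 ⊢
        rw [h]
        push_cast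
        linear_combination (x ^ 2 * e ^ 2 * (S.bvec n * conj (S.bvec n) + 1)
          + 2 * x * w * e) * e1
      · rw [S.rmode_of_mode h, S.bvec_of_mode h, h]
        simp
        ring
    · simp only [if_neg hnm, mul_zero, add_zero]
      rw [← e1, ← e2]
      simp only [map_mul, Complex.conj_ofReal, Complex.conj_conj]
      push_cast
      ring
  simp only [h1, Finset.sum_add_distrib, ← Finset.mul_sum, ← Finset.sum_mul, Finset.sum_ite_eq,
    Finset.mem_univ, if_true, sum_rmode, sum_mode_complex]
  ring

lemma cov_meanGainQuad (k i : Fin K) :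
    (S.meanGainQuad k i).cov (fun _ => 1) (S.meanGainQuad k i) = (S.meanGainVar k i : ℂ) := by
  have hp := S.sum_mixed_sq (Real.sqrt (S.ε k) * conj (S.f k)) (S.xc k i)
    (S.yc k i * Real.sqrt (S.ε k)) (S.wc k i * Real.sqrt (S.ε k)) k
  have hq := S.sum_mixed_sq (Real.sqrt (S.ε i) * conj (S.f i) * S.e2 k) (S.xc k i)
    (S.yc k i * Real.sqrt (S.ε i) * S.e4 k) (S.wc k i * Real.sqrt (S.ε i)) i
  have hk := S.sqrt_ε_mul k
  have hi := S.sqrt_ε_mul i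
  have fk : conj (S.f k) * S.f k = (‖S.f k‖ : ℂ) ^ 2 := Complex.conj_mul' _
  have fi : conj (S.f i) * S.f i = (‖S.f i‖ : ℂ) ^ 2 := Complex.conj_mul' _
  rw [meanGainQuad, Quad.cov_ofPair, if_pos rfl, if_pos rfl, if_pos ⟨rfl, rfl⟩,
    sum_mixed_frobenius]
  have h0 (n : Fin N) : S.xc k i * (Real.sqrt (S.ε k) * conj (S.f k) * S.bvec n)
        + S.yc k i * Real.sqrt (S.ε k) * (S.mode n * conj (S.hbar k n))
        + S.wc k i * Real.sqrt (S.ε k) * (S.rmode n * conj (S.hbar k n)) =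
      S.xc k i * (Real.sqrt (S.ε k) * conj (S.f k) * ((1 : ℝ) * S.bvec n))
        + S.yc k i * (Real.sqrt (S.ε k) * (S.mode n * conj (S.hbar k n)))
        + S.wc k i * (Real.sqrt (S.ε k) * (S.rmode n * conj (S.hbar k n))) := by
    push_cast
    ring
  have h3 (n : Fin N) : (S.xc k i * (Real.sqrt (S.ε i) * S.f i * (S.e2 k * conj (S.bvec n)))
      + S.yc k i * (S.e4 k * Real.sqrt (S.ε i) * (S.mode n * S.hbar i n))
      + S.wc k i * ((1 : ℝ) * Real.sqrt (S.ε i) * (S.rmode n * S.hbar i n)) : ℂ) =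
      conj (S.xc k i * (Real.sqrt (S.ε i) * conj (S.f i) * S.e2 k * S.bvec n)
        + S.yc k i * Real.sqrt (S.ε i) * S.e4 k * (S.mode n * conj (S.hbar i n))
        + S.wc k i * Real.sqrt (S.ε i) * (S.rmode n * conj (S.hbar i n))) := by
    simp only [map_add, map_mul, Complex.conj_ofReal, Complex.conj_conj, conj_rmode]
    push_cast
    ring
  have h1 : ∑ n, (S.xc k i * (Real.sqrt (S.ε k) * conj (S.f k) * ((1 : ℝ) * S.bvec n))
      + S.yc k i * (Real.sqrt (S.ε k) * (S.mode n * conj (S.hbar k n)))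
      + S.wc k i * (Real.sqrt (S.ε k) * (S.rmode n * conj (S.hbar k n)))) *
      conj (S.xc k i * (Real.sqrt (S.ε k) * conj (S.f k) * ((1 : ℝ) * S.bvec n))
      + S.yc k i * (Real.sqrt (S.ε k) * (S.mode n * conj (S.hbar k n)))
      + S.wc k i * (Real.sqrt (S.ε k) * (S.rmode n * conj (S.hbar k n)))) =
      (S.ε k * (S.xc k i ^ 2 * ‖S.f k‖ ^ 2 * (N - a) + S.yc k i ^ 2 * a
      + S.wc k i ^ 2 * (N - a) + 2 * S.xc k i * S.wc k i * ‖S.f k‖ ^ 2) : ℂ) := by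
    rw [← Finset.sum_congr rfl fun n _ => congrArg (fun v : ℂ => v * conj v) (h0 n), hp]
    simp only [map_mul, Complex.conj_ofReal, Complex.conj_conj]
    rw [← hk, ← fk]
    ring
  have h2 : ∑ n, (S.xc k i * (Real.sqrt (S.ε i) * S.f i * (S.e2 k * conj (S.bvec n)))
      + S.yc k i * (S.e4 k * Real.sqrt (S.ε i) * (S.mode n * S.hbar i n))
      + S.wc k i * ((1 : ℝ) * Real.sqrt (S.ε i) * (S.rmode n * S.hbar i n))) *
      conj (S.xc k i * (Real.sqrt (S.ε i) * S.f i * (S.e2 k * conj (S.bvec n)))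
      + S.yc k i * (S.e4 k * Real.sqrt (S.ε i) * (S.mode n * S.hbar i n))
      + S.wc k i * ((1 : ℝ) * Real.sqrt (S.ε i) * (S.rmode n * S.hbar i n))) =
      (S.ε i * (S.xc k i ^ 2 * S.e2 k ^ 2 * ‖S.f i‖ ^ 2 * (N - a)
      + S.yc k i ^ 2 * S.e4 k ^ 2 * a
      + S.wc k i ^ 2 * (N - a) + 2 * S.xc k i * S.wc k i * S.e2 k * ‖S.f i‖ ^ 2) : ℂ) := by
    rw [Finset.sum_congr rfl fun n _ => (congrArg (fun v : ℂ => v * conj v) (h3 n)).trans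
      ((mul_comm _ _).trans (congrArg (· * _) (Complex.conj_conj _))), hq]
    simp only [map_mul, Complex.conj_ofReal, Complex.conj_conj]
    rw [← hi, ← fi]
    ring
  rw [h1, h2, meanGainVar]
  push_cast
  ring

/-! ### Correlations of quadratic forms in the user-RDARS channels -/

lemma cov_alongQuad_fadeQuad (e : ℝ) (k i : Fin K) :
    (S.alongQuad e e k k).cov (fun _ => 1) (S.fadeQuad S.rmode 1 i i) =
      if k = i then ((2 * S.ε k * e * ‖S.f k‖ ^ 2 + e ^ 2 * ((N : ℝ) - a) : ℝ) : ℂ) else 0 := by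
  rw [alongQuad, fadeQuad, Quad.cov_ofPair]
  by_cases h : k = i
  · subst h
    simp only [if_true, and_self]
    have hk := S.sqrt_ε_mul k
    have fk : conj (S.f k) * S.f k = (‖S.f k‖ : ℂ) ^ 2 := Complex.conj_mul' _
    have h1 : ∑ n, (Real.sqrt (S.ε k) * conj (S.f k) * (e * S.bvec n)) *
        conj (Real.sqrt (S.ε k) * (S.rmode n * conj (S.hbar k n))) =
        (S.ε k * e * ‖S.f k‖ ^ 2 : ℂ) := by
      rw [← fk, ← hk, f_eq_sum, Finset.mul_sum, Finset.mul_sum]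
      refine Finset.sum_congr rfl fun n _ => ?_
      simp only [map_mul, Complex.conj_ofReal, Complex.conj_conj, conj_rmode]
      linear_combination (Real.sqrt (S.ε k) * Real.sqrt (S.ε k) *
        conj (∑ n, S.bvec n * S.hbar k n) * e * S.hbar k n) * S.bvec_mul_rmode n
    have h2 : ∑ n, (Real.sqrt (S.ε k) * S.f k * (e * conj (S.bvec n))) *
        conj ((1 : ℝ) * Real.sqrt (S.ε k) * (S.rmode n * S.hbar k n)) =
        (S.ε k * e * ‖S.f k‖ ^ 2 : ℂ) := by
      have h3 := congrArg conj h1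
      rw [map_sum] at h3
      simp only [map_mul, map_pow, Complex.conj_ofReal, Complex.conj_conj, conj_rmode] at h3
      rw [← h3]
      refine Finset.sum_congr rfl fun n _ => ?_
      simp only [map_mul, Complex.conj_ofReal, conj_rmode]
      push_cast
      ring
    have h4 : ∑ n, ∑ m, (e * conj (S.bvec n) * (e * S.bvec m) : ℂ) *
        conj (if n = m then (1 : ℝ) * S.rmode n else 0) = (e ^ 2 * (N - a) : ℂ) := by
      simp only [apply_ite conj, map_zero, mul_ite, mul_zero, Finset.sum_ite_eq, Finset.mem_univ,
        if_true]
      rw [← S.sum_rmode, Finset.mul_sum]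
      refine Finset.sum_congr rfl fun n _ => ?_
      rw [map_mul, conj_rmode, Complex.conj_ofReal]
      push_cast
      linear_combination e ^ 2 * S.rmode n * S.bvec_mul_conj n + e ^ 2 * S.rmode_mul_self n
    rw [h1, h2, h4]
    push_cast
    ring
  · simp [h]

lemma cov_fadeQuad_fadeQuad (k i : Fin K) :
    (S.fadeQuad S.rmode 1 k k).cov (fun _ => 1) (S.fadeQuad S.rmode 1 i i) =
      if k = i then (((2 * S.ε k + 1) * ((N : ℝ) - a) : ℝ) : ℂ) else 0 := by
  rw [fadeQuad, fadeQuad, Quad.cov_ofPair]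
  by_cases h : k = i
  · subst h
    simp only [if_true, and_self]
    have hk := S.sqrt_ε_mul k
    have h1 : ∑ n, (Real.sqrt (S.ε k) * (S.rmode n * conj (S.hbar k n))) *
        conj (Real.sqrt (S.ε k) * (S.rmode n * conj (S.hbar k n))) = (S.ε k * (N - a) : ℂ) := by
      rw [← sum_rmode, Finset.mul_sum]
      refine Finset.sum_congr rfl fun n _ => ?_
      simp only [map_mul, Complex.conj_ofReal, Complex.conj_conj, conj_rmode]
      linear_combination (S.ε k) * S.rmode_mul_self n + (S.rmode n * S.rmode n) * hk +
        (Real.sqrt (S.ε k) * Real.sqrt (S.ε k) * S.rmode n * S.rmode n) * S.hbar_mul_conj k n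
    have h2 : ∑ n, ((1 : ℝ) * Real.sqrt (S.ε k) * (S.rmode n * S.hbar k n)) *
        conj ((1 : ℝ) * Real.sqrt (S.ε k) * (S.rmode n * S.hbar k n)) =
        (S.ε k * (N - a) : ℂ) := by
      rw [← h1]
      refine Finset.sum_congr rfl fun n _ => ?_
      simp only [map_mul, Complex.conj_ofReal, Complex.conj_conj]
      push_cast
      ring
    have h4 : ∑ n, ∑ m, (if n = m then (1 : ℝ) * S.rmode n else 0) *
        conj (if n = m then (1 : ℝ) * S.rmode n else 0) = (N - a : ℂ) := by
      simp only [apply_ite conj, map_zero, mul_ite, mul_zero, ite_mul, zero_mul, Finset.sum_ite_eq,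
        Finset.mem_univ, if_true]
      rw [← S.sum_rmode]
      refine Finset.sum_congr rfl fun n _ => ?_
      rw [map_mul, conj_rmode, Complex.conj_ofReal]
      push_cast
      linear_combination S.rmode_mul_self n
    rw [h1, h2, h4]
    push_cast
    ring
  · simp [h]

section Model
variable [MeasurableSpace Ω] {μ : Measure Ω} [IsProbabilityMeasure μ] {S}

lemma IsModel.integral_along (hX : S.IsModel X μ) (e : ℝ) (k : Fin K) :
    ∫ ω, conj (S.along e k (X.outer ω)) * S.along e k (X.outer ω) ∂μ =
      ((S.ε k * ‖S.f k‖ ^ 2 + e ^ 2 * ((N : ℝ) - a) : ℝ) : ℂ) := by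
  simp_rw [← eval_alongQuad]
  rw [Quad.integral_eval hX.outer, mean_alongQuad_self, conj_f_mul_f]
  push_cast
  ring

lemma IsModel.integral_along_mul_fadeForm (hX : S.IsModel X μ) (e : ℝ) (k i : Fin K) :
    ∫ ω, (conj (S.along e k (X.outer ω)) * S.along e k (X.outer ω)) *
      S.fadeForm S.rmode 1 i i (X.outer ω) ∂μ =
      (((S.ε k * ‖S.f k‖ ^ 2 + e ^ 2 * ((N : ℝ) - a)) * ((S.ε i + 1) * ((N : ℝ) - a))
        + if k = i then 2 * S.ε k * e * ‖S.f k‖ ^ 2 + e ^ 2 * ((N : ℝ) - a) else 0 : ℝ) : ℂ) := by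
  have h := Quad.integral_eval_mul_conj hX.outer (S.alongQuad e e k k) (S.fadeQuad S.rmode 1 i i)
  simp only [eval_alongQuad, eval_fadeQuad, conj_fadeForm S _ S.conj_rmode] at h
  rw [h, mean_alongQuad_self, mean_fadeQuad_self, cov_alongQuad_fadeQuad, sum_rmode,
    conj_f_mul_f]
  simp only [map_mul, map_add, map_sub, Complex.conj_ofReal, map_one, map_natCast]
  split_ifs <;> push_cast <;> ring

lemma IsModel.integral_fadeForm_mul_fadeForm (hX : S.IsModel X μ) (k i : Fin K) :
    ∫ ω, S.fadeForm S.rmode 1 k k (X.outer ω) * S.fadeForm S.rmode 1 i i (X.outer ω) ∂μ =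
      (((S.ε k + 1) * ((N : ℝ) - a) * ((S.ε i + 1) * ((N : ℝ) - a))
        + if k = i then (2 * S.ε k + 1) * ((N : ℝ) - a) else 0 : ℝ) : ℂ) := by
  have h := Quad.integral_eval_mul_conj hX.outer (S.fadeQuad S.rmode 1 k k)
    (S.fadeQuad S.rmode 1 i i)
  simp only [eval_fadeQuad, conj_fadeForm S _ S.conj_rmode] at h
  rw [h, mean_fadeQuad_self, mean_fadeQuad_self, cov_fadeQuad_fadeQuad, sum_rmode]
  simp only [map_mul, map_add, map_sub, Complex.conj_ofReal, map_one, map_natCast]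
  split_ifs <;> push_cast <;> ring

end Model
end System
end

/-! ### Moments of the gain -/

section
variable {K L N a τ : ℕ} {Ω : Type*} {X : Randomness K L N a τ Ω}

namespace System
variable (S : System K L N a τ)

lemma g_self (k : Fin K) : S.g k k = a := by
  simp_rw [g_eq_sum, mul_comm (conj (S.hbar k _)), hbar_mul_conj, mul_one, sum_mode_complex]

lemma losRefl_self (k : Fin K) : S.losRefl k k = N - a := by
  simp_rw [losRefl_eq_sum, mul_comm (conj (S.hbar k _)), hbar_mul_conj, mul_one, sum_rmode]

/-- `E[|t_k|²]` for the component `t_k = along e k` of the user-RDARS channel. -/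
def alongPower (e : ℝ) (k : Fin K) : ℝ := S.ε k * ‖S.f k‖ ^ 2 + e ^ 2 * ((N : ℝ) - a)

/-- `E[|t_k|² ‖ξ_i‖²]` for the component `t_k = along e k` and the reflected channel `ξ_i`. -/
def alongFadePower (e : ℝ) (k i : Fin K) : ℝ :=
  S.alongPower e k * ((S.ε i + 1) * ((N : ℝ) - a))
    + if k = i then 2 * S.ε k * e * ‖S.f k‖ ^ 2 + e ^ 2 * ((N : ℝ) - a) else 0

/-- `E[‖ξ_k‖² ‖ξ_i‖²]` for the reflected channels `ξ_k`, `ξ_i`. -/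
def fadeFadePower (k i : Fin K) : ℝ :=
  (S.ε k + 1) * ((N : ℝ) - a) * ((S.ε i + 1) * ((N : ℝ) - a))
    + if k = i then (2 * S.ε k + 1) * ((N : ℝ) - a) else 0

/-- The expectation of the variance of the gain given the user-RDARS channels. -/
def meanCondVar (k i : Fin K) : ℝ :=
  L * S.c k * S.δ *
      (S.c i * S.alongFadePower (S.e2 k) k i + S.γ i * S.alongPower (S.e2 k) k)
    + L * S.c i * S.δ * S.e2 k ^ 2 *
      (S.c k * S.alongFadePower 1 i k + (S.γ k + S.sB) * S.alongPower 1 i)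
    + S.e4 k ^ 2 * S.sR * S.dc i * ((S.ε i + 1) * a)
    + L * S.e3 k * (S.c k * S.c i * S.fadeFadePower k i
      + S.c k * S.γ i * ((S.ε k + 1) * ((N : ℝ) - a))
      + (S.γ k + S.sB) * S.c i * ((S.ε i + 1) * ((N : ℝ) - a)) + (S.γ k + S.sB) * S.γ i)

section Model
variable [MeasurableSpace Ω] {μ : Measure Ω} [IsProbabilityMeasure μ] {S}

lemma IsModel.integral_cov_gainQuad (hX : S.IsModel X μ) (k i : Fin K) :
    HasMoments (fun ω => (S.gainQuad k i (X.outer ω)).cov S.innerVar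
      (S.gainQuad k i (X.outer ω))) μ ∧
    ∫ ω, (S.gainQuad k i (X.outer ω)).cov S.innerVar (S.gainQuad k i (X.outer ω)) ∂μ =
      (S.meanCondVar k i : ℂ) := by
  set A : ℝ → Fin K → Ω → ℂ := fun e k ω => conj (S.along e k (X.outer ω)) *
    S.along e k (X.outer ω) with hA
  set F : Fin K → Ω → ℂ := fun k ω => S.fadeForm S.rmode 1 k k (X.outer ω) with hF
  set G : Ω → ℂ := fun ω => S.fadeForm (fun n => S.mode n) 1 i i (X.outer ω) with hG
  have mA (e : ℝ) (k : Fin K) : HasMoments (A e k) μ := by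
    simp_rw [hA, ← eval_alongQuad]
    exact hX.hasMoments_outer _
  have mF (k : Fin K) : HasMoments (F k) μ := hX.hasMoments_fadeForm _ _ _ _
  have mG : HasMoments G μ := hX.hasMoments_fadeForm _ _ _ _
  have iA (e : ℝ) (k : Fin K) : ∫ ω, A e k ω ∂μ = (S.alongPower e k : ℂ) := hX.integral_along e k
  have iAF (e : ℝ) (k i : Fin K) : ∫ ω, A e k ω * F i ω ∂μ = (S.alongFadePower e k i : ℂ) :=
    hX.integral_along_mul_fadeForm e k i
  have iFF : ∫ ω, F k ω * F i ω ∂μ = (S.fadeFadePower k i : ℂ) :=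
    hX.integral_fadeForm_mul_fadeForm k i
  have iF (k : Fin K) : ∫ ω, F k ω ∂μ = (S.ε k + 1) * (N - a) := by
    rw [hX.integral_fadeForm, sum_rmode]
  have iG : ∫ ω, G ω ∂μ = (S.ε i + 1) * a := by
    rw [hX.integral_fadeForm, sum_mode_complex]
  have h1 (ω : Ω) : (S.gainQuad k i (X.outer ω)).cov S.innerVar (S.gainQuad k i (X.outer ω)) =
      (L * S.c k * S.δ * S.c i) * (A (S.e2 k) k ω * F i ω)
      + (L * S.c k * S.δ * S.γ i) * A (S.e2 k) k ω
      + (L * S.c i * S.δ * S.e2 k ^ 2 * S.c k) * (A 1 i ω * F k ω)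
      + (L * S.c i * S.δ * S.e2 k ^ 2 * (S.γ k + S.sB)) * A 1 i ω
      + (S.e4 k ^ 2 * S.sR * S.dc i) * G ω
      + (L * S.e3 k * S.c k * S.c i) * (F k ω * F i ω)
      + (L * S.e3 k * S.c k * S.γ i) * F k ω
      + (L * S.e3 k * (S.γ k + S.sB) * S.c i) * F i ω
      + L * S.e3 k * (S.γ k + S.sB) * S.γ i := by
    rw [cov_gainQuad]
    simp only [hA, hF, hG]
    ring
  have c {U : Ω → ℂ} (hU : HasMoments U μ) (x : ℂ) : HasMoments (fun ω => x * U ω) μ :=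
    (hasMoments_const x).mul hU
  have m1 := c ((mA (S.e2 k) k).mul (mF i)) (L * S.c k * S.δ * S.c i)
  have m2 := m1.add (c (mA (S.e2 k) k) (L * S.c k * S.δ * S.γ i))
  have m3 := m2.add (c ((mA 1 i).mul (mF k)) (L * S.c i * S.δ * S.e2 k ^ 2 * S.c k))
  have m4 := m3.add (c (mA 1 i) (L * S.c i * S.δ * S.e2 k ^ 2 * (S.γ k + S.sB)))
  have m5 := m4.add (c mG (S.e4 k ^ 2 * S.sR * S.dc i))
  have m6 := m5.add (c ((mF k).mul (mF i)) (L * S.e3 k * S.c k * S.c i))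
  have m7 := m6.add (c (mF k) (L * S.e3 k * S.c k * S.γ i))
  have m8 := m7.add (c (mF i) (L * S.e3 k * (S.γ k + S.sB) * S.c i))
  simp_rw [h1]
  refine ⟨m8.add (hasMoments_const _), ?_⟩
  rw [integral_add m8.integrable (hasMoments_const _).integrable,
    integral_add m7.integrable (c (mF i) _).integrable,
    integral_add m6.integrable (c (mF k) _).integrable,
    integral_add m5.integrable (c ((mF k).mul (mF i)) _).integrable,
    integral_add m4.integrable (c mG _).integrable,
    integral_add m3.integrable (c (mA 1 i) _).integrable,
    integral_add m2.integrable (c ((mA 1 i).mul (mF k)) _).integrable,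
    integral_add m1.integrable (c (mA (S.e2 k) k) _).integrable]
  simp only [integral_const_mul, integral_const, probReal_univ, one_smul]
  rw [iA, iA, iAF, iAF, iF, iF, iG, iFF, meanCondVar]
  push_cast
  ring

lemma IsModel.gain_eq_eval (hX : S.IsModel X μ) (k i : Fin K) (ω : Ω) :
    S.gain X μ k i ω = (S.gainQuad k i (X.outer ω)).eval fun s => X.inner s ω := by
  rw [← eval_gainQuad, gain, dotProduct]
  refine Finset.sum_congr rfl fun j _ => ?_
  rw [← q_eq_eval, ← hX.qhat_eq_eval]
  rfl

lemma tame_fadeForm (hX : S.IsModel X μ) (χ : Fin N → ℂ) (g : ℝ) (k i : Fin K) :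
    Tame X.outer μ (S.fadeForm χ g k i) :=
  Tame.sum fun n => (Tame.const _).mul ((S.tame_fade hX g k n).star.mul (S.tame_fade hX 1 i n))

lemma tame_gainQuad (hX : S.IsModel X μ) (k i : Fin K) :
    Quad.Tame X.outer μ (S.gainQuad k i) := by
  have t (s : Fin L × Col K N τ) (k : Fin K) (κ : ℝ) := S.tame_weight hX κ k s.2
  refine ⟨?_, ?_, ?_, ?_⟩
  · exact ((Tame.const _).mul ((S.tame_along hX _ k).star.mul (S.tame_along hX 1 i))).add
      ((Tame.const _).mul (tame_fadeForm hX _ _ k i))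
  · rintro (s | s)
    · exact ((Tame.const _).mul (S.tame_along hX _ k).star).mul ((Tame.const _).mul (t s i 0))
    · exact Tame.const _
  · rintro (s | s)
    · exact ((Tame.const _).mul (S.tame_along hX 1 i)).mul ((Tame.const _).mul (t s k 1).star)
    · exact (Tame.const _).mul ((Tame.sum fun n => (Tame.const _).mul
        (S.tame_fade hX 1 i n)).mul (Tame.const _))
  · rintro (s | s) (s' | s')
    · exact (Tame.const _).mul ((t s k 1).star.mul (t s' i 0))
    · exact Tame.const _
    · exact Tame.const _
    · exact Tame.const _

lemma IsModel.integral_gain (hX : S.IsModel X μ) (k i : Fin K) :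
    ∫ ω, S.gain X μ k i ω ∂μ = S.meanGain k i := by
  simp_rw [hX.gain_eq_eval]
  rw [(tame_gainQuad hX k i).integral_eval hX.inner hX.aemeasurable_outer hX.indepFun]
  simp_rw [← eval_meanGainQuad]
  rw [Quad.integral_eval hX.outer, mean_meanGainQuad]

/-- The second moment of the gain, by the law of total variance. -/
lemma IsModel.integral_norm_gain_sq (hX : S.IsModel X μ) (k i : Fin K) :
    ∫ ω, ‖S.gain X μ k i ω‖ ^ 2 ∂μ =
      ‖S.meanGain k i‖ ^ 2 + (S.meanGainVar k i + S.meanCondVar k i) := by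
  have h1 := (tame_gainQuad hX k i).integral_eval_mul_conj (tame_gainQuad hX k i)
    hX.inner hX.aemeasurable_outer hX.indepFun
  simp_rw [← hX.gain_eq_eval, ← eval_meanGainQuad] at h1
  obtain ⟨m, hm⟩ := hX.integral_cov_gainQuad k i
  have m' := hX.hasMoments_outer (S.meanGainQuad k i)
  rw [integral_add (m'.mul m'.conj).integrable m.integrable, hm,
    Quad.integral_eval_mul_conj hX.outer, mean_meanGainQuad, cov_meanGainQuad] at h1
  simp_rw [Complex.mul_conj', ← Complex.ofReal_pow] at h1
  rw [integral_complex_ofReal] at h1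
  rw [← add_assoc]
  exact_mod_cast h1

end Model

/-! ### Comparison with the closed forms -/

lemma xc_self (k : Fin K) : S.xc k k = L * S.c k * S.δ := by rw [xc, ← rc_sq]; ring

lemma yc_self (k : Fin K) : S.yc k k = S.dc k := by rw [yc, ← rd_sq]; ring

lemma wc_self (k : Fin K) : S.wc k k = L * S.e1 k * S.c k := by rw [wc, ← rc_sq]; ring

lemma norm_meanGain_self_sq (k : Fin K) : ‖S.meanGain k k‖ ^ 2 = S.Esignal k := by
  have h1 : S.meanGain k k =
      ((L * (‖S.f k‖ ^ 2 * S.c k * S.δ * S.ε k + ((N : ℝ) - a) * S.c k * S.δ * S.e2 k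
        + (((N : ℝ) - a) * S.c k * (S.ε k + 1) + S.γ k) * S.e1 k)
    + a * (S.dc k * S.ε k + S.e4 k * S.dc k) : ℝ) : ℂ) := by
    rw [meanGain, if_pos rfl, sqrt_ε_mul, conj_f_mul_f, g_self, losRefl_self, xc_self, yc_self,
      wc_self]
    push_cast
    ring
  rw [h1, Complex.norm_real, Real.norm_eq_abs, sq_abs, Esignal]

lemma gainVar_self (k : Fin K) : S.meanGainVar k k + S.meanCondVar k k = S.Eleak k := by
  simp only [meanGainVar, meanCondVar, alongFadePower, alongPower, fadeFadePower, if_true, xc_self,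
    yc_self, wc_self, Eleak]
  ring

lemma norm_meanGain_sq {k i : Fin K} (h : k ≠ i) : ‖S.meanGain k i‖ ^ 2 =
    S.ε k * S.ε i * (S.xc k i ^ 2 * ‖S.f k‖ ^ 2 * ‖S.f i‖ ^ 2 + S.yc k i ^ 2 * ‖S.g k i‖ ^ 2
      + S.wc k i ^ 2 * ‖S.losRefl k i‖ ^ 2
      + 2 * S.xc k i * S.wc k i * (conj (S.f k) * S.f i * S.losRefl i k).re
      + 2 * S.yc k i * S.xc k i * (conj (S.f k) * S.f i * S.g i k).re
      + 2 * S.yc k i * S.wc k i * (S.losRefl k i * S.g i k).re) := by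
  have h1 (z : ℂ) : ((z.re : ℝ) : ℂ) = (z + conj z) / 2 := Complex.re_eq_add_conj z
  have hk := S.sqrt_ε_mul k
  have hi := S.sqrt_ε_mul i
  rw [meanGain, if_neg h, add_zero, ← Complex.ofReal_inj]
  push_cast
  simp only [h1, ← Complex.mul_conj', map_mul, map_add, Complex.conj_ofReal, Complex.conj_conj,
    ← S.conj_g k i, ← S.conj_losRefl k i]
  rw [← hk, ← hi]
  ring

/-- The interference term is the full second moment of the gain. It includes the squared mean, which
for `i ≠ k` comes only from the overlap of the lines of sight of the two users. -/
lemma gainVar_eq {k i : Fin K} (h : i ≠ k) :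
    ‖S.meanGain k i‖ ^ 2 + (S.meanGainVar k i + S.meanCondVar k i) = S.Iint k i := by
  have hx : S.xc k i ^ 2 = L ^ 2 * S.δ ^ 2 * S.c k * S.c i := by
    rw [xc, ← rc_sq, ← rc_sq]; ring
  have hy : S.yc k i ^ 2 = S.dc k * S.dc i := by rw [yc, ← rd_sq, ← rd_sq]; ring
  have hw : S.wc k i ^ 2 = L ^ 2 * S.e1 k ^ 2 * S.c k * S.c i := by
    rw [wc, ← rc_sq, ← rc_sq]; ring
  have hxw : S.xc k i * S.wc k i = L ^ 2 * S.e1 k * S.δ * S.c k * S.c i := by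
    rw [xc, wc, ← rc_sq, ← rc_sq]; ring
  have hs : Real.sqrt (S.c k * S.c i * S.dc k * S.dc i) =
      S.rc k * S.rc i * S.rd k * S.rd i := by
    rw [← rc_sq, ← rc_sq, ← rd_sq, ← rd_sq, ← mul_pow, ← mul_pow, ← mul_pow, Real.sqrt_sq]
    exact mul_nonneg (mul_nonneg (mul_nonneg (S.rc_nonneg k) (S.rc_nonneg i)) (S.rd_nonneg k))
      (S.rd_nonneg i)
  have hyx : S.yc k i * S.xc k i = L * Real.sqrt (S.c k * S.c i * S.dc k * S.dc i) * S.δ := by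
    rw [hs, yc, xc]; ring
  have hyw : S.yc k i * S.wc k i =
      L * Real.sqrt (S.c k * S.c i * S.dc k * S.dc i) * S.e1 k := by
    rw [hs, yc, wc]; ring
  rw [norm_meanGain_sq S h.symm, Iint, losAll_sub_g]
  simp only [meanGainVar, meanCondVar, alongFadePower, alongPower, fadeFadePower, if_neg h,
    if_neg h.symm, add_zero, hx, hy, hw, hxw, hyx, hyw, mul_assoc (2 : ℝ)]
  simp only [Complex.add_re, mul_assoc, Complex.re_ofReal_mul]
  ring

end System
end

section
variable {K L N a τ : ℕ} {Ω : Type*} {X : Randomness K L N a τ Ω}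

namespace System
variable (S : System K L N a τ)

/-! ### The denominator -/

lemma a3_nonneg (k : Fin K) : 0 ≤ S.a3 k := by
  have h1 := S.a1_nonneg k
  have h2 := S.a2_nonneg k
  have h3 := S.sB_pos k
  unfold a3
  positivity

lemma a4_nonneg (k : Fin K) : 0 ≤ S.a4 k :=
  div_nonneg (S.a2_nonneg k) (add_nonneg (S.a2_nonneg k) (S.sB_pos k).le)

lemma e1_nonneg (k : Fin K) : 0 ≤ S.e1 k := add_nonneg (S.a3_nonneg k) (S.a4_nonneg k)

lemma e2_nonneg (k : Fin K) : 0 ≤ S.e2 k :=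
  add_nonneg (mul_nonneg (Nat.cast_nonneg _) (S.a3_nonneg k)) (S.a4_nonneg k)

lemma e3_nonneg (k : Fin K) : 0 ≤ S.e3 k := by
  have h1 := S.a3_nonneg k
  have h2 := S.a4_nonneg k
  unfold e3
  positivity

lemma e4_nonneg (k : Fin K) : 0 ≤ S.e4 k :=
  div_nonneg (S.dc_nonneg k) (add_nonneg (S.dc_nonneg k) (S.sR_pos k).le)

lemma e1_pos {k : Fin K} (h : 0 < S.a2 k) : 0 < S.e1 k :=
  add_pos_of_nonneg_of_pos (S.a3_nonneg k) (div_pos h (add_pos h (S.sB_pos k)))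

lemma e4_pos {k : Fin K} (h : 0 < S.dc k) : 0 < S.e4 k := div_pos h (add_pos h (S.sR_pos k))

lemma Eleak_nonneg (k : Fin K) : 0 ≤ S.Eleak k := by
  have h1 := S.e1_nonneg k
  have h2 := S.e2_nonneg k
  have h3 := S.e3_nonneg k
  have h4 := S.e4_nonneg k
  have h5 := S.c_nonneg k
  have h6 := S.dc_nonneg k
  have h7 := S.γ_nonneg k
  have h8 := S.ε_nonneg k
  have h9 := S.δ_nonneg
  have hB := (S.sB_pos k).le
  have hR := (S.sR_pos k).le
  have hM := S.M_nonneg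
  unfold Eleak
  generalize (N : ℝ) - a = M at hM
  positivity

lemma Enoise_pos {k : Fin K} (h : 0 < S.γ k ∨ (0 < S.α k ∧ 0 < S.β ∧ 0 < N)) :
    0 < S.Enoise k := by
  have h1 := S.e1_nonneg k
  have h2 := S.e2_nonneg k
  have h4 := S.e4_nonneg k
  have h5 := S.c_nonneg k
  have h6 := S.dc_nonneg k
  have h7 := S.γ_nonneg k
  have h8 := S.ε_nonneg k
  have h9 := S.δ_nonneg
  have hM := S.M_nonneg
  have hL : (0 : ℝ) < L := by exact_mod_cast S.L_pos
  have hσB := S.σB_pos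
  have hσR := S.σR_pos
  have ha2 := S.a2_nonneg k
  have hP : 0 ≤ ‖S.f k‖ ^ 2 * S.c k * S.δ * S.ε k + ((N : ℝ) - a) * S.c k * S.δ * S.e2 k := by
    positivity
  have hQ : 0 ≤ S.dc k * S.ε k := by positivity
  have hE : S.Enoise k = S.σB ^ 2 * L * (‖S.f k‖ ^ 2 * S.c k * S.δ * S.ε k
      + ((N : ℝ) - a) * S.c k * S.δ * S.e2 k + S.a2 k * S.e1 k)
      + S.σR ^ 2 * a * (S.dc k * S.ε k + S.e4 k * S.dc k) := rfl
  -- either the BS receives power from the user, or all elements are connected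
  have hcase : 0 < S.a2 k ∨ (0 < S.dc k ∧ 0 < a) := by
    rcases h with h | ⟨hα, hβ, hN⟩
    · left
      unfold a2
      positivity
    · have hd : 0 < S.dc k := by unfold dc; positivity
      rcases Nat.eq_zero_or_pos a with h0 | h0
      · left
        have hc : 0 < S.c k := by unfold c; positivity
        have : (0 : ℝ) < (N : ℝ) - a := by
          rw [h0]
          simpa using hN
        unfold a2
        positivity
      · exact Or.inr ⟨hd, h0⟩
  rw [hE]
  rcases hcase with h | ⟨h, h0⟩
  · have := S.e1_pos h
    positivity
  · have := S.e4_pos h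
    have h0' : (0 : ℝ) < a := by exact_mod_cast h0
    positivity

/-! ### Special cases -/

section NoConnected
variable (S : System K L N 0 τ)

lemma mode_of_none (n : Fin N) : S.mode n = 0 := by simp [mode, Matrix.mul_apply]

lemma f_of_none (k : Fin K) : S.f k = S.fRis k := by
  have h : S.refl = 1 := by simp [refl_eq, mode_of_none]
  rw [f_eq, B, h, one_mul, fRis]

lemma g_of_none (k i : Fin K) : S.g k i = 0 := by simp [g, mode_of_none]

lemma losRefl_of_none (k i : Fin K) : S.losRefl k i = S.losAll k i := by
  rw [← losAll_sub_g, g_of_none, sub_zero]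

lemma closedSinr_of_none (k : Fin K) : S.closedSinr k = S.risSinr k := by
  have h1 : S.Esignal k = S.risPower k ^ 2 := by simp [Esignal, risPower, f_of_none]
  have h2 : S.Enoise k = S.σB ^ 2 * S.risPower k := by
    simp only [Enoise, risPower, f_of_none, Nat.cast_zero, sub_zero]
    ring
  have h3 : S.Eleak k = S.risLeak k := by simp [Eleak, risLeak, f_of_none]
  have h4 (i : Fin K) : S.Iint k i = S.risInt k i := by
    simp [Iint, risInt, f_of_none, g_of_none, losRefl_of_none]
  rw [closedSinr, closedDenom, risSinr, h1, h2, h3]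
  simp_rw [h4]

end NoConnected

section AllConnected
variable (S : System K L N N τ)

lemma mode_of_all (n : Fin N) : S.mode n = 1 := by
  have h1 : ∑ n, (1 - S.mode n) = 0 := by simp [S.sum_mode]
  have h2 := (Finset.sum_eq_zero_iff_of_nonneg fun n _ => by
    rcases S.mode_cases n with h | h <;> simp [h]).1 h1 n (Finset.mem_univ n)
  linarith

lemma f_of_all (k : Fin K) : S.f k = 0 := by simp [f, mode_of_all]

lemma losRefl_of_all (k i : Fin K) : S.losRefl k i = 0 := by
  simp [losRefl_eq_sum, rmode, mode_of_all]

lemma g_of_all (k i : Fin K) : S.g k i = S.losAll k i :=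
  (sub_eq_zero.1 ((S.losAll_sub_g k i).trans (S.losRefl_of_all k i))).symm

lemma closedSinr_of_all (k : Fin K) : S.closedSinr k = S.dasSinr k := by
  have h0 : (S.γ k + S.sB) * S.eDir k ^ 2 = S.γ k * S.eDir k := by
    have h1 := S.γ_nonneg k
    have h2 := S.sB_pos k
    have h3 : S.γ k + S.sB ≠ 0 := by positivity
    rw [eDir]
    field_simp
  have ha3 : S.a3 k = 0 := by simp [a3, a1]
  have ha4 : S.a4 k = S.eDir k := by simp [a4, a2, eDir]
  have he1 : S.e1 k = S.eDir k := by rw [e1, ha3, ha4, zero_add]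
  have he3 : S.e3 k = S.eDir k ^ 2 := by rw [e3, ha3, ha4]; ring
  have h1 : S.Esignal k = (L * S.γ k * S.eDir k + N * S.dc k * (S.ε k + S.e4 k)) ^ 2 := by
    simp only [Esignal, f_of_all, he1, sub_self, norm_zero]
    ring
  have h2 : S.Enoise k =
      S.σB ^ 2 * L * S.γ k * S.eDir k + S.σR ^ 2 * N * S.dc k * (S.ε k + S.e4 k) := by
    simp only [Enoise, f_of_all, he1, sub_self, norm_zero]
    ring
  have h3 : S.Eleak k = L * S.γ k ^ 2 * S.eDir k + N * S.dc k ^ 2 * S.ε k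
        + N * S.dc k * (S.ε k + 1) * (S.dc k + S.sR) * S.e4 k ^ 2 := by
    simp only [Eleak, f_of_all, he1, he3, sub_self, norm_zero]
    linear_combination L * S.γ k * h0
  have h4 (i : Fin K) : S.Iint k i = L * S.γ i * S.γ k * S.eDir k
      + S.dc k * S.dc i * S.ε k * S.ε i * ‖S.losAll k i‖ ^ 2
      + N * S.dc i * (S.dc k * S.ε k + (S.ε i + 1) * (S.dc k + S.sR) * S.e4 k ^ 2) := by
    simp only [Iint, f_of_all, losRefl_of_all, g_of_all, he1, he3, sub_self, norm_zero, map_zero,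
      mul_zero, zero_mul, add_zero, Complex.zero_re]
    linear_combination L * S.γ i * h0
  rw [closedSinr, closedDenom, dasSinr, h1, h2, h3, ← add_assoc]
  simp_rw [h4]

end AllConnected

/-- Without an RDARS, the common factor `L γ_k e_k` of numerator and denominator cancels. -/
lemma dasSinr_of_empty (S : System K L 0 0 τ) (k : Fin K) : S.dasSinr k = S.mimoSinr k := by
  set C := L * S.γ k * S.eDir k with hC
  have h1 : S.dasSinr k = C * (S.p k * C) / (C * (∑ i, S.p i * S.γ i + S.σB ^ 2)) := by
    rw [← Finset.add_sum_erase _ _ (Finset.mem_univ k), dasSinr]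
    have hl (i : Fin K) : S.losAll k i = 0 := by simp [losAll, dotProduct]
    have h2 : ∑ i ∈ Finset.univ.erase k, S.p i *
          (L * S.γ i * S.γ k * S.eDir k + S.dc k * S.dc i * S.ε k * S.ε i * ‖S.losAll k i‖ ^ 2
            + (0 : ℕ) * S.dc i * (S.dc k * S.ε k + (S.ε i + 1) * (S.dc k + S.sR) * S.e4 k ^ 2)) =
        C * ∑ i ∈ Finset.univ.erase k, S.p i * S.γ i := by
      rw [Finset.mul_sum]
      refine Finset.sum_congr rfl fun i _ => ?_
      rw [hl, norm_zero, hC]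
      push_cast
      ring
    rw [h2]
    congr 1
    · rw [hC]; push_cast; ring
    · rw [hC]; push_cast; ring
  rw [h1, mimoSinr]
  by_cases h : C = 0
  · rw [show S.p k * L * S.γ k * S.eDir k = S.p k * C by rw [hC]; ring, h]
    simp
  · rw [mul_div_mul_left _ _ h, hC]
    congr 1
    ring

section Model
variable [MeasurableSpace Ω] {μ : Measure Ω} [IsProbabilityMeasure μ] {S}

lemma IsModel.norm_integral_gain_sq (hX : S.IsModel X μ) (k : Fin K) :
    ‖∫ ω, S.gain X μ k k ω ∂μ‖ ^ 2 = S.Esignal k := by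
  rw [hX.integral_gain, norm_meanGain_self_sq]

lemma IsModel.leak_eq (hX : S.IsModel X μ) (k : Fin K) :
    (∫ ω, ‖S.gain X μ k k ω‖ ^ 2 ∂μ) - ‖∫ ω, S.gain X μ k k ω ∂μ‖ ^ 2 = S.Eleak k := by
  rw [hX.integral_gain, hX.integral_norm_gain_sq, add_sub_cancel_left, gainVar_self]

lemma IsModel.interference_eq (hX : S.IsModel X μ) {k i : Fin K} (h : i ≠ k) :
    ∫ ω, ‖S.gain X μ k i ω‖ ^ 2 ∂μ = S.Iint k i := by
  rw [hX.integral_norm_gain_sq, gainVar_eq S h]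

lemma IsModel.closedDenom_pos (hX : S.IsModel X μ) {k : Fin K}
    (h : 0 < S.γ k ∨ (0 < S.α k ∧ 0 < S.β ∧ 0 < N)) : 0 < S.closedDenom k := by
  refine add_pos_of_nonneg_of_pos (add_nonneg (mul_nonneg (S.p_nonneg k) (S.Eleak_nonneg k))
    (Finset.sum_nonneg fun i hi => mul_nonneg (S.p_nonneg i) ?_)) (S.Enoise_pos h)
  rw [← hX.interference_eq (Finset.ne_of_mem_erase hi)]
  exact integral_nonneg fun ω => by positivity

lemma IsModel.sinr_eq (hX : S.IsModel X μ) (k : Fin K) : S.sinr X μ k = S.closedSinr k := by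
  rw [sinr, hX.leak_eq, hX.norm_integral_gain_sq, hX.integral_noiseForm, Complex.ofReal_re,
    Finset.sum_congr rfl fun i hi => congrArg (S.p i * ·)
      (hX.interference_eq (Finset.ne_of_mem_erase hi)), closedSinr, closedDenom]

end Model
end System
end

end
end RDARS

theorem theorem2 {K L N a τ : ℕ} (S : RDARS.System K L N a τ)
    {Ω : Type*} [MeasurableSpace Ω] (μ : MeasureTheory.Measure Ω)
    [MeasureTheory.IsProbabilityMeasure μ]
    (X : RDARS.Randomness K L N a τ Ω) (hX : S.IsModel X μ) (k : Fin K) :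
    -- the LMMSE estimate and all expectations in the SINR are well defined
    (∀ j, MeasureTheory.MemLp (fun ω => S.q X k ω j) 2 μ) ∧
    (∀ j, MeasureTheory.MemLp (fun ω => S.y X k ω j) 2 μ) ∧
    IsUnit (RDARS.cov μ (S.y X k) (S.y X k)).det ∧
    (∀ i, MeasureTheory.MemLp (S.gain X μ k i) 2 μ) ∧
    MeasureTheory.Integrable (S.noiseForm X μ k) μ ∧
    -- closed forms of the signal, noise, leakage and interference terms
    ‖∫ ω, S.gain X μ k k ω ∂μ‖ ^ 2 = S.Esignal k ∧
    ∫ ω, S.noiseForm X μ k ω ∂μ = (S.Enoise k : ℂ) ∧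
    (∫ ω, ‖S.gain X μ k k ω‖ ^ 2 ∂μ) - ‖∫ ω, S.gain X μ k k ω ∂μ‖ ^ 2 = S.Eleak k ∧
    (∀ i, i ≠ k → ∫ ω, ‖S.gain X μ k i ω‖ ^ 2 ∂μ = S.Iint k i) ∧
    -- the SINR and the rate
    (0 < S.γ k ∨ (0 < S.α k ∧ 0 < S.β ∧ 0 < N) → 0 < S.closedDenom k) ∧
    S.sinr X μ k = S.closedSinr k ∧
    (∀ b : ℝ, 1 < b →
      S.rate X μ b k = ((S.τc : ℝ) - τ) / τ * Real.logb b (1 + S.closedSinr k)) ∧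
    -- the explicit sums `f` and `g` in terms of the array responses
    (∀ i, S.f i = star S.aN ⬝ᵥ (S.B.mulVec (S.hbar i))) ∧
    (∀ i, S.g k i = star (S.hbar k) ⬝ᵥ ((S.Ac.conjTranspose * S.Ac).mulVec (S.hbar i))) ∧
    -- special cases: RIS-aided system, distributed antenna system, conventional massive MIMO
    (a = 0 → S.sinr X μ k = S.risSinr k) ∧
    (a = N → S.sinr X μ k = S.dasSinr k) ∧
    (N = 0 → S.sinr X μ k = S.mimoSinr k) := by
  have hS := hX.sinr_eq k
  refine ⟨fun j => (hX.hasMoments_q k j).memLp, fun j => (hX.hasMoments_y k j).memLp, ?_,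
    fun i => (hX.hasMoments_gain k i).memLp, (hX.hasMoments_noiseForm k).integrable,
    hX.norm_integral_gain_sq k, hX.integral_noiseForm k, hX.leak_eq k,
    fun i h => hX.interference_eq h, hX.closedDenom_pos, hS, fun b _ => ?_, S.f_eq, S.g_eq k,
    ?_, ?_, ?_⟩
  · rw [hX.cov_y_y]
    exact S.isUnit_det_obsCov k
  · rw [RDARS.System.rate, hS]
  · rintro rfl
    rw [hS, S.closedSinr_of_none]
  · rintro rfl
    rw [hS, S.closedSinr_of_all]
  · rintro rfl
    obtain rfl := Nat.le_zero.1 S.a_le_N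
    rw [hS, S.closedSinr_of_all, S.dasSinr_of_empty]
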